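/- For $d\ge 1$, a simple random walk on $\mathbb Z^d$ is a process $(S_n)_{n\ge 0}$ with $S_0=0$ whose increments $S_{n+1}-S_n$, $n\ge 0$, are independent and uniformly distributed on the $2d$ nearest neighbours of the origin; its range is $R_\infty=\{S_n : n\ge 0\}$. Let $R_\infty^1,R_\infty^2,\dots$ be the ranges of independent simple random walks on $\mathbb Z^d$, all started at the origin. (i) If $d\ge 5$, then for every $k\ge 2$ there exist constants $c_1,c_2>0$ (depending only on $d$ and $k$) such that for every real $t>1$, $$\exp\big(-c_1\, t^{1-\frac 2d}\big)\le \mathbb P\big(|R_\infty^1\cap\dots\cap R_\infty^k|>t\big)\le \exp\big(-c_2\, t^{1-\frac 2d}\big).$$ (ii) If $d=4$, then for every $k\ge 3$ there exist constants $c_1,c_2>0$ (depending only on $k$) such that for every real $t>e$, $$\exp\big(-c_1\sqrt t\big)\le \mathbb P\big(|R_\infty^1\cap\dots\cap R_\infty^k|>t\big)\le \exp\Big(-c_2\Big(\frac{t}{\log t}\Big)^{1/2}\Big).$$ (iii) If $d=3$, then for every $k\ge 4$ there exist constants $c_1,c_2>0$ (depending only on $k$) such that for every real $t>e$, $$\exp\big(-c_1\,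 t^{1/3}\big)\le \mathbb P\big(|R_\infty^1\cap\dots\cap R_\infty^k|>t\big)\le \exp\Big(-c_2\Big(\frac{t}{\log t}\Big)^{1/3}\Big).$$ -/

import Mathlib

open MeasureTheory ProbabilityTheory

/-- The `2 * d` nearest neighbours of the origin in the lattice `ℤ ^ d`. -/
def originNeighbors (d : ℕ) : Set (Fin d → ℤ) := {e | ∑ i, |e i| = 1}

/-- `S` is a simple random walk on `ℤ ^ d` started at the origin: its increments are independent
and uniformly distributed on the nearest neighbours of the origin. -/
structure IsSimpleRandomWalk {Ω : Type*} [MeasurableSpace Ω] (μ : Measure Ω) {d : ℕ}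
    (S : ℕ → Ω → (Fin d → ℤ)) : Prop where
  measurable : ∀ n, Measurable (S n)
  start : ∀ ω, S 0 ω = 0
  indep_increments : iIndepFun (fun n ω => S (n + 1) ω - S n ω) μ
  law_increment : ∀ n, μ.map (fun ω => S (n + 1) ω - S n ω) = uniformOn (originNeighbors d)

/-- `S 0, …, S (k - 1)` are (mutually) independent simple random walks on `ℤ ^ d` started at the
origin; independence is that of the whole trajectories. -/
structure AreIndepSimpleRandomWalks {Ω : Type*} [MeasurableSpace Ω] (μ : Measure Ω) {d k : ℕ}
    (S : Fin k → ℕ → Ω → (Fin d → ℤ)) : Prop where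
  walk : ∀ i, IsSimpleRandomWalk μ (S i)
  indep : iIndepFun (fun i ω n => S i n ω) μ

/-- The event that the ranges (over the infinite time horizon) of the walks `S i` have more than
`t` points in common. The number of common points is allowed to be infinite. -/
def rangesIntersectionGT {Ω : Type*} {d k : ℕ} (S : Fin k → ℕ → Ω → (Fin d → ℤ)) (t : ℝ) :
    Set Ω :=
  {ω | ENNReal.ofReal t < ((⋂ i, Set.range (fun n => S i n ω)).encard : ENNReal)}

/-! Upper bound. Let r be the scale at which r ^ d is of order t, up to a logarithm when d is 3 or
4; the target probability is exp (-c r ^ (d - 2)). If the Green potential of a finite set A is at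
most g everywhere, the number of visits of one walk to A has an exponential moment at rate 1 / (2g)
(`IsGreenBound.mean_exp_visits_le`), so the range meets A in at least 2gv points with probability at
most 2 exp (-v). The ranges are now revealed one after another. If the intersection of the first m
ranges has at most f j points in every ball of radius 2 ^ j centred in it, then its potential inside
a ball of radius 2 ^ i is at most a constant times the sum over j ≤ i + 1 of f j / 2 ^ (j (d - 2)),
and with high probability the next intersection has at most v times as many points there, up to a
constant. This is the recursion `growthSeq`, used with v of order r ^ (d - 2). Each walk lowers the
growth: from 2 ^ (jd) to 4 ^ j, and so on, until after `critWalks d` walks the series converges. In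
that last sum the scales below r are controlled by volume alone and those above r by the recursion;
both give r ^ d in total. For d = 3, 4 the bound before the last walk is linear in j, and this is
the origin of the logarithm.

The union bound over centres and scales is affordable in a box of radius 2 ^ (r ^ (d - 2)), and
outside that box a common point is unlikely because k (d - 2) ≥ d + 1. This leaves a constant in
front of the exponential. It is absorbed for large t, and for bounded t it is replaced by 1 - δ:
walks that start straight in two opposite directions have with positive probability no common point
except the origin (`exists_real_rangesIntersectionGT_le`).

Lower bound. One walk covers all but a small fraction of a ball of radius r with probability at
least exp (-C r ^ (d - 2)) (`exists_cover_latticeBall`); if each of k independent walks misses at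
most the fraction 1 / (2k), at least half of the ball is common. To cover, weight the paths by the
number W of chains of about r ^ (d - 2) successive visits alternating between two balls of radius r.
The mean of W is a chain of Green functions. Restricted to paths that avoid a point y, it is at most
a chain of Green functions killed at y, which loses a factor 1 - ε / r ^ (d - 2) per link and is
therefore small. So the weighted mean number of missed points is small, and a second-moment argument
with the exponential moment for W ^ 2 removes the weight.

The Green function is compared with (1 + ‖x‖) ^ (2 - d) by explicit radial barriers:
`exists_superharmonic` from above, `exists_subharmonic` with a minimum principle from below. -/

/-! ### Elementary inequalities for (1 ± z) ^ (-γ) -/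

theorem nonneg_of_second_deriv_nonneg {f f' f'' : ℝ → ℝ} {b : ℝ}
    (hf : ∀ z ∈ Set.Icc 0 b, HasDerivAt f (f' z) z)
    (hf' : ∀ z ∈ Set.Icc 0 b, HasDerivAt f' (f'' z) z)
    (h0 : 0 ≤ f 0) (h0' : 0 ≤ f' 0) (h2 : ∀ z ∈ Set.Icc 0 b, 0 ≤ f'' z) :
    ∀ z ∈ Set.Icc 0 b, 0 ≤ f z := by
  have key : ∀ {g g' : ℝ → ℝ}, (∀ z ∈ Set.Icc 0 b, HasDerivAt g (g' z) z) → 0 ≤ g 0 →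
      (∀ z ∈ Set.Icc 0 b, 0 ≤ g' z) → ∀ z ∈ Set.Icc 0 b, 0 ≤ g z := by
    intro g g' hg hg0 hg' z hz
    have hmono : MonotoneOn g (Set.Icc 0 b) := by
      refine monotoneOn_of_deriv_nonneg (convex_Icc 0 b)
        (fun z hz => (hg z hz).continuousAt.continuousWithinAt) ?_ ?_
      · intro z hz
        exact (hg z (interior_subset hz)).differentiableAt.differentiableWithinAt
      · intro z hz
        rw [(hg z (interior_subset hz)).deriv]
        exact hg' z (interior_subset hz)
    exact hg0.trans (hmono ⟨le_rfl, hz.1.trans hz.2⟩ hz hz.1)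
  exact key hf h0 (key hf' h0' h2)

theorem hasDerivAt_one_add_rpow (γ : ℝ) {z : ℝ} (hz : 0 < 1 + z) :
    HasDerivAt (fun z : ℝ => (1 + z) ^ (-γ)) (-γ * (1 + z) ^ (-(γ + 1))) z := by
  have h := ((hasDerivAt_id z).const_add 1).rpow_const (p := -γ) (Or.inl hz.ne')
  have e : -γ - 1 = -(γ + 1) := by ring
  simpa [e] using h

theorem hasDerivAt_one_sub_rpow (γ : ℝ) {z : ℝ} (hz : 0 < 1 - z) :
    HasDerivAt (fun z : ℝ => (1 - z) ^ (-γ)) (γ * (1 - z) ^ (-(γ + 1))) z := by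
  have h := ((hasDerivAt_id z).const_sub 1).rpow_const (p := -γ) (Or.inl hz.ne')
  have e : -γ - 1 = -(γ + 1) := by ring
  simpa [e] using h

/-- Twice the even part of `(1 + z) ^ (-γ)`. -/
noncomputable def evenRpow (γ z : ℝ) : ℝ := (1 + z) ^ (-γ) + (1 - z) ^ (-γ)

/-- Minus twice the odd part of `(1 + z) ^ (-γ)`. -/
noncomputable def oddRpow (γ z : ℝ) : ℝ := (1 - z) ^ (-γ) - (1 + z) ^ (-γ)

theorem hasDerivAt_evenRpow (γ : ℝ) {z : ℝ} (hz : z ∈ Set.Icc (0 : ℝ) (1 / 2)) :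
    HasDerivAt (evenRpow γ) (γ * oddRpow (γ + 1) z) z := by
  have h := (hasDerivAt_one_add_rpow γ (z := z) (by linarith [hz.1])).add
    (hasDerivAt_one_sub_rpow γ (z := z) (by linarith [hz.2]))
  refine h.congr_deriv ?_
  unfold oddRpow; ring

theorem hasDerivAt_oddRpow (γ : ℝ) {z : ℝ} (hz : z ∈ Set.Icc (0 : ℝ) (1 / 2)) :
    HasDerivAt (oddRpow γ) (γ * evenRpow (γ + 1) z) z := by
  have h := (hasDerivAt_one_sub_rpow γ (z := z) (by linarith [hz.2])).sub
    (hasDerivAt_one_add_rpow γ (z := z) (by linarith [hz.1]))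
  refine h.congr_deriv ?_
  unfold evenRpow; ring

theorem evenRpow_zero (γ : ℝ) : evenRpow γ 0 = 2 := by simp [evenRpow]; norm_num
theorem oddRpow_zero (γ : ℝ) : oddRpow γ 0 = 0 := by simp [oddRpow]

theorem evenRpow_neg (γ z : ℝ) : evenRpow γ (-z) = evenRpow γ z := by
  simp only [evenRpow, sub_neg_eq_add, ← sub_eq_add_neg]; ring

theorem evenRpow_nonneg (γ : ℝ) {z : ℝ} (hz : z ∈ Set.Icc (0 : ℝ) (1 / 2)) :
    0 ≤ evenRpow γ z :=
  add_nonneg (Real.rpow_nonneg (by linarith [hz.1]) _) (Real.rpow_nonneg (by linarith [hz.2]) _)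

theorem one_sub_rpow_le {γ : ℝ} (hγ : 0 ≤ γ) {z : ℝ} (hz : z ∈ Set.Icc (0 : ℝ) (1 / 2)) :
    (1 - z) ^ (-γ) ≤ 2 ^ γ := by
  have h : (1 - z) ^ (-γ) ≤ (1 / 2 : ℝ) ^ (-γ) :=
    Real.rpow_le_rpow_of_nonpos (by norm_num) (by linarith [hz.2]) (by linarith)
  refine h.trans_eq ?_
  rw [one_div, Real.inv_rpow (by norm_num), Real.rpow_neg (by norm_num), inv_inv]

theorem evenRpow_le_const {γ : ℝ} (hγ : 0 ≤ γ) {z : ℝ} (hz : z ∈ Set.Icc (0 : ℝ) (1 / 2)) :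
    evenRpow γ z ≤ 2 * 2 ^ γ := by
  have h1 := one_sub_rpow_le hγ hz
  have h2 : (1 + z) ^ (-γ) ≤ 1 :=
    Real.rpow_le_one_of_one_le_of_nonpos (by linarith [hz.1]) (by linarith)
  have h3 : (1 : ℝ) ≤ 2 ^ γ := Real.one_le_rpow (by norm_num) hγ
  unfold evenRpow; linarith

/-- The slope of `evenRpow γ` vanishes at 0 and its second derivative is γ (γ + 1) `evenRpow (γ +
2)`. Comparison with an even quartic therefore reduces to comparing second derivatives, and a bound
for γ + 2 becomes a bound for γ that is two orders finer. -/
theorem evenRpow_ge_of_second_order {γ A B C : ℝ} (hC : C ≤ 2)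
    (h : ∀ z ∈ Set.Icc (0 : ℝ) (1 / 2),
      2 * A + 12 * B * z ^ 2 ≤ γ * (γ + 1) * evenRpow (γ + 2) z) :
    ∀ z ∈ Set.Icc (0 : ℝ) (1 / 2), C + A * z ^ 2 + B * z ^ 4 ≤ evenRpow γ z := by
  intro z hz
  have := nonneg_of_second_deriv_nonneg (b := 1 / 2)
    (f := fun z => evenRpow γ z - (C + A * z ^ 2 + B * z ^ 4))
    (f' := fun z => γ * oddRpow (γ + 1) z - (2 * A * z + 4 * B * z ^ 3))
    (f'' := fun z => γ * ((γ + 1) * evenRpow (γ + 2) z) - (2 * A + 12 * B * z ^ 2)) ?_ ?_ ?_ ?_ ?_ z hz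
  · linarith
  · intro z hz
    have := (hasDerivAt_evenRpow γ hz).sub
      ((((hasDerivAt_pow 2 z).const_mul A).const_add C).add ((hasDerivAt_pow 4 z).const_mul B))
    refine this.congr_deriv ?_
    push_cast; ring
  · intro z hz
    have := ((hasDerivAt_oddRpow (γ + 1) hz).const_mul γ).sub
      (((hasDerivAt_id z).const_mul (2 * A)).add ((hasDerivAt_pow 3 z).const_mul (4 * B)))
    refine this.congr_deriv ?_
    have e : γ + 1 + 1 = γ + 2 := by ring
    rw [e]; push_cast; ring
  · simp [evenRpow_zero, hC]
  · simp [oddRpow_zero]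
  · intro z hz
    have := h z hz
    linarith

theorem evenRpow_le_of_second_order {γ A B C : ℝ} (hC : 2 ≤ C)
    (h : ∀ z ∈ Set.Icc (0 : ℝ) (1 / 2),
      γ * (γ + 1) * evenRpow (γ + 2) z ≤ 2 * A + 12 * B * z ^ 2) :
    ∀ z ∈ Set.Icc (0 : ℝ) (1 / 2), evenRpow γ z ≤ C + A * z ^ 2 + B * z ^ 4 := by
  intro z hz
  have := nonneg_of_second_deriv_nonneg (b := 1 / 2)
    (f := fun z => (C + A * z ^ 2 + B * z ^ 4) - evenRpow γ z)
    (f' := fun z => (2 * A * z + 4 * B * z ^ 3) - γ * oddRpow (γ + 1) z)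
    (f'' := fun z => (2 * A + 12 * B * z ^ 2) - γ * ((γ + 1) * evenRpow (γ + 2) z)) ?_ ?_ ?_ ?_ ?_ z hz
  · linarith
  · intro z hz
    have := ((((hasDerivAt_pow 2 z).const_mul A).const_add C).add
      ((hasDerivAt_pow 4 z).const_mul B)).sub (hasDerivAt_evenRpow γ hz)
    refine this.congr_deriv ?_
    push_cast; ring
  · intro z hz
    have := (((hasDerivAt_id z).const_mul (2 * A)).add
      ((hasDerivAt_pow 3 z).const_mul (4 * B))).sub ((hasDerivAt_oddRpow (γ + 1) hz).const_mul γ)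
    refine this.congr_deriv ?_
    have e : γ + 1 + 1 = γ + 2 := by ring
    rw [e]; push_cast; ring
  · simp [evenRpow_zero, hC]
  · simp [oddRpow_zero]
  · intro z hz
    have := h z hz
    linarith

theorem evenRpow_lower {γ : ℝ} (hγ : 0 ≤ γ) {z : ℝ} (hz : |z| ≤ 1 / 2) :
    2 + γ * (γ + 1) * z ^ 2 ≤ evenRpow γ z := by
  have two_le : ∀ γ : ℝ, 0 ≤ γ → ∀ z ∈ Set.Icc (0 : ℝ) (1 / 2), 2 ≤ evenRpow γ z := by
    intro γ hγ z hz
    have := evenRpow_ge_of_second_order (γ := γ) (A := 0) (B := 0) le_rfl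
      (fun z hz => by have := evenRpow_nonneg (γ + 2) hz; simp; positivity) z hz
    simpa using this
  have main : ∀ z ∈ Set.Icc (0 : ℝ) (1 / 2), 2 + γ * (γ + 1) * z ^ 2 ≤ evenRpow γ z := by
    intro z hz
    have := evenRpow_ge_of_second_order (γ := γ) (A := γ * (γ + 1)) (B := 0) le_rfl
      (fun z hz => by
        have := two_le (γ + 2) (by linarith) z hz
        have h0 : 0 ≤ γ * (γ + 1) := by positivity
        nlinarith) z hz
    simpa using this
  rcases le_total 0 z with h | h
  · exact main z ⟨h, (le_abs_self z).trans hz⟩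
  · have := main (-z) ⟨by linarith, (neg_le_abs z).trans hz⟩
    rwa [evenRpow_neg, neg_sq] at this

theorem evenRpow_upper {γ : ℝ} (hγ : 0 ≤ γ) :
    ∃ K : ℝ, 0 ≤ K ∧ ∀ z : ℝ, |z| ≤ 1 / 2 →
      evenRpow γ z ≤ 2 + γ * (γ + 1) * z ^ 2 + K * z ^ 4 := by
  have quad : ∀ γ : ℝ, 0 ≤ γ → ∃ K : ℝ, 0 ≤ K ∧
      ∀ z ∈ Set.Icc (0 : ℝ) (1 / 2), evenRpow γ z ≤ 2 + K * z ^ 2 := by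
    intro γ hγ
    refine ⟨γ * (γ + 1) * 2 ^ (γ + 2), by positivity, fun z hz => ?_⟩
    have := evenRpow_le_of_second_order (γ := γ) (A := γ * (γ + 1) * 2 ^ (γ + 2)) (B := 0) le_rfl
      (fun z hz => by
        have := evenRpow_le_const (γ := γ + 2) (by linarith) hz
        have h0 : 0 ≤ γ * (γ + 1) := by positivity
        nlinarith) z hz
    simpa using this
  obtain ⟨K, hK, hb⟩ := quad (γ + 2) (by linarith)
  have h0 : 0 ≤ γ * (γ + 1) := by positivity
  refine ⟨γ * (γ + 1) * K, by positivity, ?_⟩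
  have main : ∀ z ∈ Set.Icc (0 : ℝ) (1 / 2),
      evenRpow γ z ≤ 2 + γ * (γ + 1) * z ^ 2 + γ * (γ + 1) * K * z ^ 4 :=
    evenRpow_le_of_second_order le_rfl (fun z hz => by
      have := mul_le_mul_of_nonneg_left (hb z hz) h0
      have : 0 ≤ γ * (γ + 1) * K * z ^ 2 := by positivity
      nlinarith)
  intro z hz
  rcases le_total 0 z with h | h
  · exact main z ⟨h, (le_abs_self z).trans hz⟩
  · have := main (-z) ⟨by linarith, (neg_le_abs z).trans hz⟩
    rwa [evenRpow_neg, neg_sq, Even.neg_pow (by decide)] at this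

theorem one_sub_rpow_lower {γ : ℝ} (hγ : 0 ≤ γ) {z : ℝ} (hz : z ∈ Set.Icc (0 : ℝ) (1 / 2)) :
    1 + γ * z ≤ (1 - z) ^ (-γ) := by
  have := nonneg_of_second_deriv_nonneg (b := 1 / 2)
    (f := fun z : ℝ => (1 - z) ^ (-γ) - (1 + γ * z))
    (f' := fun z => γ * (1 - z) ^ (-(γ + 1)) - γ)
    (f'' := fun z => γ * ((γ + 1) * (1 - z) ^ (-(γ + 1 + 1)))) ?_ ?_ ?_ ?_ ?_ z hz
  · linarith
  · intro z hz
    have := (hasDerivAt_one_sub_rpow γ (z := z) (by linarith [hz.2])).sub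
      (((hasDerivAt_id z).const_mul γ).const_add 1)
    refine this.congr_deriv ?_
    ring
  · intro z hz
    exact ((hasDerivAt_one_sub_rpow (γ + 1) (z := z) (by linarith [hz.2])).const_mul γ).sub_const γ
  · simp
  · simp
  · intro z hz
    have : 0 ≤ (1 - z) ^ (-(γ + 1 + 1)) := Real.rpow_nonneg (by linarith [hz.2]) _
    positivity

theorem one_sub_rpow_upper {γ : ℝ} (hγ : 0 ≤ γ) :
    ∃ K : ℝ, 0 ≤ K ∧ ∀ z ∈ Set.Icc (0 : ℝ) (1 / 2),
      (1 - z) ^ (-γ) ≤ 1 + γ * z + K * z ^ 2 := by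
  refine ⟨γ * (γ + 1) * 2 ^ (γ + 1 + 1), by positivity, fun z hz => ?_⟩
  set K := γ * (γ + 1) * 2 ^ (γ + 1 + 1) with hK
  have hK0 : 0 ≤ K := by positivity
  have := nonneg_of_second_deriv_nonneg (b := 1 / 2)
    (f := fun z : ℝ => (1 + γ * z + K * z ^ 2) - (1 - z) ^ (-γ))
    (f' := fun z => (γ + 2 * K * z) - γ * (1 - z) ^ (-(γ + 1)))
    (f'' := fun z => 2 * K - γ * ((γ + 1) * (1 - z) ^ (-(γ + 1 + 1)))) ?_ ?_ ?_ ?_ ?_ z hz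
  · linarith
  · intro z hz
    have := ((((hasDerivAt_id z).const_mul γ).const_add 1).add
      ((hasDerivAt_pow 2 z).const_mul K)).sub
      (hasDerivAt_one_sub_rpow γ (z := z) (by linarith [hz.2]))
    refine this.congr_deriv ?_
    push_cast; ring
  · intro z hz
    have := (((hasDerivAt_id z).const_mul (2 * K)).const_add γ).sub
      ((hasDerivAt_one_sub_rpow (γ + 1) (z := z) (by linarith [hz.2])).const_mul γ)
    refine this.congr_deriv ?_
    ring
  · simp
  · simp
  · intro z hz
    have h1 := one_sub_rpow_le (γ := γ + 1 + 1) (by linarith) hz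
    have h2 := mul_le_mul_of_nonneg_left h1 (by positivity : 0 ≤ γ * (γ + 1))
    nlinarith

/-! ### Discrete Laplacian of radial functions -/

/-- The average of `f` over the nearest neighbours of `x`. -/
noncomputable def stepAvg {d : ℕ} (f : (Fin d → ℤ) → ℝ) (x : Fin d → ℤ) : ℝ :=
  (∑ i, (f (x + Pi.single i 1) + f (x - Pi.single i 1))) / (2 * d)

/-- The square of the Euclidean norm of a lattice point. -/
def sqNorm {d : ℕ} (x : Fin d → ℤ) : ℝ := ∑ i, (x i : ℝ) ^ 2

theorem sqNorm_nonneg {d : ℕ} (x : Fin d → ℤ) : 0 ≤ sqNorm x :=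
  Finset.sum_nonneg fun _ _ => sq_nonneg _

theorem sqNorm_add_single {d : ℕ} (x : Fin d → ℤ) (i : Fin d) (s : ℤ) :
    sqNorm (x + Pi.single i s) = sqNorm x + s ^ 2 + 2 * s * x i := by
  unfold sqNorm
  rw [← Finset.add_sum_erase _ _ (Finset.mem_univ i),
    ← Finset.add_sum_erase Finset.univ (fun j => (x j : ℝ) ^ 2) (Finset.mem_univ i)]
  have : ∑ j ∈ Finset.univ.erase i, (((x + Pi.single i s : Fin d → ℤ) j : ℤ) : ℝ) ^ 2 =
      ∑ j ∈ Finset.univ.erase i, (x j : ℝ) ^ 2 :=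
    Finset.sum_congr rfl fun j hj => by simp [Finset.ne_of_mem_erase hj]
  rw [this]
  simp; ring

theorem sqNorm_sub_single {d : ℕ} (x : Fin d → ℤ) (i : Fin d) (s : ℤ) :
    sqNorm (x - Pi.single i s) = sqNorm x + s ^ 2 - 2 * s * x i := by
  rw [sub_eq_add_neg, ← Pi.single_neg, sqNorm_add_single]
  push_cast; ring

theorem sq_coord_le_sqNorm {d : ℕ} (x : Fin d → ℤ) (i : Fin d) : (x i : ℝ) ^ 2 ≤ sqNorm x :=
  Finset.single_le_sum (f := fun i => (x i : ℝ) ^ 2) (fun _ _ => sq_nonneg _) (Finset.mem_univ i)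

theorem sqNorm_le {d : ℕ} (x : Fin d → ℤ) : sqNorm x ≤ d * ‖x‖ ^ 2 := by
  have : ∀ i ∈ (Finset.univ : Finset (Fin d)), (x i : ℝ) ^ 2 ≤ ‖x‖ ^ 2 := by
    intro i _
    have := norm_le_pi_norm x i
    rw [Int.norm_eq_abs] at this
    exact sq_le_sq' (by linarith [neg_abs_le (x i : ℝ)]) ((le_abs_self _).trans this)
  simpa [sqNorm] using Finset.sum_le_sum this

theorem norm_sq_le_sqNorm {d : ℕ} (x : Fin d → ℤ) : ‖x‖ ^ 2 ≤ sqNorm x := by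
  have : ‖x‖ ≤ Real.sqrt (sqNorm x) := by
    refine (pi_norm_le_iff_of_nonneg (Real.sqrt_nonneg _)).2 fun i => ?_
    rw [Int.norm_eq_abs]
    exact Real.abs_le_sqrt (sq_coord_le_sqNorm x i)
  calc ‖x‖ ^ 2 ≤ Real.sqrt (sqNorm x) ^ 2 := pow_le_pow_left₀ (norm_nonneg _) this 2
    _ = sqNorm x := Real.sq_sqrt (sqNorm_nonneg x)

/-- The radial function `(|x|² + a) ^ (-γ)`. -/
noncomputable def radial {d : ℕ} (a γ : ℝ) (x : Fin d → ℤ) : ℝ := (sqNorm x + a) ^ (-γ)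

theorem radial_pos {d : ℕ} {a γ : ℝ} (ha : 0 < a) (x : Fin d → ℤ) : 0 < radial a γ x :=
  Real.rpow_pos_of_pos (by linarith [sqNorm_nonneg x]) _

section Radial

variable {d : ℕ} {a : ℝ}

/-- This is 4 |x i| ≤ (x i) ^ 2 + 4, and it is the reason for the standing hypothesis 3 ≤ a. -/
theorem abs_coord_ratio_le (ha : 3 ≤ a) (x : Fin d → ℤ) (i : Fin d) :
    |2 * (x i : ℝ) / (sqNorm x + a + 1)| ≤ 1 / 2 := by
  have hQ : 0 < sqNorm x + a + 1 := by linarith [sqNorm_nonneg x]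
  have h := sq_coord_le_sqNorm x i
  rw [abs_div, abs_of_pos hQ, div_le_iff₀ hQ, abs_le]
  constructor <;> nlinarith [sq_nonneg ((x i : ℝ) - 2), sq_nonneg ((x i : ℝ) + 2)]

/-- With Q = |x|² + a + 1, a step along ±e_i changes |x|² + a to Q (1 ± z) with z = 2 x_i / Q.
Opposite neighbours pair up, so the odd orders cancel. -/
theorem stepAvg_radial (ha : 3 ≤ a) (γ : ℝ) (x : Fin d → ℤ) :
    stepAvg (radial a γ) x = (sqNorm x + a + 1) ^ (-γ) *
      ((∑ i, evenRpow γ (2 * (x i : ℝ) / (sqNorm x + a + 1))) / (2 * d)) := by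
  have hQ : 0 < sqNorm x + a + 1 := by linarith [sqNorm_nonneg x]
  unfold stepAvg
  rw [← mul_div_assoc, Finset.mul_sum]
  congr 1
  refine Finset.sum_congr rfl fun i _ => ?_
  have hz := abs_le.1 (abs_coord_ratio_le ha x i)
  set Q := sqNorm x + a + 1 with hQd
  unfold evenRpow radial
  rw [mul_add, ← Real.mul_rpow hQ.le (by linarith), ← Real.mul_rpow hQ.le (by linarith),
    sqNorm_add_single, sqNorm_sub_single]
  have e1 : Q * (1 + 2 * (x i : ℝ) / Q) = sqNorm x + ((1 : ℤ) : ℝ) ^ 2 + 2 * ((1 : ℤ) : ℝ) * x i + a := by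
    field_simp; push_cast; rw [hQd]; ring
  have e2 : Q * (1 - 2 * (x i : ℝ) / Q) = sqNorm x + ((1 : ℤ) : ℝ) ^ 2 - 2 * ((1 : ℤ) : ℝ) * x i + a := by
    field_simp; push_cast; rw [hQd]; ring
  rw [e1, e2]

theorem sum_coord_ratio_sq (x : Fin d → ℤ) :
    ∑ i, (2 * (x i : ℝ) / (sqNorm x + a + 1)) ^ 2 = 4 * sqNorm x / (sqNorm x + a + 1) ^ 2 := by
  simp only [div_pow, mul_pow]
  rw [← Finset.sum_div, ← Finset.mul_sum]
  norm_num [sqNorm]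

theorem le_stepAvg_radial (hd : 0 < d) (ha : 3 ≤ a) {γ : ℝ} (hγ : 0 ≤ γ) (x : Fin d → ℤ) :
    (sqNorm x + a + 1) ^ (-γ) *
      (1 + γ * (γ + 1) * (2 / d) * sqNorm x / (sqNorm x + a + 1) ^ 2) ≤ stepAvg (radial a γ) x := by
  have hQ : 0 < sqNorm x + a + 1 := by linarith [sqNorm_nonneg x]
  have hd' : (0 : ℝ) < d := by exact_mod_cast hd
  rw [stepAvg_radial ha]
  refine mul_le_mul_of_nonneg_left ?_ (Real.rpow_nonneg hQ.le _)
  have h : ∑ i : Fin d, (2 + γ * (γ + 1) * (2 * (x i : ℝ) / (sqNorm x + a + 1)) ^ 2) ≤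
      ∑ i, evenRpow γ (2 * (x i : ℝ) / (sqNorm x + a + 1)) :=
    Finset.sum_le_sum fun i _ => evenRpow_lower hγ (abs_coord_ratio_le ha x i)
  rw [Finset.sum_add_distrib, ← Finset.mul_sum, sum_coord_ratio_sq] at h
  rw [le_div_iff₀ (by positivity)]
  refine le_trans (le_of_eq ?_) h
  simp
  field_simp
  ring

/-- The quartic terms are absorbed by z ^ 4 ≤ (4 / Q) z ^ 2, whose sum over the coordinates is at
most 16 / Q ^ 2. The constant is uniform in a because a will be chosen in terms of K. -/
theorem stepAvg_radial_le (hd : 0 < d) {γ : ℝ} (hγ : 0 ≤ γ) :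
    ∃ K : ℝ, 0 ≤ K ∧ ∀ a : ℝ, 3 ≤ a → ∀ x : Fin d → ℤ, stepAvg (radial a γ) x ≤
      (sqNorm x + a + 1) ^ (-γ) * (1 + γ * (γ + 1) * (2 / d) * sqNorm x / (sqNorm x + a + 1) ^ 2
        + K / (sqNorm x + a + 1) ^ 2) := by
  obtain ⟨K, hK, hub⟩ := evenRpow_upper hγ
  have hd' : (0 : ℝ) < d := by exact_mod_cast hd
  refine ⟨8 * K / d, by positivity, fun a ha x => ?_⟩
  have hx := sqNorm_nonneg x
  have hQ : 0 < sqNorm x + a + 1 := by linarith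
  rw [stepAvg_radial ha]
  refine mul_le_mul_of_nonneg_left ?_ (Real.rpow_nonneg hQ.le _)
  have h4 : ∀ i, (2 * (x i : ℝ) / (sqNorm x + a + 1)) ^ 4 ≤
      4 / (sqNorm x + a + 1) * (2 * (x i : ℝ) / (sqNorm x + a + 1)) ^ 2 := by
    intro i
    have : (2 * (x i : ℝ) / (sqNorm x + a + 1)) ^ 2 ≤ 4 / (sqNorm x + a + 1) := by
      rw [div_pow, div_le_div_iff₀ (by positivity) hQ]
      have := sq_coord_le_sqNorm x i
      have h2 : (2 * (x i : ℝ)) ^ 2 ≤ 4 * (sqNorm x + a + 1) := by nlinarith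
      nlinarith
    have := mul_le_mul_of_nonneg_right this (sq_nonneg (2 * (x i : ℝ) / (sqNorm x + a + 1)))
    refine le_trans (le_of_eq ?_) this
    ring
  have h : ∑ i, evenRpow γ (2 * (x i : ℝ) / (sqNorm x + a + 1)) ≤
      ∑ i : Fin d, (2 + γ * (γ + 1) * (2 * (x i : ℝ) / (sqNorm x + a + 1)) ^ 2
        + K * (4 / (sqNorm x + a + 1) * (2 * (x i : ℝ) / (sqNorm x + a + 1)) ^ 2)) :=
    Finset.sum_le_sum fun i _ => (hub _ (abs_coord_ratio_le ha x i)).trans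
      (by linarith [mul_le_mul_of_nonneg_left (h4 i) hK])
  rw [Finset.sum_add_distrib, Finset.sum_add_distrib, ← Finset.mul_sum, ← Finset.mul_sum,
    ← Finset.mul_sum, sum_coord_ratio_sq] at h
  rw [div_le_iff₀ (by positivity)]
  refine h.trans ?_
  have h5 : K * (4 / (sqNorm x + a + 1) * (4 * sqNorm x / (sqNorm x + a + 1) ^ 2)) ≤
      16 * K / (sqNorm x + a + 1) ^ 2 := by
    have : 4 / (sqNorm x + a + 1) * (4 * sqNorm x / (sqNorm x + a + 1) ^ 2) ≤
        16 / (sqNorm x + a + 1) ^ 2 := by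
      rw [div_mul_div_comm, div_le_div_iff₀ (by positivity) (by positivity)]
      have : (sqNorm x) * (sqNorm x + a + 1) ^ 2 ≤ (sqNorm x + a + 1) * (sqNorm x + a + 1) ^ 2 := by
        gcongr; linarith
      nlinarith
    calc _ ≤ K * (16 / (sqNorm x + a + 1) ^ 2) := mul_le_mul_of_nonneg_left this hK
      _ = _ := by ring
  have e : (1 + γ * (γ + 1) * (2 / d) * sqNorm x / (sqNorm x + a + 1) ^ 2
        + 8 * K / d / (sqNorm x + a + 1) ^ 2) * (2 * d) =
      (2 * d + γ * (γ + 1) * (4 * sqNorm x / (sqNorm x + a + 1) ^ 2)) +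
        16 * K / (sqNorm x + a + 1) ^ 2 := by
    field_simp; ring
  rw [e]
  simp
  linarith

theorem radial_eq (ha : 3 ≤ a) (γ : ℝ) (x : Fin d → ℤ) :
    radial a γ x = (sqNorm x + a + 1) ^ (-γ) * (1 - 1 / (sqNorm x + a + 1)) ^ (-γ) := by
  have hx := sqNorm_nonneg x
  have hQ : 0 < sqNorm x + a + 1 := by linarith
  rw [← Real.mul_rpow hQ.le, radial]
  · congr 1; field_simp; ring
  · rw [sub_nonneg, div_le_one hQ]; linarith

theorem inv_mem_Icc (ha : 3 ≤ a) (x : Fin d → ℤ) :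
    1 / (sqNorm x + a + 1) ∈ Set.Icc (0 : ℝ) (1 / 2) := by
  have hx := sqNorm_nonneg x
  have hQ : 0 < sqNorm x + a + 1 := by linarith
  refine ⟨by positivity, ?_⟩
  rw [div_le_div_iff₀ hQ (by norm_num)]; linarith

end Radial

/-! ### Barriers with the decay of the Green function -/

/-- The decay profile `(1 + ‖x‖) ^ (2 - d)` of the Green function. -/
noncomputable def decay {d : ℕ} (x : Fin d → ℤ) : ℝ := ((1 + ‖x‖) ^ (d - 2))⁻¹

theorem decay_pos {d : ℕ} (x : Fin d → ℤ) : 0 < decay x := by unfold decay; positivity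

theorem decay_le_one {d : ℕ} (x : Fin d → ℤ) : decay x ≤ 1 :=
  inv_le_one_of_one_le₀ (one_le_pow₀ (by linarith [norm_nonneg x]))

theorem decay_eq_rpow {d : ℕ} (hd : 2 ≤ d) (x : Fin d → ℤ) :
    decay x = ((1 + ‖x‖) ^ 2) ^ (-(((d : ℝ) - 2) / 2)) := by
  have h : 0 < 1 + ‖x‖ := by positivity
  rw [decay, ← Real.rpow_natCast, ← Real.rpow_neg h.le, ← Real.rpow_natCast _ 2, ← Real.rpow_mul h.le]
  congr 1
  push_cast [Nat.cast_sub hd]; ring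

theorem radial_le_decay {d : ℕ} (hd : 3 ≤ d) {a : ℝ} (ha : 3 ≤ a) (x : Fin d → ℤ) :
    radial a (((d : ℝ) - 2) / 2) x ≤ 2 ^ (((d : ℝ) - 2) / 2) * decay x := by
  have hd' : (3 : ℝ) ≤ d := by exact_mod_cast hd
  have h : 0 < 1 + ‖x‖ := by positivity
  have h1 := norm_sq_le_sqNorm x
  have h2 : (1 / 2 : ℝ) * (1 + ‖x‖) ^ 2 ≤ sqNorm x + a := by nlinarith [sq_nonneg (‖x‖ - 1)]
  rw [decay_eq_rpow (by omega)]
  calc radial a (((d : ℝ) - 2) / 2) x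
      ≤ ((1 / 2 : ℝ) * (1 + ‖x‖) ^ 2) ^ (-(((d : ℝ) - 2) / 2)) :=
        Real.rpow_le_rpow_of_nonpos (by positivity) h2 (by linarith)
    _ = _ := by
        rw [Real.mul_rpow (by norm_num) (by positivity), one_div, Real.inv_rpow (by norm_num),
          Real.rpow_neg (by norm_num), inv_inv]

theorem decay_le_radial {d : ℕ} (hd : 3 ≤ d) {a : ℝ} (ha : 3 ≤ a) (x : Fin d → ℤ) :
    decay x ≤ ((d : ℝ) + a) ^ (((d : ℝ) - 2) / 2) * radial a (((d : ℝ) - 2) / 2) x := by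
  have hd' : (3 : ℝ) ≤ d := by exact_mod_cast hd
  have h0 := sqNorm_nonneg x
  have hn := norm_nonneg x
  have h1 := sqNorm_le x
  have h2 : sqNorm x + a ≤ ((d : ℝ) + a) * (1 + ‖x‖) ^ 2 := by nlinarith [sq_nonneg ‖x‖]
  have h3 : ((d : ℝ) + a) ^ (-(((d : ℝ) - 2) / 2)) * decay x ≤ radial a (((d : ℝ) - 2) / 2) x := by
    rw [decay_eq_rpow (by omega), ← Real.mul_rpow (by positivity) (by positivity)]
    exact Real.rpow_le_rpow_of_nonpos (by linarith) h2 (by linarith)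
  have hp : 0 < ((d : ℝ) + a) ^ (((d : ℝ) - 2) / 2) := Real.rpow_pos_of_pos (by linarith) _
  rw [Real.rpow_neg (by linarith)] at h3
  calc decay x = ((d : ℝ) + a) ^ (((d : ℝ) - 2) / 2) *
        ((((d : ℝ) + a) ^ (((d : ℝ) - 2) / 2))⁻¹ * decay x) := by field_simp
    _ ≤ _ := by gcongr

/-- A strictly superharmonic function with the decay of the Green function. -/
theorem exists_superharmonic {d : ℕ} (hd : 3 ≤ d) :
    ∃ (φ : (Fin d → ℤ) → ℝ) (C : ℝ), 0 < C ∧ (∀ x, 0 < φ x) ∧ (∀ x, φ x ≤ C * decay x) ∧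
      ∀ x, stepAvg φ x + (if x = 0 then 1 else 0) ≤ φ x := by
  have hd' : (3 : ℝ) ≤ d := by exact_mod_cast hd
  set β : ℝ := ((d : ℝ) - 2) / 2 with hβ
  have hβ0 : 0 < β := by linarith
  obtain ⟨K, hK, hub⟩ := stepAvg_radial_le (d := d) (by omega) hβ0.le
  -- The defect of superharmonicity comes out as (β (a + 1) - K) / Q ^ 2; this shift makes it at
  -- least β / Q ^ 2.
  set a : ℝ := 3 + K / β with ha
  have ha3 : 3 ≤ a := by rw [ha]; have : 0 ≤ K / β := by positivity
                         linarith
  have hle : ∀ x : Fin d → ℤ,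
      (sqNorm x + a + 1) ^ (-β) * (β / (sqNorm x + a + 1) ^ 2) ≤
        radial a β x - stepAvg (radial a β) x := by
    intro x
    have hx := sqNorm_nonneg x
    set Q := sqNorm x + a + 1 with hQd
    have hQ : 0 < Q := by linarith
    have h1 := hub a ha3 x
    have h2 := radial_eq ha3 β x
    have h3 := one_sub_rpow_lower hβ0.le (inv_mem_Icc ha3 x)
    rw [← hQd] at h1 h2 h3
    have hp : 0 ≤ Q ^ (-β) := Real.rpow_nonneg hQ.le _
    -- The exponent β = (d - 2) / 2 is critical: the second-order term of the average has the same
    -- coefficient β as the first-order term of `radial_eq`, so the terms of order 1 / Q cancel and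
    -- the sign is decided at order 1 / Q ^ 2.
    have e : β * (β + 1) * (2 / d) = β := by
      have : β + 1 = d / 2 := by rw [hβ]; ring
      rw [this]; field_simp
    rw [e] at h1
    have h4 := mul_le_mul_of_nonneg_left h3 hp
    rw [← h2] at h4
    have h5 : β / Q ^ 2 ≤ 1 + β * (1 / Q) - (1 + β * sqNorm x / Q ^ 2 + K / Q ^ 2) := by
      have e2 : 1 + β * (1 / Q) - (1 + β * sqNorm x / Q ^ 2 + K / Q ^ 2) =
          (β * (a + 1) - K) / Q ^ 2 := by
        field_simp; rw [hQd]; ring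
      rw [e2]
      gcongr
      have : β * a = 3 * β + K := by rw [ha]; field_simp
      linarith
    have h6 := mul_le_mul_of_nonneg_left h5 hp
    linarith
  -- The gap at the origin, where Q = a + 1. Dividing by it produces the required unit source.
  set c : ℝ := (a + 1) ^ (-β) * (β / (a + 1) ^ 2) with hc
  have hc0 : 0 < c := by
    have : 0 < a + 1 := by linarith
    have := Real.rpow_pos_of_pos this (-β)
    positivity
  have hs : ∀ x, stepAvg (fun y : Fin d → ℤ => c⁻¹ * radial a β y) x =
      c⁻¹ * stepAvg (radial a β) x := by
    intro x; unfold stepAvg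
    rw [← mul_div_assoc, Finset.mul_sum]; simp only [mul_add]
  refine ⟨fun x => c⁻¹ * radial a β x, c⁻¹ * 2 ^ β, by positivity,
    fun x => mul_pos (inv_pos.2 hc0) (radial_pos (by linarith) x), fun x => ?_, fun x => ?_⟩
  · rw [mul_assoc]
    exact mul_le_mul_of_nonneg_left (radial_le_decay hd ha3 x) (by positivity)
  · rw [hs]
    have h := hle x
    split_ifs with h0
    · have e : sqNorm x + a + 1 = a + 1 := by subst h0; simp [sqNorm]
      rw [e, ← hc] at h
      have : c⁻¹ * c ≤ c⁻¹ * (radial a β x - stepAvg (radial a β) x) := by gcongr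
      rw [inv_mul_cancel₀ hc0.ne'] at this
      linarith
    · have hx := sqNorm_nonneg x
      have h1 : 0 ≤ (sqNorm x + a + 1) ^ (-β) * (β / (sqNorm x + a + 1) ^ 2) := by
        have := Real.rpow_nonneg (by linarith : 0 ≤ sqNorm x + a + 1) (-β)
        positivity
      have : c⁻¹ * stepAvg (radial a β) x ≤ c⁻¹ * radial a β x := by gcongr; linarith
      linarith

/-- A function with the decay of the Green function that is subharmonic off a finite ball. -/
theorem exists_subharmonic {d : ℕ} (hd : 3 ≤ d) :
    ∃ (ψ : (Fin d → ℤ) → ℝ) (c C M K : ℝ), 0 < c ∧ 0 < C ∧ 0 < M ∧ (∀ x, c * decay x ≤ ψ x) ∧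
      (∀ x, ψ x ≤ C * decay x) ∧ ∀ x, ψ x ≤ stepAvg ψ x + (if ‖x‖ ≤ K then M else 0) := by
  have hd' : (3 : ℝ) ≤ d := by exact_mod_cast hd
  set β : ℝ := ((d : ℝ) - 2) / 2 with hβ
  have hβ0 : 0 < β := by linarith
  obtain ⟨K₁, hK₁, hub₁⟩ := one_sub_rpow_upper hβ0.le
  obtain ⟨K₂, hK₂, hub₂⟩ := one_sub_rpow_upper (γ := β + 1) (by linarith)
  set γ : ℝ := β + 1 with hγ
  have hγ0 : 0 < γ := by linarith
  -- The critical part `radial 3 β` fails to be subharmonic by at most (4 β + K₁) Q ^ (-β - 2). The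
  -- correction with exponent γ = β + 1 gains (2 γ / d - D / Q) Q ^ (-β - 2), which is at least (γ /
  -- d) Q ^ (-β - 2) once D / Q ≤ γ / d. This b makes that half of the gain cancel the loss.
  set b : ℝ := (d / γ) * (4 * β + K₁) with hb
  have hb0 : 0 ≤ b := by positivity
  set D : ℝ := γ * (1 + 2 / d) * 4 + K₂ with hD
  have h3 : (3 : ℝ) ≤ 3 := le_rfl
  have bound : ∀ (γ' K' : ℝ), 0 ≤ γ' →
      (∀ z ∈ Set.Icc (0 : ℝ) (1 / 2), (1 - z) ^ (-γ') ≤ 1 + γ' * z + K' * z ^ 2) →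
      ∀ x : Fin d → ℤ, (sqNorm x + 3 + 1) ^ (-γ') *
        (γ' * (γ' + 1) * (2 / d) * sqNorm x / (sqNorm x + 3 + 1) ^ 2
          - γ' / (sqNorm x + 3 + 1) - K' / (sqNorm x + 3 + 1) ^ 2) ≤
        stepAvg (radial 3 γ') x - radial 3 γ' x := by
    intro γ' K' hγ' hub x
    have hx := sqNorm_nonneg x
    have h1 := le_stepAvg_radial (d := d) (by omega) h3 hγ' x
    have h2 := radial_eq h3 γ' x
    have h4 := hub _ (inv_mem_Icc h3 x)
    have hp : 0 ≤ (sqNorm x + 3 + 1) ^ (-γ') := Real.rpow_nonneg (by linarith) _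
    have h5 := mul_le_mul_of_nonneg_left h4 hp
    rw [← h2] at h5
    refine le_trans (le_of_eq ?_) (sub_le_sub h1 h5)
    generalize sqNorm x + 3 + 1 = Q
    ring
  have b1 : ∀ x : Fin d → ℤ, (sqNorm x + 3 + 1) ^ (-β) *
      (-(4 * β + K₁) / (sqNorm x + 3 + 1) ^ 2) ≤ stepAvg (radial 3 β) x - radial 3 β x := by
    intro x
    have hx := sqNorm_nonneg x
    refine le_trans (le_of_eq ?_) (bound β K₁ hβ0.le hub₁ x)
    have e : β * (β + 1) * (2 / d) = β := by
      have : β + 1 = d / 2 := by rw [hβ]; ring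
      rw [this]; field_simp
    rw [e]; congr 1; field_simp; ring
  have b2 : ∀ x : Fin d → ℤ, (sqNorm x + 3 + 1) ^ (-β) *
      ((2 * γ / d - D / (sqNorm x + 3 + 1)) / (sqNorm x + 3 + 1) ^ 2) ≤
        stepAvg (radial 3 γ) x - radial 3 γ x := by
    intro x
    have hx := sqNorm_nonneg x
    refine le_trans (le_of_eq ?_) (bound γ K₂ hγ0.le hub₂ x)
    have e : γ * (γ + 1) * (2 / d) = γ * (1 + 2 / d) := by
      have : γ + 1 = d / 2 + 1 := by rw [hγ, hβ]; ring
      rw [this]; field_simp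
    have e2 : (sqNorm x + 3 + 1) ^ (-γ) =
        (sqNorm x + 3 + 1) ^ (-β) * (sqNorm x + 3 + 1)⁻¹ := by
      rw [hγ, neg_add, Real.rpow_add (by linarith), Real.rpow_neg_one]
    rw [e, e2, mul_assoc, hD]; congr 1; field_simp; ring
  set ψ : (Fin d → ℤ) → ℝ := fun x => radial 3 β x + b * radial 3 γ x with hψ
  have hs : ∀ x, stepAvg ψ x = stepAvg (radial 3 β) x + b * stepAvg (radial 3 γ) x := by
    intro x; simp only [hψ, stepAvg]
    rw [← mul_div_assoc, ← add_div, Finset.mul_sum, ← Finset.sum_add_distrib]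
    congr 1; refine Finset.sum_congr rfl fun i _ => ?_; ring
  have hr1 : ∀ x : Fin d → ℤ, radial 3 γ x ≤ radial 3 β x := by
    intro x
    exact Real.rpow_le_rpow_of_exponent_le (by linarith [sqNorm_nonneg x]) (by linarith)
  have hr2 : ∀ x : Fin d → ℤ, radial 3 β x ≤ 1 := by
    intro x
    exact Real.rpow_le_one_of_one_le_of_nonpos (by linarith [sqNorm_nonneg x]) (by linarith)
  have hr3 : ∀ γ' (x : Fin d → ℤ), 0 ≤ stepAvg (radial 3 γ') x := by
    intro γ' x
    refine div_nonneg (Finset.sum_nonneg fun i _ => add_nonneg ?_ ?_) (by positivity)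
    · exact (radial_pos (by norm_num) _).le
    · exact (radial_pos (by norm_num) _).le
  have hP : 0 < ((d : ℝ) + 3) ^ β := by positivity
  refine ⟨ψ, (((d : ℝ) + 3) ^ β)⁻¹, (1 + b) * 2 ^ β, 1 + b, max 0 (D * d / γ), by positivity, by positivity,
    by positivity, fun x => ?_, fun x => ?_, fun x => ?_⟩
  · rw [inv_mul_le_iff₀ hP]
    refine (decay_le_radial hd h3 x).trans ?_
    have := mul_nonneg hb0 (radial_pos (γ := γ) (by norm_num : (0 : ℝ) < 3) x).le
    simp only [hψ]
    gcongr; linarith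
  · have h1 := radial_le_decay hd h3 x
    have h2 := mul_le_mul_of_nonneg_left (hr1 x) hb0
    simp only [hψ]
    calc radial 3 β x + b * radial 3 γ x ≤ (1 + b) * radial 3 β x := by linarith
      _ ≤ (1 + b) * (2 ^ β * decay x) := by gcongr
      _ = _ := by ring
  -- Inside the exceptional ball ψ ≤ 1 + b = M and the average is nonnegative; outside, Q ≥ ‖x‖
  -- forces D / Q ≤ γ / d.
  · split_ifs with hK
    · have h1 := mul_nonneg hb0 (hr3 γ x)
      have h2 := mul_le_mul_of_nonneg_left (hr1 x) hb0
      have h4 := mul_le_mul_of_nonneg_left (hr2 x) hb0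
      rw [hs]; simp only [hψ]
      linarith [hr3 β x, hr2 x]
    · rw [not_le, max_lt_iff] at hK
      have hx := sqNorm_nonneg x
      have hn : ‖x‖ ≤ sqNorm x + 3 + 1 := by
        have := norm_sq_le_sqNorm x
        nlinarith [sq_nonneg (‖x‖ - 1)]
      set Q := sqNorm x + 3 + 1 with hQ
      have hQ0 : 0 < Q := by linarith
      have hDQ : D / Q ≤ γ / d := by
        rw [div_le_div_iff₀ hQ0 (by positivity)]
        have := hK.2
        rw [div_lt_iff₀ hγ0] at this
        nlinarith
      have h1 := b1 x
      have h2 := mul_le_mul_of_nonneg_left (b2 x) hb0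
      rw [← hQ] at h1 h2
      have hp : 0 < Q ^ (-β) := Real.rpow_pos_of_pos hQ0 _
      have key : 0 ≤ Q ^ (-β) * (-(4 * β + K₁) / Q ^ 2) +
          b * (Q ^ (-β) * ((2 * γ / d - D / Q) / Q ^ 2)) := by
        have : Q ^ (-β) * (-(4 * β + K₁) / Q ^ 2) +
          b * (Q ^ (-β) * ((2 * γ / d - D / Q) / Q ^ 2)) =
            Q ^ (-β) / Q ^ 2 * (b * (2 * γ / d - D / Q) - (4 * β + K₁)) := by ring
        rw [this]
        refine mul_nonneg (by positivity) ?_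
        have h5 : b * (γ / d) ≤ b * (2 * γ / d - D / Q) := by
          gcongr
          have : 2 * γ / d = γ / d + γ / d := by ring
          linarith
        have h6 : b * (γ / d) = 4 * β + K₁ := by rw [hb]; field_simp
        linarith
      rw [hs]; simp only [hψ]
      linarith

/-! ### Averages over one step and over all paths of given length -/

section StepAvg

variable {d : ℕ}

theorem stepAvg_mono {f g : (Fin d → ℤ) → ℝ} (h : ∀ x, f x ≤ g x) (x : Fin d → ℤ) :
    stepAvg f x ≤ stepAvg g x := by
  unfold stepAvg
  gcongr with i
  · exact h _
  · exact h _

theorem stepAvg_add (f g : (Fin d → ℤ) → ℝ) (x : Fin d → ℤ) :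
    stepAvg (fun y => f y + g y) x = stepAvg f x + stepAvg g x := by
  unfold stepAvg
  rw [← add_div, ← Finset.sum_add_distrib]
  congr 1
  exact Finset.sum_congr rfl fun i _ => by ring

theorem stepAvg_const_mul (c : ℝ) (f : (Fin d → ℤ) → ℝ) (x : Fin d → ℤ) :
    stepAvg (fun y => c * f y) x = c * stepAvg f x := by
  unfold stepAvg
  rw [← mul_div_assoc, Finset.mul_sum]
  simp only [mul_add]

theorem stepAvg_sum {ι : Type*} (s : Finset ι) (f : ι → (Fin d → ℤ) → ℝ) (x : Fin d → ℤ) :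
    stepAvg (fun y => ∑ j ∈ s, f j y) x = ∑ j ∈ s, stepAvg (f j) x := by
  unfold stepAvg
  rw [← Finset.sum_div, Finset.sum_comm]
  simp only [Finset.sum_add_distrib]

theorem stepAvg_const (hd : 0 < d) (c : ℝ) (x : Fin d → ℤ) : stepAvg (fun _ => c) x = c := by
  have : (0 : ℝ) < d := by exact_mod_cast hd
  simp [stepAvg]; field_simp; ring

theorem stepAvg_sub_right (f : (Fin d → ℤ) → ℝ) (z x : Fin d → ℤ) :
    stepAvg (fun y => f (y - z)) x = stepAvg f (x - z) := by
  unfold stepAvg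
  congr 1
  exact Finset.sum_congr rfl fun i _ => by
    simp only [add_sub_right_comm, sub_right_comm]

theorem stepAvg_nonneg {f : (Fin d → ℤ) → ℝ} (h : ∀ x, 0 ≤ f x) (x : Fin d → ℤ) :
    0 ≤ stepAvg f x :=
  div_nonneg (Finset.sum_nonneg fun i _ => add_nonneg (h _) (h _)) (by positivity)

end StepAvg

/-- The mean of `f` over the lists of steps of length `N` of simple random walk. -/
noncomputable def pathMean {d : ℕ} : ℕ → (List (Fin d → ℤ) → ℝ) → ℝ
  | 0, f => f []
  | N + 1, f => (∑ i, (pathMean N (fun l => f (Pi.single i 1 :: l)) +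
      pathMean N (fun l => f (-Pi.single i 1 :: l)))) / (2 * d)

section PathMean

variable {d : ℕ}

/-- First-step decomposition: a functional of the path from x which, after the first step e, depends
on the path from x + e only. The recursions for path means below rest on this form of the Markov
property. -/
theorem pathMean_succ {F H : (Fin d → ℤ) → List (Fin d → ℤ) → ℝ} (N : ℕ) (x : Fin d → ℤ)
    (h : ∀ e l, F x (e :: l) = H (x + e) l) :
    pathMean (N + 1) (F x) = stepAvg (fun y => pathMean N (H y)) x := by
  simp only [pathMean, stepAvg, h, sub_eq_add_neg]

theorem pathMean_mono {f g : List (Fin d → ℤ) → ℝ} (h : ∀ l, f l ≤ g l) (N : ℕ) :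
    pathMean N f ≤ pathMean N g := by
  induction N generalizing f g with
  | zero => exact h _
  | succ N ih =>
    simp only [pathMean]
    gcongr with i
    · exact ih fun l => h _
    · exact ih fun l => h _

theorem pathMean_add (f g : List (Fin d → ℤ) → ℝ) (N : ℕ) :
    pathMean N (fun l => f l + g l) = pathMean N f + pathMean N g := by
  induction N generalizing f g with
  | zero => rfl
  | succ N ih =>
    simp only [pathMean, ih]
    rw [← add_div, ← Finset.sum_add_distrib]
    congr 1
    exact Finset.sum_congr rfl fun i _ => by ring

theorem pathMean_const_mul (c : ℝ) (f : List (Fin d → ℤ) → ℝ) (N : ℕ) :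
    pathMean N (fun l => c * f l) = c * pathMean N f := by
  induction N generalizing f with
  | zero => rfl
  | succ N ih =>
    simp only [pathMean, ih]
    rw [← mul_div_assoc, Finset.mul_sum]
    simp only [mul_add]

theorem pathMean_const (hd : 0 < d) (c : ℝ) (N : ℕ) : pathMean (d := d) N (fun _ => c) = c := by
  have : (0 : ℝ) < d := by exact_mod_cast hd
  induction N with
  | zero => rfl
  | succ N ih => simp [pathMean, ih]; field_simp; ring

theorem pathMean_zero_fun (N : ℕ) : pathMean (d := d) N (fun _ => 0) = 0 := by
  induction N with
  | zero => rfl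
  | succ N ih => simp [pathMean, ih]

theorem pathMean_nonneg {f : List (Fin d → ℤ) → ℝ} (h : ∀ l, 0 ≤ f l) (N : ℕ) :
    0 ≤ pathMean N f :=
  (pathMean_zero_fun N).ge.trans (pathMean_mono h N)

theorem pathMean_sum {ι : Type*} (s : Finset ι) (f : ι → List (Fin d → ℤ) → ℝ) (N : ℕ) :
    pathMean N (fun l => ∑ j ∈ s, f j l) = ∑ j ∈ s, pathMean N (f j) := by
  classical
  induction s using Finset.induction_on with
  | empty => simpa using pathMean_zero_fun N
  | insert a s ha ih => simp only [Finset.sum_insert ha, pathMean_add, ih]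

end PathMean

/-! ### Visits to a finite set and Green potentials -/

/-- The set of points visited by the path from `x` with the given list of steps. -/
def pathRange {d : ℕ} : (Fin d → ℤ) → List (Fin d → ℤ) → Finset (Fin d → ℤ)
  | x, [] => {x}
  | x, e :: l => insert x (pathRange (x + e) l)

/-- The number of visits to `A` of the path from `x` with the given list of steps. -/
def pathVisits {d : ℕ} (A : Finset (Fin d → ℤ)) : (Fin d → ℤ) → List (Fin d → ℤ) → ℕ
  | x, [] => if x ∈ A then 1 else 0
  | x, e :: l => (if x ∈ A then 1 else 0) + pathVisits A (x + e) l

theorem card_pathRange_inter_le {d : ℕ} (A : Finset (Fin d → ℤ)) (x : Fin d → ℤ)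
    (l : List (Fin d → ℤ)) : (A ∩ pathRange x l).card ≤ pathVisits A x l := by
  induction l generalizing x with
  | nil =>
    simp only [pathRange, pathVisits]
    split_ifs with h
    · exact (Finset.card_le_card Finset.inter_subset_right).trans (by simp)
    · simp [Finset.inter_singleton_of_notMem h]
  | cons e l ih =>
    simp only [pathRange, pathVisits]
    split_ifs with h
    · rw [Finset.inter_insert_of_mem h, add_comm 1]
      exact (Finset.card_insert_le _ _).trans (Nat.add_le_add_right (ih (x + e)) 1)
    · rw [Finset.inter_insert_of_notMem h, zero_add]
      exact ih _

/-- A function that dominates the Green function of simple random walk. -/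
structure IsGreenBound {d : ℕ} (φ : (Fin d → ℤ) → ℝ) : Prop where
  pos : ∀ x, 0 < φ x
  superharmonic : ∀ x, stepAvg φ x + (if x = 0 then 1 else 0) ≤ φ x

section GreenBound

variable {d : ℕ} {φ : (Fin d → ℤ) → ℝ}

theorem IsGreenBound.stepAvg_potential_add_le (hφ : IsGreenBound φ) (A : Finset (Fin d → ℤ))
    (x : Fin d → ℤ) :
    stepAvg (fun y => ∑ z ∈ A, φ (y - z)) x + (if x ∈ A then 1 else 0) ≤ ∑ z ∈ A, φ (x - z) := by
  rw [stepAvg_sum]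
  have e : (if x ∈ A then (1 : ℝ) else 0) = ∑ z ∈ A, (if x - z = 0 then (1 : ℝ) else 0) := by
    simp [sub_eq_zero]
  rw [e, ← Finset.sum_add_distrib]
  refine Finset.sum_le_sum fun z _ => ?_
  rw [stepAvg_sub_right]
  exact hφ.superharmonic _

/-- Khasminskii's argument. The function h = 1 + g⁻¹ Σ φ (· - z) lies in [1, 2], is superharmonic,
and drops on average by 1 / g at points of A. Since h ≤ 2, the drop is at least h / (2g), which pays
for the factor exp (1 / (2g)) gained at each visit. So exp (visits / (2g)) h is a supermartingale
along the walk. -/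
theorem IsGreenBound.mean_exp_visits_le (hd : 0 < d) (hφ : IsGreenBound φ)
    {A : Finset (Fin d → ℤ)}
    {g : ℝ} (hg : 0 < g) (hA : ∀ x, ∑ z ∈ A, φ (x - z) ≤ g) (N : ℕ) (x : Fin d → ℤ) :
    pathMean N (fun l => Real.exp (pathVisits A x l / (2 * g))) ≤ 2 := by
  set h : (Fin d → ℤ) → ℝ := fun y => 1 + g⁻¹ * ∑ z ∈ A, φ (y - z) with hh
  have h1 : ∀ y, 1 ≤ h y := fun y => by
    have : 0 ≤ ∑ z ∈ A, φ (y - z) := Finset.sum_nonneg fun z _ => (hφ.pos _).le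
    simp only [hh]
    have : 0 ≤ g⁻¹ * ∑ z ∈ A, φ (y - z) := by positivity
    linarith
  have h2 : ∀ y, h y ≤ 2 := fun y => by
    have := mul_le_mul_of_nonneg_left (hA y) (inv_nonneg.2 hg.le)
    rw [inv_mul_cancel₀ hg.ne'] at this
    simp only [hh]; linarith
  have hP : ∀ y, stepAvg h y ≤ h y - g⁻¹ * (if y ∈ A then 1 else 0) := fun y => by
    have e : stepAvg h y = 1 + g⁻¹ * stepAvg (fun y => ∑ z ∈ A, φ (y - z)) y := by
      simp only [hh]
      rw [stepAvg_add (fun _ => 1), stepAvg_const hd, stepAvg_const_mul]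
    have := mul_le_mul_of_nonneg_left (hφ.stepAvg_potential_add_le A y) (inv_nonneg.2 hg.le)
    rw [e]; simp only [hh]; linarith
  have hw : ∀ y, Real.exp ((if y ∈ A then (1 : ℝ) else 0) / (2 * g)) *
      (h y - g⁻¹ * (if y ∈ A then 1 else 0)) ≤ h y := fun y => by
    split_ifs with hy
    · have e1 : 1 - 1 / (2 * g) ≤ Real.exp (-(1 / (2 * g))) := by
        have := Real.add_one_le_exp (-(1 / (2 * g))); linarith
      have e2 : h y - g⁻¹ * 1 ≤ h y * (1 - 1 / (2 * g)) := by
        have : g⁻¹ = 2 * (1 / (2 * g)) := by field_simp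
        rw [this]
        have := mul_le_mul_of_nonneg_right (h2 y) (by positivity : 0 ≤ 1 / (2 * g))
        linarith
      calc Real.exp (1 / (2 * g)) * (h y - g⁻¹ * 1)
          ≤ Real.exp (1 / (2 * g)) * (h y * Real.exp (-(1 / (2 * g)))) := by
            refine mul_le_mul_of_nonneg_left (e2.trans ?_) (Real.exp_pos _).le
            exact mul_le_mul_of_nonneg_left e1 (by linarith [h1 y])
        _ = h y * (Real.exp (1 / (2 * g)) * Real.exp (-(1 / (2 * g)))) := by ring
        _ = h y := by rw [← Real.exp_add]; simp
    · simp
  have hb : ∀ y, Real.exp ((if y ∈ A then (1 : ℝ) else 0) / (2 * g)) ≤ h y := fun y => by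
    refine le_trans ?_ (hw y)
    refine le_mul_of_one_le_right (Real.exp_pos _).le ?_
    split_ifs with hy
    · have h3 := hφ.stepAvg_potential_add_le A y
      have h4 := stepAvg_nonneg (f := fun y => ∑ z ∈ A, φ (y - z))
        (fun y => Finset.sum_nonneg fun z _ => (hφ.pos _).le) y
      rw [if_pos hy] at h3
      have : g⁻¹ * 1 ≤ g⁻¹ * ∑ z ∈ A, φ (y - z) :=
        mul_le_mul_of_nonneg_left (by linarith) (inv_nonneg.2 hg.le)
      simp only [hh]; linarith
    · simpa using h1 y
  refine le_trans ?_ (h2 x)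
  induction N generalizing x with
  | zero =>
    refine le_trans (le_of_eq ?_) (hb x)
    simp only [pathMean, pathVisits]
    split_ifs <;> simp
  | succ N ih =>
    have e : pathMean (N + 1) (fun l => Real.exp (pathVisits A x l / (2 * g))) =
        Real.exp ((if x ∈ A then (1 : ℝ) else 0) / (2 * g)) *
          stepAvg (fun y => pathMean N (fun l => Real.exp (pathVisits A y l / (2 * g)))) x := by
      rw [pathMean_succ (F := fun x l => Real.exp (pathVisits A x l / (2 * g)))
        (H := fun y l => Real.exp ((if x ∈ A then (1 : ℝ) else 0) / (2 * g)) *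
          Real.exp (pathVisits A y l / (2 * g)))]
      · simp only [pathMean_const_mul, stepAvg_const_mul]
      · intro e l
        rw [← Real.exp_add, ← add_div]
        simp [pathVisits]
    rw [e]
    refine le_trans ?_ (hw x)
    exact mul_le_mul_of_nonneg_left ((stepAvg_mono ih x).trans (hP x)) (Real.exp_pos _).le

theorem IsGreenBound.prob_card_le (hd : 0 < d) (hφ : IsGreenBound φ) {A : Finset (Fin d → ℤ)}
    {g : ℝ} (hg : 0 < g) (hA : ∀ x, ∑ z ∈ A, φ (x - z) ≤ g) (N : ℕ) (x : Fin d → ℤ) (M : ℝ) :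
    pathMean N ({l | M ≤ ((A ∩ pathRange x l).card : ℝ)}.indicator 1) ≤
      2 * Real.exp (-M / (2 * g)) := by
  have h := hφ.mean_exp_visits_le hd hg hA N x
  have h2 : pathMean N ({l | M ≤ ((A ∩ pathRange x l).card : ℝ)}.indicator 1) ≤
      pathMean N (fun l => Real.exp (-M / (2 * g)) * Real.exp (pathVisits A x l / (2 * g))) := by
    refine pathMean_mono (fun l => ?_) N
    rw [Set.indicator_apply]
    split_ifs with hl
    · rw [← Real.exp_add, ← add_div]
      refine Real.one_le_exp (div_nonneg ?_ (by positivity))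
      have : ((A ∩ pathRange x l).card : ℝ) ≤ pathVisits A x l := by
        exact_mod_cast card_pathRange_inter_le A x l
      have hl : M ≤ ((A ∩ pathRange x l).card : ℝ) := hl
      linarith
    · positivity
  rw [pathMean_const_mul] at h2
  refine h2.trans ?_
  rw [mul_comm 2 (Real.exp _)]
  exact mul_le_mul_of_nonneg_left h (Real.exp_pos _).le

/-- Optional stopping at y: φ (· - y) is nonnegative and superharmonic, and its value at y is at
least 1. -/
theorem IsGreenBound.prob_mem_le (hφ : IsGreenBound φ) (N : ℕ) (x y : Fin d → ℤ) :
    pathMean N ({l | y ∈ pathRange x l}.indicator 1) ≤ φ (x - y) := by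
  have h1 : 1 ≤ φ 0 := by
    have := hφ.superharmonic 0
    have h2 := stepAvg_nonneg (fun x => (hφ.pos x).le) (0 : Fin d → ℤ)
    simp at this; linarith
  induction N generalizing x with
  | zero =>
    simp only [pathMean, pathRange, Set.indicator_apply, Set.mem_ofPred_eq, Finset.mem_singleton]
    split_ifs with h
    · subst h; simpa using h1
    · exact (hφ.pos _).le
  | succ N ih =>
    by_cases hxy : y = x
    · subst hxy
      have e : ({l | y ∈ pathRange y l}.indicator 1 : List (Fin d → ℤ) → ℝ) = fun _ => 1 := by
        funext l
        rw [Set.indicator_of_mem]; rfl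
        cases l <;> simp [pathRange]
      rw [e, sub_self]
      -- In dimension 0 a path mean of positive length is an empty sum, hence 0 and not 1.
      rcases Nat.eq_zero_or_pos d with h0 | h0
      · subst h0; simpa [pathMean] using (hφ.pos _).le
      · rw [pathMean_const h0]; exact h1
    · rw [pathMean_succ (F := fun x => {l | y ∈ pathRange x l}.indicator 1)
        (H := fun x => {l | y ∈ pathRange x l}.indicator 1)]
      · refine (stepAvg_mono (g := fun z => φ (z - y)) ih x).trans ?_
        rw [stepAvg_sub_right]
        have := hφ.superharmonic (x - y)
        split_ifs at this <;> linarith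
      · intro e l
        simp [Set.indicator_apply, pathRange, hxy]

end GreenBound

/-! ### From probability measures to path means -/

/-- The list `[g m, …, g (m + N - 1)]`. -/
def slice {X : Type*} (g : ℕ → X) : ℕ → ℕ → List X
  | _, 0 => []
  | m, N + 1 => g m :: slice g (m + 1) N

theorem slice_congr {X : Type*} {g g' : ℕ → X} {m N : ℕ}
    (h : ∀ j ∈ Finset.Ico m (m + N), g j = g' j) : slice g m N = slice g' m N := by
  induction N generalizing m with
  | zero => rfl
  | succ N ih =>
    simp only [slice]
    rw [h m (by simp), ih fun j hj => h j (by simp at hj ⊢; omega)]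

theorem pathRange_slice {d : ℕ} (s : ℕ → Fin d → ℤ) (m N : ℕ) :
    pathRange (s m) (slice (fun n => s (n + 1) - s n) m N) =
      (Finset.range (N + 1)).image fun j => s (m + j) := by
  induction N generalizing m with
  | zero => simp [slice, pathRange]
  | succ N ih =>
    simp only [slice, pathRange, add_sub_cancel, ih]
    rw [Finset.range_add_one' (n := N + 1), Finset.image_insert]
    congr 1
    ext x; simp [add_assoc, add_comm 1]; rfl

section Neighbors

variable {d : ℕ}

/-- The nearest neighbours of the origin, listed by coordinate and sign. -/
def unitStep (p : Fin d × Bool) : Fin d → ℤ := if p.2 then Pi.single p.1 1 else -Pi.single p.1 1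

theorem unitStep_injective : Function.Injective (unitStep (d := d)) := by
  rintro ⟨i, b⟩ ⟨j, c⟩ h
  have hi := congrFun h i
  have hj := congrFun h j
  by_cases hij : i = j
  · subst hij
    cases b <;> cases c <;> simp [unitStep] at hi ⊢
  · cases b <;> cases c <;> simp [unitStep, hij] at hi

theorem originNeighbors_eq : originNeighbors d = (Finset.univ.image (unitStep (d := d)) : Set _) := by
  ext x
  simp only [originNeighbors, Set.mem_ofPred_eq, Finset.coe_image, Finset.coe_univ, Set.image_univ,
    Set.mem_range]
  constructor
  · intro h
    have hne : ∃ i, x i ≠ 0 := by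
      by_contra! hc
      simp [hc] at h
    obtain ⟨i, hi⟩ := hne
    rw [← Finset.add_sum_erase _ _ (Finset.mem_univ i)] at h
    have h1 : 1 ≤ |x i| := Int.one_le_abs hi
    have h2 : 0 ≤ ∑ j ∈ Finset.univ.erase i, |x j| := Finset.sum_nonneg fun _ _ => abs_nonneg _
    have h3 : ∑ j ∈ Finset.univ.erase i, |x j| = 0 := by omega
    have h4 : |x i| = 1 := by omega
    have h5 : ∀ j, j ≠ i → x j = 0 := fun j hj => by
      have := (Finset.sum_eq_zero_iff_of_nonneg fun _ _ => abs_nonneg _).1 h3 j (by simp [hj])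
      simpa using this
    rcases (abs_eq (by norm_num)).1 h4 with h6 | h6
    · refine ⟨(i, true), ?_⟩
      ext j
      by_cases hj : j = i
      · subst hj; simp [unitStep, h6]
      · simp [unitStep, hj, h5 j hj]
    · refine ⟨(i, false), ?_⟩
      ext j
      by_cases hj : j = i
      · subst hj; simp [unitStep, h6]
      · simp [unitStep, hj, h5 j hj]
  · rintro ⟨⟨i, b⟩, rfl⟩
    rw [← Finset.add_sum_erase _ _ (Finset.mem_univ i), Finset.sum_eq_zero]
    · cases b <;> simp [unitStep]
    · intro j hj
      cases b <;> simp [unitStep, Finset.ne_of_mem_erase hj]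

theorem uniformOn_originNeighbors_singleton (p : Fin d × Bool) :
    uniformOn (originNeighbors d) {unitStep p} = ENNReal.ofReal (1 / (2 * d)) := by
  have hd : 0 < d := Fin.pos p.1
  rw [originNeighbors_eq, ← Finset.coe_singleton, uniformOn_apply_finset,
    Finset.card_image_of_injective _ unitStep_injective, Finset.inter_singleton_of_mem (by simp)]
  rw [ENNReal.ofReal_div_of_pos (by positivity)]
  simp [mul_comm, ENNReal.ofReal_mul]

end Neighbors

namespace IsSimpleRandomWalk

variable {Ω : Type*} [MeasurableSpace Ω] {μ : Measure Ω} {d : ℕ} {S : ℕ → Ω → (Fin d → ℤ)}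

theorem measurable_increment (hS : IsSimpleRandomWalk μ S) (n : ℕ) :
    Measurable fun ω => S (n + 1) ω - S n ω :=
  (hS.measurable (n + 1)).sub (hS.measurable n)

theorem real_increment_eq (hS : IsSimpleRandomWalk μ S) (n : ℕ) (p : Fin d × Bool) :
    μ.real {ω | S (n + 1) ω - S n ω = unitStep p} = 1 / (2 * d) := by
  have h := uniformOn_originNeighbors_singleton p
  rw [← hS.law_increment n, Measure.map_apply (hS.measurable_increment n)
    (MeasurableSet.singleton _)] at h
  have h2 : μ {ω | S (n + 1) ω - S n ω = unitStep p} = ENNReal.ofReal (1 / (2 * d)) := h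
  rw [measureReal_def, h2, ENNReal.toReal_ofReal (by positivity)]

theorem ae_increment_mem (hS : IsSimpleRandomWalk μ S) (n : ℕ) :
    ∀ᵐ ω ∂μ, ∃ p : Fin d × Bool, S (n + 1) ω - S n ω = unitStep p := by
  have hfin : (originNeighbors d).Finite := by rw [originNeighbors_eq]; exact Finset.finite_toSet _
  have h : uniformOn (originNeighbors d) (originNeighbors d)ᶜ = 0 := by
    rw [uniformOn_eq_zero_iff hfin]; simp
  rw [← hS.law_increment n, Measure.map_apply (hS.measurable_increment n)
    (hfin.measurableSet.compl)] at h
  have h2 : ∀ᵐ ω ∂μ, S (n + 1) ω - S n ω ∈ originNeighbors d := by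
    rw [ae_iff]; exact h
  filter_upwards [h2] with ω hω
  rw [originNeighbors_eq] at hω
  simpa [eq_comm] using hω

theorem _root_.measurableSet_slice {Ω : Type*} [MeasurableSpace Ω] {d : ℕ}
    {S : ℕ → Ω → (Fin d → ℤ)} (hS : ∀ n, Measurable (S n)) (m N : ℕ)
    (Q : Set (List (Fin d → ℤ))) :
    MeasurableSet {ω | slice (fun n => S (n + 1) ω - S n ω) m N ∈ Q} := by
  induction N generalizing m Q with
  | zero => simp [slice]
  | succ N ih =>
    have : {ω | slice (fun n => S (n + 1) ω - S n ω) m (N + 1) ∈ Q} =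
        ⋃ e, ({ω | S (m + 1) ω - S m ω = e} ∩
          {ω | slice (fun n => S (n + 1) ω - S n ω) (m + 1) N ∈ {l | e :: l ∈ Q}}) := by
      ext ω; simp [slice]
    rw [this]
    exact MeasurableSet.iUnion fun e =>
      (((hS (m + 1)).sub (hS m)) (MeasurableSet.singleton e)).inter (ih _ _)

/-- The steps of a simple random walk are distributed as in `pathMean`. -/
theorem real_slice_eq [IsProbabilityMeasure μ] (hS : IsSimpleRandomWalk μ S)
    (m N : ℕ) (Q : Set (List (Fin d → ℤ))) :
    μ.real {ω | slice (fun n => S (n + 1) ω - S n ω) m N ∈ Q} = pathMean N (Q.indicator 1) := by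
  induction N generalizing m Q with
  | zero => by_cases h : [] ∈ Q <;> simp [slice, pathMean, h]
  | succ N ih =>
    set E : Fin d × Bool → Set Ω := fun p => {ω | S (m + 1) ω - S m ω = unitStep p} ∩
      {ω | slice (fun n => S (n + 1) ω - S n ω) (m + 1) N ∈ {l | unitStep p :: l ∈ Q}} with hE
    have h1 : {ω | slice (fun n => S (n + 1) ω - S n ω) m (N + 1) ∈ Q} =ᵐ[μ]
        ⋃ p ∈ (Finset.univ : Finset (Fin d × Bool)), E p := by
      filter_upwards [hS.ae_increment_mem m] with ω ⟨p, hp⟩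
      apply propext
      change _ ∈ Q ↔ ω ∈ ⋃ p ∈ (Finset.univ : Finset (Fin d × Bool)), E p
      simp only [hE, Finset.mem_univ, Set.iUnion_true, Set.mem_iUnion, slice]
      constructor
      · intro h
        exact ⟨p, hp, by simpa [hp] using h⟩
      · rintro ⟨q, hq, h⟩
        have hq : S (m + 1) ω - S m ω = unitStep q := hq
        rw [hq]; exact h
    have hm : ∀ p, MeasurableSet (E p) := fun p =>
      (hS.measurable_increment m (MeasurableSet.singleton _)).inter (measurableSet_slice hS.measurable _ _ _)
    rw [measureReal_congr h1, measureReal_biUnion_finset]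
    · have h2 : ∀ p, μ.real (E p) = 1 / (2 * d) *
          pathMean N ({l | unitStep p :: l ∈ Q}.indicator 1) := by
        intro p
        have hind := hS.indep_increments.indepFun_finset {m} (Finset.Ico (m + 1) (m + 1 + N))
          (by simp) hS.measurable_increment
        -- The later steps are a function of finitely many increments, those with index in the
        -- window; the default value 0 outside the window is never read.
        have h3 := hind.measure_inter_preimage_eq_mul {τ | τ ⟨m, by simp⟩ = unitStep p}
          {τ | slice (fun n => if h : n ∈ Finset.Ico (m + 1) (m + 1 + N) then τ ⟨n, h⟩ else 0)
            (m + 1) N ∈ {l | unitStep p :: l ∈ Q}} (MeasurableSet.of_discrete)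
          (MeasurableSet.of_discrete)
        have e : ∀ ω, slice (fun n => if h : n ∈ Finset.Ico (m + 1) (m + 1 + N) then
            S (n + 1) ω - S n ω else 0) (m + 1) N =
              slice (fun n => S (n + 1) ω - S n ω) (m + 1) N := fun ω =>
          slice_congr fun j hj => by rw [dif_pos hj]
        simp only [Set.preimage_ofPred_eq, e] at h3
        rw [← ih (m + 1), ← hS.real_increment_eq m p, measureReal_def, measureReal_def,
          measureReal_def, ← ENNReal.toReal_mul]
        exact congrArg _ h3
      simp only [h2, Fintype.sum_prod_type, Fintype.sum_bool, pathMean]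
      rw [Finset.sum_div]
      refine Finset.sum_congr rfl fun i _ => ?_
      simp only [unitStep, Bool.false_eq_true, if_true, if_false]
      have e : ∀ e : Fin d → ℤ, ({l | e :: l ∈ Q}.indicator 1 : List (Fin d → ℤ) → ℝ) =
          fun l => Q.indicator 1 (e :: l) := fun e => rfl
      rw [e, e]; ring
    · intro p _ q _ hpq
      refine Set.disjoint_left.2 fun ω hp hq => hpq (unitStep_injective ?_)
      exact (hp.1 : S (m + 1) ω - S m ω = unitStep p).symm.trans hq.1
    · exact fun p _ => hm p

theorem mem_pathRange_slice (hS : IsSimpleRandomWalk μ S) (ω : Ω) (N : ℕ) (x : Fin d → ℤ) :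
    x ∈ pathRange 0 (slice (fun n => S (n + 1) ω - S n ω) 0 N) ↔ ∃ j ≤ N, S j ω = x := by
  have := pathRange_slice (fun n => S n ω) 0 N
  rw [hS.start] at this
  rw [this]; simp

theorem measurableSet_mem_range (hS : IsSimpleRandomWalk μ S) (x : Fin d → ℤ) :
    MeasurableSet {ω | x ∈ Set.range fun n => S n ω} := by
  have : {ω | x ∈ Set.range fun n => S n ω} = ⋃ n, {ω | S n ω = x} := by ext ω; simp
  rw [this]
  exact MeasurableSet.iUnion fun n => hS.measurable n (MeasurableSet.singleton x)

open Classical in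
-- The finite-horizon bound does not depend on the horizon. The events increase with it, and since A
-- is finite all its visited points are reached by some finite time, so continuity from below gives
-- the infinite range.
theorem real_card_inter_range_le [IsProbabilityMeasure μ] (hS : IsSimpleRandomWalk μ S)
    (hd : 0 < d) {φ : (Fin d → ℤ) → ℝ} (hφ : IsGreenBound φ) {A : Finset (Fin d → ℤ)} {g : ℝ}
    (hg : 0 < g) (hA : ∀ x, ∑ z ∈ A, φ (x - z) ≤ g) (M : ℝ) :
    μ.real {ω | M ≤ ((A.filter (· ∈ Set.range fun n => S n ω)).card : ℝ)} ≤
      2 * Real.exp (-M / (2 * g)) := by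
  set s : ℕ → Set Ω := fun N => {ω | slice (fun n => S (n + 1) ω - S n ω) 0 N ∈
    {l | M ≤ ((A ∩ pathRange 0 l).card : ℝ)}} with hs
  have hmono : Monotone s := by
    intro N N' hN ω hω
    refine le_trans (show M ≤ _ from hω) ?_
    norm_cast
    refine Finset.card_le_card (Finset.inter_subset_inter_left fun x hx => ?_)
    rw [hS.mem_pathRange_slice] at hx ⊢
    obtain ⟨j, hj, h⟩ := hx
    exact ⟨j, hj.trans hN, h⟩
  have hsub : {ω | M ≤ ((A.filter (· ∈ Set.range fun n => S n ω)).card : ℝ)} ⊆ ⋃ N, s N := by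
    intro ω hω
    have : ∀ x ∈ A.filter (· ∈ Set.range fun n => S n ω), ∃ j, S j ω = x := fun x hx => by
      simpa using (Finset.mem_filter.1 hx).2
    choose! j hj using this
    refine Set.mem_iUnion.2 ⟨(A.filter (· ∈ Set.range fun n => S n ω)).sup j, ?_⟩
    refine le_trans (show M ≤ _ from hω) ?_
    norm_cast
    refine Finset.card_le_card fun x hx => Finset.mem_inter.2 ⟨(Finset.mem_filter.1 hx).1, ?_⟩
    rw [hS.mem_pathRange_slice]
    exact ⟨j x, Finset.le_sup hx, hj x hx⟩
  refine (measureReal_mono hsub).trans ?_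
  have ht := (ENNReal.tendsto_toReal (measure_ne_top μ _)).comp
    (tendsto_measure_iUnion_atTop (μ := μ) hmono)
  refine le_of_tendsto ht (Filter.Eventually.of_forall fun N => ?_)
  have := hS.real_slice_eq 0 N {l | M ≤ ((A ∩ pathRange 0 l).card : ℝ)}
  exact this.le.trans (hφ.prob_card_le hd hg hA N 0 M)

end IsSimpleRandomWalk

/-! ### Growth of a finite set in dyadic balls -/

open Classical in
/-- The part of `A` in the closed ball of radius `r` around `z`. -/
noncomputable def ballPart {d : ℕ} (A : Finset (Fin d → ℤ)) (z : Fin d → ℤ) (r : ℝ) :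
    Finset (Fin d → ℤ) := A.filter fun y => ‖y - z‖ ≤ r

theorem mem_ballPart {d : ℕ} {A : Finset (Fin d → ℤ)} {z y : Fin d → ℤ} {r : ℝ} :
    y ∈ ballPart A z r ↔ y ∈ A ∧ ‖y - z‖ ≤ r := by simp [ballPart]

/-- The number of points of `A` in dyadic balls centred in `A` is bounded by `f`. -/
def HasGrowth {d : ℕ} (A : Finset (Fin d → ℤ)) (f : ℕ → ℝ) : Prop :=
  ∀ z ∈ A, ∀ j : ℕ, ((ballPart A z (2 ^ j)).card : ℝ) ≤ f j

section Growth

variable {d : ℕ}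

open Classical in
-- The first dyadic radius that contains w already gives the bound. Keeping all larger radii as well
-- turns a sum over w into counts of points in dyadic balls.
theorem decay_le_sum_dyadic (w : Fin d → ℤ) {i : ℕ} (hw : ‖w‖ ≤ 2 ^ i) :
    decay w ≤ 2 ^ (d - 2) *
      ∑ j ∈ Finset.range (i + 1), if ‖w‖ ≤ 2 ^ j then (((2 : ℝ) ^ j) ^ (d - 2))⁻¹ else 0 := by
  have hex : ∃ j : ℕ, ‖w‖ ≤ 2 ^ j := ⟨i, hw⟩
  set j := Nat.find hex with hj
  have hji : j ≤ i := Nat.find_min' hex hw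
  have h1 : (((2 : ℝ) ^ j) ^ (d - 2))⁻¹ ≤
      ∑ j ∈ Finset.range (i + 1), if ‖w‖ ≤ 2 ^ j then (((2 : ℝ) ^ j) ^ (d - 2))⁻¹ else 0 := by
    refine le_trans (if_pos (Nat.find_spec hex)).ge (Finset.single_le_sum
      (f := fun j => if ‖w‖ ≤ 2 ^ j then (((2 : ℝ) ^ j) ^ (d - 2))⁻¹ else 0) (fun k _ => ?_)
      (Finset.mem_range.2 (Nat.lt_succ_of_le hji)))
    split_ifs <;> positivity
  refine le_trans ?_ (mul_le_mul_of_nonneg_left h1 (by positivity))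
  rcases Nat.eq_zero_or_pos j with h0 | h0
  · rw [h0]; simp only [pow_zero, one_pow, inv_one, mul_one]
    exact (decay_le_one w).trans (one_le_pow₀ (by norm_num))
  · obtain ⟨k, hk⟩ : ∃ k, j = k + 1 := ⟨j - 1, by omega⟩
    have h2 : ¬ ‖w‖ ≤ 2 ^ k := Nat.find_min hex (by omega)
    rw [not_le] at h2
    rw [hk, decay, pow_succ, mul_pow, mul_inv, mul_comm ((_ : ℝ)⁻¹), ← mul_assoc,
      mul_inv_cancel₀ (by positivity), one_mul]
    gcongr; linarith

theorem decay_le_of_norm_le {w w' : Fin d → ℤ} (h : ‖w'‖ ≤ 2 * ‖w‖) :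
    decay w ≤ 2 ^ (d - 2) * decay w' := by
  unfold decay
  rw [← div_eq_mul_inv, inv_eq_one_div, div_le_div_iff₀ (by positivity) (by positivity), one_mul,
    ← mul_pow]
  gcongr; linarith

/-- Growth is known only around points of A, so x is replaced by its nearest point z₁ in the ball
part. This at most doubles distances, since ‖z - z₁‖ ≤ 2 ‖x - z‖, and costs a factor 2 ^ (d - 2).
Two points of a ball of radius 2 ^ i are at distance at most 2 ^ (i + 1), hence the scales up to i +
1. -/
theorem sum_decay_le_of_growth {A : Finset (Fin d → ℤ)} {f : ℕ → ℝ} (hf : ∀ j, 0 ≤ f j)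
    (hA : HasGrowth A f) (z₀ : Fin d → ℤ) (i : ℕ) (x : Fin d → ℤ) :
    ∑ z ∈ ballPart A z₀ (2 ^ i), decay (x - z) ≤
      4 ^ (d - 2) * ∑ j ∈ Finset.range (i + 2), f j / (2 ^ j) ^ (d - 2) := by
  classical
  set A' := ballPart A z₀ (2 ^ i) with hA'
  have hR : 0 ≤ ∑ j ∈ Finset.range (i + 2), f j / ((2 : ℝ) ^ j) ^ (d - 2) :=
    Finset.sum_nonneg fun j _ => div_nonneg (hf j) (by positivity)
  rcases A'.eq_empty_or_nonempty with h0 | h0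
  · rw [h0]; simp only [Finset.sum_empty]; positivity
  obtain ⟨z₁, hz₁, hmin⟩ := A'.exists_min_image (fun z => ‖x - z‖) h0
  have h1 : ∀ z ∈ A', decay (x - z) ≤ 4 ^ (d - 2) *
      ∑ j ∈ Finset.range (i + 2), if ‖z - z₁‖ ≤ 2 ^ j then (((2 : ℝ) ^ j) ^ (d - 2))⁻¹ else 0 := by
    intro z hz
    have e1 : ‖z - z₁‖ ≤ 2 * ‖x - z‖ := by
      have := norm_sub_le (x - z₁) (x - z)
      rw [sub_sub_sub_cancel_left] at this
      linarith [hmin z hz]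
    have e2 : ‖z - z₁‖ ≤ 2 ^ (i + 1) := by
      have := norm_sub_le (z - z₀) (z₁ - z₀)
      rw [sub_sub_sub_cancel_right] at this
      have := (mem_ballPart.1 hz).2
      have := (mem_ballPart.1 hz₁).2
      rw [pow_succ]; linarith
    refine (decay_le_of_norm_le e1).trans ?_
    have := mul_le_mul_of_nonneg_left (decay_le_sum_dyadic (z - z₁) e2)
      (by positivity : (0 : ℝ) ≤ 2 ^ (d - 2))
    refine this.trans (le_of_eq ?_)
    rw [← mul_assoc, ← mul_pow]; norm_num
  refine (Finset.sum_le_sum h1).trans ?_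
  rw [← Finset.mul_sum, Finset.sum_comm]
  gcongr with j _
  rw [← Finset.sum_filter, Finset.sum_const, nsmul_eq_mul, div_eq_mul_inv]
  refine mul_le_mul_of_nonneg_right ?_ (by positivity)
  refine le_trans ?_ (hA z₁ (mem_ballPart.1 hz₁).1 j)
  norm_cast
  refine Finset.card_le_card fun y hy => ?_
  rw [Finset.mem_filter] at hy
  exact mem_ballPart.2 ⟨(mem_ballPart.1 hy.1).1, hy.2⟩

/-- The lattice points of norm at most `r`. -/
noncomputable def latticeBall (d r : ℕ) : Finset (Fin d → ℤ) :=
  Fintype.piFinset fun _ => Finset.Icc (-(r : ℤ)) r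

theorem mem_latticeBall {r : ℕ} {x : Fin d → ℤ} : x ∈ latticeBall d r ↔ ‖x‖ ≤ r := by
  rw [pi_norm_le_iff_of_nonneg (by positivity)]
  simp only [latticeBall, Fintype.mem_piFinset, Finset.mem_Icc, Int.norm_eq_abs]
  refine forall_congr' fun i => ?_
  rw [← abs_le]
  norm_cast

theorem card_latticeBall (r : ℕ) : (latticeBall d r).card = (2 * r + 1) ^ d := by
  simp [latticeBall]
  congr 1; omega

theorem card_ballPart_le (A : Finset (Fin d → ℤ)) (z : Fin d → ℤ) (j : ℕ) :
    ((ballPart A z (2 ^ j)).card : ℝ) ≤ 3 ^ d * (2 ^ j) ^ d := by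
  have h1 : (ballPart A z (2 ^ j)).card ≤ (latticeBall d (2 ^ j)).card := by
    refine Finset.card_le_card_of_injOn (fun y => y - z) (fun y hy => ?_)
      (fun a _ b _ h => sub_left_injective h)
    have := (mem_ballPart.1 hy).2
    simp only [Finset.mem_coe, mem_latticeBall]
    exact_mod_cast this
  rw [card_latticeBall] at h1
  have h2 : (2 * 2 ^ j + 1) ^ d ≤ (3 * 2 ^ j) ^ d := by
    gcongr; have := Nat.one_le_two_pow (n := j); omega
  rw [← mul_pow]
  exact_mod_cast h1.trans h2

/-- Bounds on the growth of successive intersections of ranges. -/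
noncomputable def growthSeq (d : ℕ) (D : ℝ) : ℕ → ℕ → ℝ
  | 0, j => 3 ^ d * (2 ^ j) ^ d
  | m + 1, i => D * ∑ j ∈ Finset.range (i + 2),
      min (growthSeq d D m j) (3 ^ d * (2 ^ j) ^ d) / (2 ^ j) ^ (d - 2)

theorem growthSeq_pos {D : ℝ} (hD : 0 < D) (m j : ℕ) : 0 < growthSeq d D m j := by
  induction m generalizing j with
  | zero => unfold growthSeq; positivity
  | succ m ih =>
    unfold growthSeq
    refine mul_pos hD (Finset.sum_pos (fun i _ => ?_) (by simp))
    have := ih i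
    positivity

theorem growthSeq_succ_mono {D : ℝ} (hD : 0 < D) (m : ℕ) : Monotone (growthSeq d D (m + 1)) := by
  intro i i' h
  unfold growthSeq
  refine mul_le_mul_of_nonneg_left (Finset.sum_le_sum_of_subset_of_nonneg ?_ ?_) hD.le
  · exact Finset.range_mono (by omega)
  · intro j _ _
    have := growthSeq_pos (d := d) hD m j
    positivity

theorem HasGrowth.sum_le {A : Finset (Fin d → ℤ)} {D : ℝ} (hD : 0 < D) {m : ℕ}
    (hA : HasGrowth A (growthSeq d D m)) {φ : (Fin d → ℤ) → ℝ} {C : ℝ} (hC : 0 < C)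
    (hφC : ∀ x, φ x ≤ C * decay x) (z₀ : Fin d → ℤ) (i : ℕ) (x : Fin d → ℤ) :
    ∑ z ∈ ballPart A z₀ (2 ^ i), φ (x - z) ≤ C * 4 ^ (d - 2) / D * growthSeq d D (m + 1) i := by
  have h1 : HasGrowth A fun j => min (growthSeq d D m j) (3 ^ d * (2 ^ j) ^ d) :=
    fun z hz j => le_min (hA z hz j) (card_ballPart_le A z j)
  have h2 := sum_decay_le_of_growth (fun j => (by
    have := growthSeq_pos (d := d) hD m j
    positivity)) h1 z₀ i x
  calc ∑ z ∈ ballPart A z₀ (2 ^ i), φ (x - z)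
      ≤ ∑ z ∈ ballPart A z₀ (2 ^ i), C * decay (x - z) := Finset.sum_le_sum fun z _ => hφC _
    _ = C * ∑ z ∈ ballPart A z₀ (2 ^ i), decay (x - z) := by rw [Finset.mul_sum]
    _ ≤ C * (4 ^ (d - 2) * _) := mul_le_mul_of_nonneg_left h2 hC.le
    _ = _ := by rw [growthSeq]; field_simp

open Classical in
/-- With high probability, intersecting with the range of a walk improves the growth bound. -/
theorem IsSimpleRandomWalk.real_not_hasGrowth_le {Ω : Type*} [MeasurableSpace Ω] {μ : Measure Ω}
    [IsProbabilityMeasure μ] {S : ℕ → Ω → (Fin d → ℤ)} (hS : IsSimpleRandomWalk μ S) (hd : 0 < d)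
    {φ : (Fin d → ℤ) → ℝ} (hφ : IsGreenBound φ) {C : ℝ} (hC : 0 < C)
    (hφC : ∀ x, φ x ≤ C * decay x) {v : ℝ} (hv : 0 < v) {m J : ℕ} {A : Finset (Fin d → ℤ)}
    (hAJ : A ⊆ latticeBall d (2 ^ J))
    (hA : HasGrowth A (growthSeq d (2 * C * 4 ^ (d - 2) * v) m)) :
    μ.real {ω | ¬ HasGrowth (A.filter (· ∈ Set.range fun n => S n ω))
      (growthSeq d (2 * C * 4 ^ (d - 2) * v) (m + 1))} ≤
      A.card * ((J + 2) * (2 * Real.exp (-v))) := by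
  set D := 2 * C * 4 ^ (d - 2) * v with hDd
  have hD : 0 < D := by positivity
  set E : (Fin d → ℤ) → ℕ → Set Ω := fun z i => {ω | growthSeq d D (m + 1) i ≤
    (((ballPart A z (2 ^ i)).filter (· ∈ Set.range fun n => S n ω)).card : ℝ)} with hE
  have hEle : ∀ z i, μ.real (E z i) ≤ 2 * Real.exp (-v) := by
    intro z i
    have hg := growthSeq_pos (d := d) hD (m + 1) i
    have := hS.real_card_inter_range_le hd hφ (g := C * 4 ^ (d - 2) / D * growthSeq d D (m + 1) i)
      (by positivity) (hA.sum_le hD hC hφC z i) (growthSeq d D (m + 1) i)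
    refine this.trans (le_of_eq ?_)
    -- The constant D = 2 C 4 ^ (d - 2) v is chosen so that the threshold divided by twice the
    -- potential bound is exactly v.
    have key : ∀ G : ℝ, G ≠ 0 → -G / (2 * (C * 4 ^ (d - 2) / D * G)) = -v := by
      intro G hG
      rw [hDd]; field_simp
    rw [key _ hg.ne']
  have hsub : {ω | ¬ HasGrowth (A.filter (· ∈ Set.range fun n => S n ω))
      (growthSeq d D (m + 1))} ⊆ ⋃ z ∈ A, ⋃ i ∈ Finset.range (J + 2), E z i := by
    intro ω hω
    have hω : ¬ HasGrowth (A.filter (· ∈ Set.range fun n => S n ω)) (growthSeq d D (m + 1)) := hω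
    unfold HasGrowth at hω
    push Not at hω
    obtain ⟨z, hz, j, hj⟩ := hω
    have hzA := (Finset.mem_filter.1 hz).1
    simp only [Set.mem_iUnion]
    -- A lies in a box of radius 2 ^ J, so a ball of radius 2 ^ (J + 1) around a point of A contains
    -- all of A. Larger scales bring no new event because the growth bound is monotone in the scale.
    refine ⟨z, hzA, min j (J + 1), by simp, ?_⟩
    refine (growthSeq_succ_mono hD m (min_le_left _ _)).trans (hj.le.trans ?_)
    norm_cast
    refine Finset.card_le_card fun y hy => ?_
    obtain ⟨hy1, hy2⟩ := mem_ballPart.1 hy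
    obtain ⟨hy3, hy4⟩ := Finset.mem_filter.1 hy1
    refine Finset.mem_filter.2 ⟨mem_ballPart.2 ⟨hy3, ?_⟩, hy4⟩
    rcases min_choice j (J + 1) with h | h <;> rw [h]
    · exact hy2
    · have h1 := mem_latticeBall.1 (hAJ hy3)
      have h2 := mem_latticeBall.1 (hAJ hzA)
      have := norm_sub_le y z
      push_cast at h1 h2
      push_cast [pow_succ]; linarith
  refine (measureReal_mono hsub (measure_ne_top μ _)).trans ((measureReal_biUnion_finset_le _ _).trans ?_)
  rw [← nsmul_eq_mul]
  refine Finset.sum_le_card_nsmul _ _ _ fun z _ => (measureReal_biUnion_finset_le _ _).trans ?_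
  have := Finset.sum_le_card_nsmul (Finset.range (J + 2)) (fun i => μ.real (E z i)) _
    fun i _ => hEle z i
  simpa using this

end Growth

/-! ### Revealing the ranges one walk at a time -/

section Intersections

variable {Ω : Type*} {d k : ℕ}

open Classical in
/-- The points of `Λ` visited by each of the first `m` walks. -/
noncomputable def visitedBy (Λ : Finset (Fin d → ℤ)) (S : Fin k → ℕ → Ω → (Fin d → ℤ)) (m : ℕ)
    (ω : Ω) : Finset (Fin d → ℤ) :=
  Λ.filter fun x => ∀ i : Fin k, i.val < m → x ∈ Set.range fun n => S i n ω

theorem visitedBy_subset (Λ : Finset (Fin d → ℤ)) (S : Fin k → ℕ → Ω → (Fin d → ℤ)) (m : ℕ)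
    (ω : Ω) : visitedBy Λ S m ω ⊆ Λ := by
  classical
  intro x hx
  simp only [visitedBy, Finset.mem_filter] at hx
  exact hx.1

open Classical in
theorem visitedBy_succ (Λ : Finset (Fin d → ℤ)) (S : Fin k → ℕ → Ω → (Fin d → ℤ)) {m : ℕ}
    (hm : m < k) (ω : Ω) : visitedBy Λ S (m + 1) ω =
      (visitedBy Λ S m ω).filter (· ∈ Set.range fun n => S ⟨m, hm⟩ n ω) := by
  ext x
  simp only [visitedBy, Finset.mem_filter, and_assoc]
  refine and_congr_right fun _ => ⟨fun h => ⟨fun i hi => h i (by omega), h ⟨m, hm⟩ (by simp)⟩,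
    fun h i hi => ?_⟩
  rcases Nat.lt_succ_iff_lt_or_eq.1 hi with hi | hi
  · exact h.1 i hi
  · have : i = ⟨m, hm⟩ := Fin.ext hi
    rw [this]; exact h.2

variable [MeasurableSpace Ω] {μ : Measure Ω}

namespace AreIndepSimpleRandomWalks

variable {S : Fin k → ℕ → Ω → (Fin d → ℤ)}

/-- Inside a finite box the range is recorded by a function from the box to `Prop`. This space is
finite and discrete, so every event about it is measurable and independence passes to it. -/
theorem iIndepFun_mem_range (hS : AreIndepSimpleRandomWalks μ S) (Λ : Finset (Fin d → ℤ)) :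
    iIndepFun (fun (i : Fin k) ω (x : Λ) => (x : Fin d → ℤ) ∈ Set.range fun n => S i n ω) μ := by
  refine hS.indep.comp (fun _ (τ : ℕ → Fin d → ℤ) (x : Λ) => (x : Fin d → ℤ) ∈ Set.range τ)
    fun _ => measurable_pi_iff.2 fun x => measurable_to_prop ?_
  have : (fun τ : ℕ → Fin d → ℤ => (x : Fin d → ℤ) ∈ Set.range τ) ⁻¹' {True} =
      ⋃ n, (fun τ : ℕ → Fin d → ℤ => τ n) ⁻¹' {(x : Fin d → ℤ)} := by ext τ; simp
  rw [this]
  exact MeasurableSet.iUnion fun n => measurable_pi_apply n (MeasurableSet.singleton _)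

theorem measurable_mem_range (hS : AreIndepSimpleRandomWalks μ S) (Λ : Finset (Fin d → ℤ))
    (i : Fin k) :
    Measurable fun ω (x : Λ) => (x : Fin d → ℤ) ∈ Set.range fun n => S i n ω := by
  refine measurable_pi_iff.2 fun x => measurable_to_prop ?_
  have := (hS.walk i).measurableSet_mem_range (x : Fin d → ℤ)
  refine (congrArg MeasurableSet ?_).mp this
  ext ω; simp

theorem measurableSet_visitedBy_eq (hS : AreIndepSimpleRandomWalks μ S)
    (Λ A : Finset (Fin d → ℤ)) (m : ℕ) : MeasurableSet {ω | visitedBy Λ S m ω = A} := by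
  classical
  have hm : Measurable fun ω (i : Fin k) (x : Λ) =>
      (x : Fin d → ℤ) ∈ Set.range fun n => S i n ω :=
    measurable_pi_iff.2 fun i => hS.measurable_mem_range Λ i
  have := hm (MeasurableSet.of_discrete (s := {τ : Fin k → Λ → Prop |
    Λ.filter (fun x => ∃ h : x ∈ Λ, ∀ i : Fin k, i.val < m → τ i ⟨x, h⟩) = A}))
  refine (congrArg MeasurableSet ?_).mp this
  ext ω
  simp only [Set.mem_preimage, Set.mem_ofPred_eq, visitedBy]
  refine Eq.congr_left (Finset.filter_congr fun x hx => ?_)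
  simp [hx]

open Classical in
theorem real_inter_visitedBy (hS : AreIndepSimpleRandomWalks μ S) (Λ A : Finset (Fin d → ℤ))
    (hA : A ⊆ Λ) (Q : Finset (Fin d → ℤ) → Prop) {m : ℕ} (hm : m < k) :
    μ.real ({ω | visitedBy Λ S m ω = A} ∩
      {ω | Q (A.filter (· ∈ Set.range fun n => S ⟨m, hm⟩ n ω))}) =
    μ.real {ω | visitedBy Λ S m ω = A} *
      μ.real {ω | Q (A.filter (· ∈ Set.range fun n => S ⟨m, hm⟩ n ω))} := by
  have hind := (hS.iIndepFun_mem_range Λ).indepFun_finset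
    (Finset.univ.filter fun i : Fin k => i.val < m) {⟨m, hm⟩} (by simp) (hS.measurable_mem_range Λ)
  have h := hind.measure_inter_preimage_eq_mul
    {τ | Λ.filter (fun x => ∃ h : x ∈ Λ, ∀ i (hi : i ∈ Finset.univ.filter fun i : Fin k => i.val < m),
      τ ⟨i, hi⟩ ⟨x, h⟩) = A}
    {τ | Q (A.filter fun x => ∃ h : x ∈ Λ, τ ⟨⟨m, hm⟩, by simp⟩ ⟨x, h⟩)}
    MeasurableSet.of_discrete MeasurableSet.of_discrete
  have e1 : {ω | visitedBy Λ S m ω = A} =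
      (fun ω (i : (Finset.univ.filter fun i : Fin k => i.val < m)) (x : Λ) =>
        (x : Fin d → ℤ) ∈ Set.range fun n => S i n ω) ⁻¹'
      {τ | Λ.filter (fun x => ∃ h : x ∈ Λ,
        ∀ i (hi : i ∈ Finset.univ.filter fun i : Fin k => i.val < m), τ ⟨i, hi⟩ ⟨x, h⟩) = A} := by
    ext ω
    simp only [Set.mem_preimage, Set.mem_ofPred_eq, visitedBy]
    refine Eq.congr_left (Finset.filter_congr fun x hx => ?_)
    simp [hx]
  have e2 : {ω | Q (A.filter (· ∈ Set.range fun n => S ⟨m, hm⟩ n ω))} =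
      (fun ω (i : ({⟨m, hm⟩} : Finset (Fin k))) (x : Λ) =>
        (x : Fin d → ℤ) ∈ Set.range fun n => S i n ω) ⁻¹'
      {τ | Q (A.filter fun x => ∃ h : x ∈ Λ, τ ⟨⟨m, hm⟩, by simp⟩ ⟨x, h⟩)} := by
    ext ω
    simp only [Set.mem_preimage, Set.mem_ofPred_eq]
    refine iff_of_eq (congrArg Q (Finset.filter_congr fun x hx => ?_))
    simp [hA hx]
  rw [e1, e2]
  simp only [measureReal_def, ← ENNReal.toReal_mul]
  exact congrArg _ h

open Classical in
-- Conditioning on the set visited by the walks 0, …, m - 1, which takes finitely many values and is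
-- independent of walk m: a bound that is uniform over admissible deterministic sets A survives
-- averaging.
theorem real_visitedBy_step_le [IsProbabilityMeasure μ] (hS : AreIndepSimpleRandomWalks μ S)
    (Λ : Finset (Fin d → ℤ))
    (P Q : Finset (Fin d → ℤ) → Prop) {m : ℕ} (hm : m < k) {p : ℝ} (hp0 : 0 ≤ p)
    (hp : ∀ A ⊆ Λ, P A →
      μ.real {ω | ¬ Q (A.filter (· ∈ Set.range fun n => S ⟨m, hm⟩ n ω))} ≤ p) :
    μ.real {ω | P (visitedBy Λ S m ω) ∧ ¬ Q (visitedBy Λ S (m + 1) ω)} ≤ p := by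
  have hsub : {ω | P (visitedBy Λ S m ω) ∧ ¬ Q (visitedBy Λ S (m + 1) ω)} ⊆
      ⋃ A ∈ Λ.powerset.filter P, ({ω | visitedBy Λ S m ω = A} ∩
        {ω | ¬ Q (A.filter (· ∈ Set.range fun n => S ⟨m, hm⟩ n ω))}) := by
    rintro ω ⟨h1, h2⟩
    rw [visitedBy_succ Λ S hm] at h2
    simp only [Set.mem_iUnion]
    exact ⟨visitedBy Λ S m ω, by simp [h1, visitedBy_subset], rfl, h2⟩
  refine (measureReal_mono hsub (measure_ne_top μ _)).trans
    ((measureReal_biUnion_finset_le _ _).trans ?_)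
  calc ∑ A ∈ Λ.powerset.filter P, μ.real ({ω | visitedBy Λ S m ω = A} ∩
        {ω | ¬ Q (A.filter (· ∈ Set.range fun n => S ⟨m, hm⟩ n ω))})
      ≤ ∑ A ∈ Λ.powerset.filter P, μ.real {ω | visitedBy Λ S m ω = A} * p := by
        refine Finset.sum_le_sum fun A hA => ?_
        have hA := Finset.mem_filter.1 hA
        rw [hS.real_inter_visitedBy Λ A (Finset.mem_powerset.1 hA.1) (fun B => ¬ Q B) hm]
        exact mul_le_mul_of_nonneg_left (hp A (Finset.mem_powerset.1 hA.1) hA.2)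
          measureReal_nonneg
    _ = μ.real (⋃ A ∈ Λ.powerset.filter P, {ω | visitedBy Λ S m ω = A}) * p := by
        rw [← Finset.sum_mul, measureReal_biUnion_finset]
        · intro A _ B _ hAB
          exact Set.disjoint_left.2 fun ω hA hB => hAB
            ((show visitedBy Λ S m ω = A from hA).symm.trans hB)
        · exact fun A _ => hS.measurableSet_visitedBy_eq Λ A m
    _ ≤ p := mul_le_of_le_one_left hp0 measureReal_le_one

/-- The intersections of the ranges satisfy the growth bounds with high probability. -/
theorem real_not_hasGrowth_visitedBy_le [IsProbabilityMeasure μ]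
    (hS : AreIndepSimpleRandomWalks μ S) (hd : 0 < d) {φ : (Fin d → ℤ) → ℝ} (hφ : IsGreenBound φ)
    {C : ℝ} (hC : 0 < C) (hφC : ∀ x, φ x ≤ C * decay x) {v : ℝ} (hv : 0 < v) (J : ℕ) {m : ℕ}
    (hm : m ≤ k) :
    μ.real {ω | ¬ HasGrowth (visitedBy (latticeBall d (2 ^ J)) S m ω)
      (growthSeq d (2 * C * 4 ^ (d - 2) * v) m)} ≤
      m * ((latticeBall d (2 ^ J)).card * ((J + 2) * (2 * Real.exp (-v)))) := by
  classical
  set Λ := latticeBall d (2 ^ J) with hΛ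
  set f := growthSeq d (2 * C * 4 ^ (d - 2) * v) with hf
  induction m with
  | zero =>
    have : {ω | ¬ HasGrowth (visitedBy Λ S 0 ω) (f 0)} = ∅ := by
      ext ω
      have : HasGrowth (visitedBy Λ S 0 ω) (f 0) := fun z _ j => by
        simp only [hf, growthSeq]; exact card_ballPart_le _ z j
      simp [this]
    rw [this]; simp
  | succ m ih =>
    have hsub : {ω | ¬ HasGrowth (visitedBy Λ S (m + 1) ω) (f (m + 1))} ⊆
        {ω | ¬ HasGrowth (visitedBy Λ S m ω) (f m)} ∪
        {ω | HasGrowth (visitedBy Λ S m ω) (f m) ∧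
          ¬ HasGrowth (visitedBy Λ S (m + 1) ω) (f (m + 1))} := by
      intro ω hω
      by_cases h : HasGrowth (visitedBy Λ S m ω) (f m)
      · exact Or.inr ⟨h, hω⟩
      · exact Or.inl h
    have h2 : μ.real {ω | HasGrowth (visitedBy Λ S m ω) (f m) ∧
          ¬ HasGrowth (visitedBy Λ S (m + 1) ω) (f (m + 1))} ≤
        Λ.card * ((J + 2) * (2 * Real.exp (-v))) := by
      refine hS.real_visitedBy_step_le Λ (fun A => HasGrowth A (f m))
        (fun A => HasGrowth A (f (m + 1))) (by omega) (by positivity) fun A hA hAf => ?_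
      refine ((hS.walk _).real_not_hasGrowth_le hd hφ hC hφC hv hA hAf).trans ?_
      gcongr
    calc _ ≤ _ := measureReal_mono hsub (measure_ne_top μ _)
      _ ≤ _ := measureReal_union_le _ _
      _ ≤ _ := add_le_add (ih (by omega)) h2
      _ = _ := by push_cast; ring

end AreIndepSimpleRandomWalks

end Intersections

/-! ### Walks with a prescribed initial piece -/

theorem slice_add {X : Type*} (g : ℕ → X) (m a b : ℕ) :
    slice g m (a + b) = slice g m a ++ slice g (m + a) b := by
  induction a generalizing m with
  | zero => simp [slice]
  | succ a ih => rw [Nat.add_right_comm]; simp [slice, ih, add_assoc, add_comm 1]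

theorem length_slice {X : Type*} (g : ℕ → X) (m N : ℕ) : (slice g m N).length = N := by
  induction N generalizing m with
  | zero => rfl
  | succ N ih => simp [slice, ih]

section Prefix

variable {d : ℕ}

theorem pathRange_append (x : Fin d → ℤ) (l l' : List (Fin d → ℤ)) :
    pathRange x (l ++ l') = pathRange x l ∪ pathRange (x + l.sum) l' := by
  induction l generalizing x with
  | nil =>
    simp only [List.nil_append, List.sum_nil, add_zero, pathRange]
    refine (Finset.union_eq_right.2 ?_).symm
    cases l' <;> simp [pathRange]
  | cons e l ih =>
    simp only [List.cons_append, pathRange, ih, List.sum_cons, Finset.insert_union, add_assoc]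

theorem pathMean_succ_unitStep (N : ℕ) (f : List (Fin d → ℤ) → ℝ) :
    pathMean (N + 1) f =
      (∑ p : Fin d × Bool, pathMean N fun l => f (unitStep p :: l)) / (2 * d) := by
  simp [pathMean, Fintype.sum_prod_type, unitStep]

theorem pathMean_prefix (l₀ : List (Fin d × Bool)) (N : ℕ) (Q : Set (List (Fin d → ℤ))) :
    pathMean (l₀.length + N) ({l | ∃ l' ∈ Q, l = l₀.map unitStep ++ l'}.indicator 1) =
      (1 / (2 * d)) ^ l₀.length * pathMean N (Q.indicator 1) := by
  induction l₀ with
  | nil => simp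
  | cons p₀ l₀ ih =>
    rw [List.length_cons, Nat.add_right_comm, pathMean_succ_unitStep, Finset.sum_eq_single p₀]
    · have e : (fun l => ({l | ∃ l' ∈ Q, l = (p₀ :: l₀).map unitStep ++ l'}.indicator 1
          (unitStep p₀ :: l) : ℝ)) = {l | ∃ l' ∈ Q, l = l₀.map unitStep ++ l'}.indicator 1 := by
        funext l
        classical
        rw [Set.indicator_apply, Set.indicator_apply]
        exact if_congr (by simp) rfl rfl
      rw [e, ih]; ring
    · intro p _ hp
      have e : (fun l => ({l | ∃ l' ∈ Q, l = (p₀ :: l₀).map unitStep ++ l'}.indicator 1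
          (unitStep p :: l) : ℝ)) = fun _ => 0 := by
        funext l; simp [unitStep_injective.eq_iff, hp]
      rw [e, pathMean_zero_fun]
    · simp

end Prefix

namespace IsSimpleRandomWalk

variable {Ω : Type*} [MeasurableSpace Ω] {μ : Measure Ω} {d : ℕ} {S : ℕ → Ω → (Fin d → ℤ)}

theorem real_prefix_eq [IsProbabilityMeasure μ] (hS : IsSimpleRandomWalk μ S)
    (l₀ : List (Fin d × Bool)) :
    μ.real {ω | slice (fun n => S (n + 1) ω - S n ω) 0 l₀.length = l₀.map unitStep} =
      (1 / (2 * d)) ^ l₀.length := by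
  have h := hS.real_slice_eq 0 l₀.length {l | ∃ l' ∈ Set.univ, l = l₀.map unitStep ++ l'}
  have h2 := pathMean_prefix l₀ 0 (d := d) Set.univ
  rw [add_zero] at h2
  rw [h2] at h
  have e : {ω | slice (fun n => S (n + 1) ω - S n ω) 0 l₀.length = l₀.map unitStep} =
      {ω | slice (fun n => S (n + 1) ω - S n ω) 0 l₀.length ∈
        {l | ∃ l' ∈ Set.univ, l = l₀.map unitStep ++ l'}} := by
    ext ω
    simp only [Set.mem_ofPred_eq, Set.mem_univ, true_and]
    refine ⟨fun h => ⟨[], by simpa using h⟩, fun ⟨l', h⟩ => ?_⟩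
    have hl := congrArg List.length h
    rw [length_slice] at hl
    have : l' = [] := by simpa using hl
    simpa [this] using h
  rw [e, h]
  simp [pathMean]

/-- Markov property at the end of the prescribed piece: x lies on that piece, or is hit by a fresh
walk from its endpoint. With the empty piece and x ≠ 0 this is the ordinary hitting bound. -/
theorem real_prefix_mem_range_le [IsProbabilityMeasure μ] (hS : IsSimpleRandomWalk μ S)
    {φ : (Fin d → ℤ) → ℝ} (hφ : IsGreenBound φ) (l₀ : List (Fin d × Bool))
    (x : Fin d → ℤ) :
    μ.real {ω | slice (fun n => S (n + 1) ω - S n ω) 0 l₀.length = l₀.map unitStep ∧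
      x ∈ Set.range fun n => S n ω} ≤
      (1 / (2 * d)) ^ l₀.length * ((if x ∈ pathRange 0 (l₀.map unitStep) then 1 else 0) +
        φ ((l₀.map unitStep).sum - x)) := by
  have hpow : (0 : ℝ) ≤ (1 / (2 * d)) ^ l₀.length := by positivity
  split_ifs with hx
  · refine (measureReal_mono (fun ω h => h.1) (measure_ne_top μ _)).trans
      ((hS.real_prefix_eq l₀).le.trans ?_)
    exact le_mul_of_one_le_right hpow (by linarith [hφ.pos ((l₀.map unitStep).sum - x)])
  set s : ℕ → Set Ω := fun N => {ω | slice (fun n => S (n + 1) ω - S n ω) 0 (l₀.length + N) ∈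
    {l | ∃ l' ∈ {l' | x ∈ pathRange (l₀.map unitStep).sum l'}, l = l₀.map unitStep ++ l'}} with hs
  have key : ∀ N ω, ω ∈ s N ↔
      slice (fun n => S (n + 1) ω - S n ω) 0 l₀.length = l₀.map unitStep ∧
        ∃ j ≤ l₀.length + N, S j ω = x := by
    intro N ω
    have e : ω ∈ s N ↔ ∃ l', x ∈ pathRange (l₀.map unitStep).sum l' ∧
        slice (fun n => S (n + 1) ω - S n ω) 0 (l₀.length + N) = l₀.map unitStep ++ l' := Iff.rfl
    rw [e, ← hS.mem_pathRange_slice]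
    constructor
    · rintro ⟨l', h1, h2⟩
      refine ⟨?_, ?_⟩
      · rw [slice_add] at h2
        exact (List.append_inj h2 (by simp [length_slice])).1
      · rw [h2, pathRange_append, zero_add]
        exact Finset.mem_union_right _ h1
    · rintro ⟨h1, h2⟩
      refine ⟨slice (fun n => S (n + 1) ω - S n ω) (0 + l₀.length) N, ?_, ?_⟩
      · rw [slice_add, h1, pathRange_append, zero_add, Finset.mem_union] at h2
        exact h2.resolve_left hx
      · rw [slice_add, h1]
  have hmono : Monotone s := by
    intro N N' hN ω hω
    obtain ⟨h1, j, hj, h⟩ := (key N ω).1 hω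
    exact (key N' ω).2 ⟨h1, j, by omega, h⟩
  have hsub : {ω | slice (fun n => S (n + 1) ω - S n ω) 0 l₀.length = l₀.map unitStep ∧
      x ∈ Set.range fun n => S n ω} ⊆ ⋃ N, s N := by
    rintro ω ⟨h1, n, hn⟩
    exact Set.mem_iUnion.2 ⟨n, (key n ω).2 ⟨h1, n, by omega, hn⟩⟩
  refine (measureReal_mono hsub (measure_ne_top μ _)).trans ?_
  have ht := (ENNReal.tendsto_toReal (measure_ne_top μ _)).comp
    (tendsto_measure_iUnion_atTop (μ := μ) hmono)
  refine le_of_tendsto ht (Filter.Eventually.of_forall fun N => ?_)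
  have := hS.real_slice_eq 0 (l₀.length + N)
    {l | ∃ l' ∈ {l' | x ∈ pathRange (l₀.map unitStep).sum l'}, l = l₀.map unitStep ++ l'}
  rw [pathMean_prefix] at this
  refine this.le.trans (mul_le_mul_of_nonneg_left ?_ hpow)
  rw [zero_add]
  exact hφ.prob_mem_le N _ x

end IsSimpleRandomWalk

/-- One factorisation for several uses: taking U to be everything leaves only the initial pieces,
taking trivial pieces leaves only the hitting of U. -/
theorem AreIndepSimpleRandomWalks.real_iInter_prefix {Ω : Type*} [MeasurableSpace Ω]
    {μ : Measure Ω} {d k : ℕ} {S : Fin k → ℕ → Ω → (Fin d → ℤ)}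
    (hS : AreIndepSimpleRandomWalks μ S) (N : Fin k → ℕ) (Q : Fin k → Set (List (Fin d → ℤ)))
    (U : Set (Fin d → ℤ)) :
    μ.real {ω | ∀ i, slice (fun n => S i (n + 1) ω - S i n ω) 0 (N i) ∈ Q i ∧
      ∃ n, S i n ω ∈ U} =
    ∏ i, μ.real {ω | slice (fun n => S i (n + 1) ω - S i n ω) 0 (N i) ∈ Q i ∧
      ∃ n, S i n ω ∈ U} := by
  have hm : ∀ i ∈ (Finset.univ : Finset (Fin k)), MeasurableSet {τ : ℕ → Fin d → ℤ |
      slice (fun n => τ (n + 1) - τ n) 0 (N i) ∈ Q i ∧ ∃ n, τ n ∈ U} := by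
    intro i _
    refine (measurableSet_slice (S := fun n (τ : ℕ → Fin d → ℤ) => τ n)
      (fun n => measurable_pi_apply n) 0 (N i) (Q i)).inter ?_
    have : {τ : ℕ → Fin d → ℤ | ∃ n, τ n ∈ U} = ⋃ n, (fun τ => τ n) ⁻¹' U := by ext; simp
    rw [Set.ofPred] at this
    exact this ▸ MeasurableSet.iUnion fun n => measurable_pi_apply n MeasurableSet.of_discrete
  have h := hS.indep.measure_inter_preimage_eq_mul Finset.univ hm
  simp only [measureReal_def, ← ENNReal.toReal_prod]
  refine congrArg _ (Eq.trans (congrArg _ ?_) h)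
  ext ω; simp

/-! ### Common points far from the origin -/

/-- A summable profile on the lattice. -/
theorem summable_one_add_norm_rpow {d : ℕ} (hd : 0 < d) :
    Summable fun x : Fin d → ℤ => (1 + ‖x‖) ^ (-((d : ℝ) + 1 / 2)) := by
  have hd' : (0 : ℝ) < d := by exact_mod_cast hd
  set s : ℝ := 1 + 1 / (2 * d) with hs
  have hs1 : 1 < s := by rw [hs]; have : 0 < 1 / (2 * (d : ℝ)) := by positivity
                         linarith
  have hnat : Summable fun n : ℕ => (1 + (n : ℝ)) ^ (-s) := by
    have := (summable_nat_add_iff 1).2 (Real.summable_nat_rpow.2 (by linarith : -s < -1))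
    refine this.congr fun n => ?_
    push_cast; rw [add_comm]
  have hint : Summable fun n : ℤ => (1 + |(n : ℝ)|) ^ (-s) := by
    refine Summable.of_nat_of_neg ?_ ?_
    · simpa using hnat
    · simpa using hnat
  refine summable_of_sum_le (c := (∑' n : ℤ, (1 + |(n : ℝ)|) ^ (-s)) ^ d)
    (fun x => Real.rpow_nonneg (by positivity) _) fun u => ?_
  have hle : ∀ x : Fin d → ℤ, (1 + ‖x‖) ^ (-((d : ℝ) + 1 / 2)) ≤
      ∏ i, (1 + |(x i : ℝ)|) ^ (-s) := by
    intro x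
    have h1 : ∀ i ∈ (Finset.univ : Finset (Fin d)), (1 + ‖x‖) ^ (-s) ≤ (1 + |(x i : ℝ)|) ^ (-s) := by
      intro i _
      refine Real.rpow_le_rpow_of_nonpos (by positivity) ?_ (by linarith)
      have := norm_le_pi_norm x i
      rw [Int.norm_eq_abs] at this
      linarith
    have h2 := Finset.prod_le_prod (fun i _ => Real.rpow_nonneg (by positivity) _) h1
    refine le_trans (le_of_eq ?_) h2
    rw [Finset.prod_const, Finset.card_univ, Fintype.card_fin, ← Real.rpow_natCast,
      ← Real.rpow_mul (by positivity)]
    congr 1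
    rw [hs]; field_simp
  obtain ⟨r, hr⟩ : ∃ r : ℕ, u ⊆ latticeBall d r := by
    obtain ⟨r, hr⟩ := exists_nat_ge (∑ x ∈ u, ‖x‖)
    refine ⟨r, fun x hx => mem_latticeBall.2 (le_trans ?_ hr)⟩
    exact Finset.single_le_sum (f := fun x => ‖x‖) (fun x _ => norm_nonneg x) hx
  calc ∑ x ∈ u, (1 + ‖x‖) ^ (-((d : ℝ) + 1 / 2))
      ≤ ∑ x ∈ latticeBall d r, ∏ i, (1 + |(x i : ℝ)|) ^ (-s) :=
        (Finset.sum_le_sum fun x _ => hle x).trans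
          (Finset.sum_le_sum_of_subset_of_nonneg hr fun x _ _ => by positivity)
    _ = ∏ i : Fin d, ∑ n ∈ Finset.Icc (-(r : ℤ)) r, (1 + |(n : ℝ)|) ^ (-s) := by
        rw [latticeBall, Finset.prod_univ_sum]
    _ ≤ _ := by
        rw [Finset.prod_const, Finset.card_univ, Fintype.card_fin]
        refine pow_le_pow_left₀ (Finset.sum_nonneg fun n _ => by positivity) ?_ d
        exact hint.sum_le_tsum _ fun n _ => by positivity

/-- Of the exponent k (d - 2) ≥ d + 1, the part d + 1/2 is spent on summability over the lattice and
the remaining 1/2 on smallness at large distance. -/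
theorem decay_pow_le {d k : ℕ} (hk : d + 1 ≤ k * (d - 2)) (x : Fin d → ℤ) :
    decay x ^ k ≤ (1 + ‖x‖) ^ (-(1 / 2 : ℝ)) * (1 + ‖x‖) ^ (-((d : ℝ) + 1 / 2)) := by
  have h : 0 < 1 + ‖x‖ := by positivity
  rw [← Real.rpow_add h, decay, inv_pow, ← pow_mul, mul_comm (d - 2)]
  have e : -(1 / 2 : ℝ) + -((d : ℝ) + 1 / 2) = -((d + 1 : ℕ) : ℝ) := by push_cast; ring
  rw [e, Real.rpow_neg h.le, Real.rpow_natCast]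
  gcongr
  linarith [norm_nonneg x]

section Far

variable {Ω : Type*} [MeasurableSpace Ω] {μ : Measure Ω} {d k : ℕ}

/-- The union bound over lattice points. -/
theorem measureReal_iUnion_le_tsum [IsFiniteMeasure μ] {E : (Fin d → ℤ) → Set Ω}
    {a : (Fin d → ℤ) → ℝ} (ha : Summable a) (h : ∀ x, μ.real (E x) ≤ a x) :
    μ.real (⋃ x, E x) ≤ ∑' x, a x := by
  have ha0 : ∀ x, 0 ≤ a x := fun x => measureReal_nonneg.trans (h x)
  rw [measureReal_def]
  refine ENNReal.toReal_le_of_le_ofReal (tsum_nonneg ha0) ?_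
  rw [ENNReal.ofReal_tsum_of_nonneg ha0 ha]
  refine (measure_iUnion_le _).trans (ENNReal.tsum_le_tsum fun x => ?_)
  rw [← ENNReal.ofReal_toReal (measure_ne_top μ (E x))]
  exact ENNReal.ofReal_le_ofReal (h x)

/-- Common points of the ranges far from the origin are unlikely. -/
theorem AreIndepSimpleRandomWalks.real_exists_far_le (hd : 0 < d) (hk : d + 1 ≤ k * (d - 2))
    {φ : (Fin d → ℤ) → ℝ} (hφ : IsGreenBound φ) {C : ℝ} (hC : 0 < C)
    (hφC : ∀ x, φ x ≤ C * decay x) [IsProbabilityMeasure μ] {S : Fin k → ℕ → Ω → (Fin d → ℤ)}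
    (hS : AreIndepSimpleRandomWalks μ S) (r : ℕ) :
    μ.real {ω | ∃ x, x ∉ latticeBall d r ∧ ∀ i, x ∈ Set.range fun n => S i n ω} ≤
      C ^ k * (∑' x : Fin d → ℤ, (1 + ‖x‖) ^ (-((d : ℝ) + 1 / 2))) *
        (1 + (r : ℝ)) ^ (-(1 / 2 : ℝ)) := by
  have hsum := summable_one_add_norm_rpow hd
  have e : {ω | ∃ x, x ∉ latticeBall d r ∧ ∀ i, x ∈ Set.range fun n => S i n ω} =
      ⋃ x, {ω | x ∉ latticeBall d r ∧ ∀ i, x ∈ Set.range fun n => S i n ω} := by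
    ext ω; simp
  rw [e]
  refine (measureReal_iUnion_le_tsum (a := fun x => C ^ k * (1 + (r : ℝ)) ^ (-(1 / 2 : ℝ)) *
    (1 + ‖x‖) ^ (-((d : ℝ) + 1 / 2))) (hsum.mul_left _) fun x => ?_).trans (le_of_eq ?_)
  · by_cases hx : x ∈ latticeBall d r
    · simp only [hx, not_true_eq_false, false_and, Set.ofPred_false, measureReal_empty]
      positivity
    · have h1 := hS.real_iInter_prefix (fun _ => 0) (fun _ => Set.univ) {x}
      simp only [Set.mem_univ, true_and, Set.mem_singleton_iff] at h1
      simp only [hx, not_false_eq_true, true_and, Set.mem_range]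
      have hr : (r : ℝ) < ‖x‖ := by rwa [mem_latticeBall, not_le] at hx
      rw [h1]
      have h2 : ∀ i, μ.real {ω | ∃ n, S i n ω = x} ≤ C * decay x := by
        intro i
        have := (hS.walk i).real_prefix_mem_range_le hφ [] x
        have hx0 : x ≠ 0 := by rintro rfl; rw [norm_zero] at hr; linarith [r.cast_nonneg (α := ℝ)]
        simp [slice, pathRange, hx0] at this
        refine this.trans ((hφC _).trans (le_of_eq ?_))
        rw [decay, decay, norm_neg]
      calc ∏ i, μ.real {ω | ∃ n, S i n ω = x} ≤ ∏ i : Fin k, (C * decay x) :=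
            Finset.prod_le_prod (fun i _ => measureReal_nonneg) fun i _ => h2 i
        _ = C ^ k * decay x ^ k := by simp [mul_pow]
        _ ≤ C ^ k * ((1 + ‖x‖) ^ (-(1 / 2 : ℝ)) * (1 + ‖x‖) ^ (-((d : ℝ) + 1 / 2))) := by
            gcongr; exact decay_pow_le hk x
        _ ≤ C ^ k * ((1 + (r : ℝ)) ^ (-(1 / 2 : ℝ)) * (1 + ‖x‖) ^ (-((d : ℝ) + 1 / 2))) := by
            gcongr ?_ * (?_ * _)
            exact Real.rpow_le_rpow_of_nonpos (by positivity) (by linarith) (by norm_num)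
        _ = _ := by ring
  · rw [tsum_mul_left]; ring

end Far

/-! ### Solving the growth recursion -/

section Analytic

theorem sum_four_pow_le (n : ℕ) : ∑ j ∈ Finset.range (n + 1), (4 : ℝ) ^ j ≤ 2 * 4 ^ n := by
  induction n with
  | zero => norm_num
  | succ n ih => rw [Finset.sum_range_succ, pow_succ]; nlinarith [pow_pos (by norm_num : (0:ℝ) < 4) n]

theorem sum_two_pow_le (n : ℕ) : ∑ j ∈ Finset.range (n + 1), (2 : ℝ) ^ j ≤ 2 * 2 ^ n := by
  induction n with
  | zero => norm_num
  | succ n ih => rw [Finset.sum_range_succ, pow_succ]; nlinarith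

theorem sum_linear_mul_half_pow_le (N : ℕ) :
    ∑ i ∈ Finset.range N, ((i : ℝ) + 3) / 2 ^ i ≤ 8 := by
  have : ∑ i ∈ Finset.range N, ((i : ℝ) + 3) / 2 ^ i = 8 - (2 * N + 8) / 2 ^ N := by
    induction N with
    | zero => norm_num
    | succ N ih => rw [Finset.sum_range_succ, ih, pow_succ]; push_cast; field_simp; ring
  rw [this]
  have : 0 ≤ (2 * (N : ℝ) + 8) / 2 ^ N := by positivity
  linarith

theorem growthSeq_one_le {d : ℕ} (hd : 2 ≤ d) {D : ℝ} (hD : 0 < D) (i : ℕ) :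
    growthSeq d D 1 i ≤ 8 * 3 ^ d * D * 4 ^ i := by
  have h : ∀ j ∈ Finset.range (i + 1 + 1),
      min (growthSeq d D 0 j) (3 ^ d * (2 ^ j) ^ d) / (2 ^ j) ^ (d - 2) ≤ 3 ^ d * (4 : ℝ) ^ j := by
    intro j _
    rw [div_le_iff₀ (by positivity)]
    refine (min_le_right _ _).trans (le_of_eq ?_)
    have e : (4 : ℝ) ^ j = (2 ^ j) ^ 2 := by rw [← pow_mul, mul_comm, pow_mul]; norm_num
    rw [e, mul_assoc, ← pow_add]; congr 2; omega
  have h2 := Finset.sum_le_sum h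
  rw [← Finset.mul_sum] at h2
  calc growthSeq d D 1 i ≤ D * (3 ^ d * (2 * 4 ^ (i + 1))) := by
        rw [growthSeq]
        refine mul_le_mul_of_nonneg_left (h2.trans ?_) hD.le
        gcongr; exact sum_four_pow_le _
    _ = _ := by rw [pow_succ]; ring

theorem growthSeq_four_two_le {D : ℝ} (hD : 0 < D) (i : ℕ) :
    growthSeq 4 D 2 i ≤ 8 * 3 ^ 4 * D ^ 2 * (i + 2) := by
  have h : ∀ j ∈ Finset.range (i + 2),
      min (growthSeq 4 D 1 j) (3 ^ 4 * (2 ^ j) ^ 4) / (2 ^ j) ^ (4 - 2) ≤ 8 * 3 ^ 4 * D := by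
    intro j _
    rw [div_le_iff₀ (by positivity)]
    refine (min_le_left _ _).trans ((growthSeq_one_le (by norm_num) hD j).trans (le_of_eq ?_))
    have e : (4 : ℝ) ^ j = (2 ^ j) ^ 2 := by rw [← pow_mul, mul_comm, pow_mul]; norm_num
    rw [e]
  have h2 := Finset.sum_le_sum h
  rw [Finset.sum_const, Finset.card_range, nsmul_eq_mul] at h2
  calc growthSeq 4 D 2 i ≤ D * (((i + 2 : ℕ) : ℝ) * (8 * 3 ^ 4 * D)) := by
        rw [growthSeq]
        exact mul_le_mul_of_nonneg_left h2 hD.le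
    _ = _ := by push_cast; ring

theorem growthSeq_three_two_le {D : ℝ} (hD : 0 < D) (i : ℕ) :
    growthSeq 3 D 2 i ≤ 864 * D ^ 2 * 2 ^ i := by
  have h : ∀ j ∈ Finset.range (i + 1 + 1),
      min (growthSeq 3 D 1 j) (3 ^ 3 * (2 ^ j) ^ 3) / (2 ^ j) ^ (3 - 2) ≤ 216 * D * (2 : ℝ) ^ j := by
    intro j _
    rw [div_le_iff₀ (by positivity)]
    refine (min_le_left _ _).trans ((growthSeq_one_le (by norm_num) hD j).trans (le_of_eq ?_))
    have e : (4 : ℝ) ^ j = (2 ^ j) ^ 2 := by rw [← pow_mul, mul_comm, pow_mul]; norm_num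
    rw [e]; norm_num; ring
  have h2 := Finset.sum_le_sum h
  rw [← Finset.mul_sum] at h2
  calc growthSeq 3 D 2 i ≤ D * (216 * D * (2 * 2 ^ (i + 1))) := by
        rw [growthSeq]
        refine mul_le_mul_of_nonneg_left (h2.trans ?_) hD.le
        gcongr; exact sum_two_pow_le _
    _ = _ := by rw [pow_succ]; ring

theorem growthSeq_three_three_le {D : ℝ} (hD : 0 < D) (i : ℕ) :
    growthSeq 3 D 3 i ≤ 864 * D ^ 3 * (i + 2) := by
  have h : ∀ j ∈ Finset.range (i + 2),
      min (growthSeq 3 D 2 j) (3 ^ 3 * (2 ^ j) ^ 3) / (2 ^ j) ^ (3 - 2) ≤ 864 * D ^ 2 := by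
    intro j _
    rw [div_le_iff₀ (by positivity)]
    refine (min_le_left _ _).trans ((growthSeq_three_two_le hD j).trans (le_of_eq ?_))
    norm_num
  have h2 := Finset.sum_le_sum h
  rw [Finset.sum_const, Finset.card_range, nsmul_eq_mul] at h2
  calc growthSeq 3 D 3 i ≤ D * (((i + 2 : ℕ) : ℝ) * (864 * D ^ 2)) := by
        rw [growthSeq]
        exact mul_le_mul_of_nonneg_left h2 hD.le
    _ = _ := by push_cast; ring

/-- The last walk, at scale r = 2 ^ j₀. For j ≤ j₀ the volume bound contributes Σ 4 ^ j, of order r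
^ 2. For j > j₀ the hypothesis contributes r ^ a times a series in 2 ^ (j (b - (d - 2))), which is
geometric because b + 1 ≤ d - 2 and is dominated by its first term, again r ^ 2 because a + b = d.
The prefactor r ^ (d - 2) brings the total to r ^ d. The weight ε switches the factor linear in the
scale on or off. -/
theorem growthSeq_succ_le {d a b : ℕ} (hab : a + b = d) (hb : b + 1 ≤ d - 2) {D₀ K ε : ℝ}
    (hD₀ : 0 < D₀) (hK : 0 ≤ K) (hε : 0 ≤ ε) {m j₀ : ℕ}
    (h : ∀ j, growthSeq d (D₀ * (2 ^ j₀) ^ (d - 2)) m j ≤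
      K * (2 ^ j₀) ^ a * (2 ^ j) ^ b * (ε * j + 2)) (i : ℕ) :
    growthSeq d (D₀ * (2 ^ j₀) ^ (d - 2)) (m + 1) i ≤
      D₀ * (2 * 3 ^ d + 4 * K * (ε + 1)) * ((2 ^ j₀) ^ d * (ε * j₀ + 1)) := by
  set D := D₀ * ((2 : ℝ) ^ j₀) ^ (d - 2) with hD
  have hD0 : 0 < D := by positivity
  set T : ℕ → ℝ := fun j =>
    min (growthSeq d D m j) (3 ^ d * (2 ^ j) ^ d) / (2 ^ j) ^ (d - 2) with hT
  have hT0 : ∀ j, 0 ≤ T j := fun j => by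
    have := growthSeq_pos (d := d) hD0 m j
    simp only [hT]; positivity
  have h1 : ∀ j, T j ≤ 3 ^ d * (4 : ℝ) ^ j := by
    intro j
    simp only [hT]
    rw [div_le_iff₀ (by positivity)]
    refine (min_le_right _ _).trans (le_of_eq ?_)
    have e : (4 : ℝ) ^ j = (2 ^ j) ^ 2 := by rw [← pow_mul, mul_comm, pow_mul]; norm_num
    rw [e, mul_assoc, ← pow_add]; congr 2; omega
  have h2 : ∀ l : ℕ, T (j₀ + 1 + l) ≤
      K * 4 ^ j₀ * ((ε + 1) * (ε * j₀ + 1)) * (((l : ℝ) + 3) / 2 ^ l) / 2 := by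
    intro l
    simp only [hT]
    refine (div_le_div_of_nonneg_right ((min_le_left _ _).trans (h _)) (by positivity)).trans ?_
    -- The surplus e makes the natural-number subtraction disappear: d - 2 = b + 1 + e and a = 2 +
    -- (1 + e).
    obtain ⟨e, he⟩ : ∃ e, d - 2 = b + 1 + e := ⟨d - 2 - (b + 1), by omega⟩
    have ha : a = 2 + (1 + e) := by omega
    rw [he, ha]
    have e1 : K * (2 ^ j₀) ^ (2 + (1 + e)) * (2 ^ (j₀ + 1 + l)) ^ b *
        (ε * ((j₀ + 1 + l : ℕ) : ℝ) + 2) / (2 ^ (j₀ + 1 + l)) ^ (b + 1 + e) =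
        K * 4 ^ j₀ * (ε * ((j₀ + 1 + l : ℕ) : ℝ) + 2) * ((1 / 2 ^ (1 + l)) ^ (1 + e)) := by
      have e4 : (4 : ℝ) ^ j₀ = (2 ^ j₀) ^ 2 := by rw [← pow_mul, mul_comm, pow_mul]; norm_num
      rw [e4, one_div, inv_pow, add_assoc j₀, pow_add 2 j₀]
      field_simp
      ring
    rw [e1]
    have e2 : ((1 : ℝ) / 2 ^ (1 + l)) ^ (1 + e) ≤ 1 / 2 ^ (1 + l) :=
      pow_le_of_le_one (by positivity)
        (by rw [div_le_one (by positivity)]; exact one_le_pow₀ (by norm_num)) (by omega)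
    have e3 : ε * ((j₀ + 1 + l : ℕ) : ℝ) + 2 ≤ ((ε + 1) * (ε * j₀ + 1)) * ((l : ℝ) + 3) := by
      push_cast
      have p1 : 0 ≤ ε * (j₀ : ℝ) := by positivity
      have p2 : 0 ≤ ε * (ε * (j₀ : ℝ)) := by positivity
      have p3 : (0 : ℝ) ≤ l := by positivity
      have p4 := mul_nonneg p1 p3
      have p5 := mul_nonneg p2 p3
      have p6 := mul_nonneg hε p3
      nlinarith
    calc K * 4 ^ j₀ * (ε * ((j₀ + 1 + l : ℕ) : ℝ) + 2) * ((1 / 2 ^ (1 + l)) ^ (1 + e))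
        ≤ K * 4 ^ j₀ * (((ε + 1) * (ε * j₀ + 1)) * ((l : ℝ) + 3)) * (1 / 2 ^ (1 + l)) := by
          gcongr
      _ = _ := by rw [pow_add]; field_simp
  have h3 : ∑ j ∈ Finset.range (i + 2), T j ≤
      ∑ j ∈ Finset.range (j₀ + 1), T j + ∑ l ∈ Finset.range (i + 2), T (j₀ + 1 + l) := by
    rw [← Finset.sum_range_add]
    exact Finset.sum_le_sum_of_subset_of_nonneg (Finset.range_mono (by omega)) fun j _ _ => hT0 j
  have h4 : ∑ j ∈ Finset.range (j₀ + 1), T j ≤ 3 ^ d * (2 * 4 ^ j₀) := by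
    refine (Finset.sum_le_sum fun j _ => h1 j).trans ?_
    rw [← Finset.mul_sum]
    gcongr; exact sum_four_pow_le _
  have h5 : ∑ l ∈ Finset.range (i + 2), T (j₀ + 1 + l) ≤
      K * 4 ^ j₀ * ((ε + 1) * (ε * j₀ + 1)) * 8 / 2 := by
    refine (Finset.sum_le_sum fun l _ => h2 l).trans ?_
    rw [← Finset.sum_div, ← Finset.mul_sum]
    gcongr; exact sum_linear_mul_half_pow_le _
  have e0 : growthSeq d D (m + 1) i = D * ∑ j ∈ Finset.range (i + 2), T j := rfl
  rw [e0]
  have h6 : ∑ j ∈ Finset.range (i + 2), T j ≤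
      (2 * 3 ^ d + 4 * K * (ε + 1)) * (4 ^ j₀ * (ε * j₀ + 1)) := by
    have p1 : 0 ≤ ε * (j₀ : ℝ) := by positivity
    have p2 : 0 ≤ (3 : ℝ) ^ d * (4 ^ j₀) * (ε * j₀) := by positivity
    nlinarith
  refine (mul_le_mul_of_nonneg_left h6 hD0.le).trans (le_of_eq ?_)
  have e4 : (4 : ℝ) ^ j₀ = (2 ^ j₀) ^ 2 := by rw [← pow_mul, mul_comm, pow_mul]; norm_num
  have e5 : ((2 : ℝ) ^ j₀) ^ d = (2 ^ j₀) ^ (d - 2) * (2 ^ j₀) ^ 2 := by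
    rw [← pow_add]; congr 1; omega
  rw [hD, e4, e5]; ring

end Analytic

/-! ### Upper tail along a geometric sequence of levels -/

/-- The critical number of walks: with this many walks the intersection of the ranges is finite. -/
def critWalks (d : ℕ) : ℕ := if d = 3 then 4 else if d = 4 then 3 else 2

/-- The weight of the logarithmic correction. -/
noncomputable def logWeight (d : ℕ) : ℝ := if d ≤ 4 then 1 else 0

theorem logWeight_nonneg (d : ℕ) : 0 ≤ logWeight d := by unfold logWeight; split_ifs <;> norm_num

theorem critWalks_spec {d : ℕ} (hd : 3 ≤ d) : d + 1 ≤ critWalks d * (d - 2) := by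
  unfold critWalks; split_ifs <;> omega

/-- Before the last walk the bound is of the form r ^ a 2 ^ (jb) with (a, b) equal to (3, 0), (4, 0)
or (d - 2, 2) for d = 3, d = 4 and d ≥ 5. In the first two cases it also carries the factor j + 2,
which becomes the logarithm of r. -/
theorem exists_growthSeq_critWalks_le {d : ℕ} (hd : 3 ≤ d) {D₀ : ℝ} (hD₀ : 0 < D₀) :
    ∃ K : ℝ, 0 < K ∧ ∀ j₀ i : ℕ, growthSeq d (D₀ * (2 ^ j₀) ^ (d - 2)) (critWalks d) i ≤
      K * ((2 ^ j₀) ^ d * (logWeight d * j₀ + 1)) := by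
  have main : ∀ (a b m : ℕ) (K : ℝ), critWalks d = m + 1 → a + b = d → b + 1 ≤ d - 2 → 0 ≤ K →
      (∀ j₀ j, growthSeq d (D₀ * (2 ^ j₀) ^ (d - 2)) m j ≤
        K * (2 ^ j₀) ^ a * (2 ^ j) ^ b * (logWeight d * j + 2)) →
      ∃ K : ℝ, 0 < K ∧ ∀ j₀ i : ℕ, growthSeq d (D₀ * (2 ^ j₀) ^ (d - 2)) (critWalks d) i ≤
        K * ((2 ^ j₀) ^ d * (logWeight d * j₀ + 1)) := by
    intro a b m K hm hab hb hK h
    have := logWeight_nonneg d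
    refine ⟨D₀ * (2 * 3 ^ d + 4 * K * (logWeight d + 1)), by positivity, fun j₀ i => ?_⟩
    rw [hm]
    exact growthSeq_succ_le hab hb hD₀ hK this (h j₀) i
  have hDpos : ∀ j₀ : ℕ, 0 < D₀ * ((2 : ℝ) ^ j₀) ^ (d - 2) := fun j₀ => by positivity
  rcases (by omega : d = 3 ∨ d = 4 ∨ 5 ≤ d) with rfl | rfl | h5
  · refine main 3 0 3 (864 * D₀ ^ 3) (by simp [critWalks]) (by norm_num) (by norm_num)
      (by positivity) fun j₀ j => ?_
    refine (growthSeq_three_three_le (hDpos j₀) j).trans (le_of_eq ?_)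
    simp only [logWeight]; norm_num; left; ring
  · refine main 4 0 2 (8 * 3 ^ 4 * D₀ ^ 2) (by simp [critWalks]) (by norm_num) (by norm_num)
      (by positivity) fun j₀ j => ?_
    refine (growthSeq_four_two_le (hDpos j₀) j).trans (le_of_eq ?_)
    simp only [logWeight]; norm_num; left; ring
  · refine main (d - 2) 2 1 (8 * 3 ^ d * D₀)
      (by unfold critWalks; rw [if_neg (by omega), if_neg (by omega)]) (by omega) (by omega)
      (by positivity) fun j₀ j => ?_
    refine (growthSeq_one_le (by omega) (hDpos j₀) j).trans ?_
    have e : (4 : ℝ) ^ j = (2 ^ j) ^ 2 := by rw [← pow_mul, mul_comm, pow_mul]; norm_num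
    rw [logWeight, if_neg (by omega), e]
    have : 0 ≤ 8 * 3 ^ d * D₀ * ((2 : ℝ) ^ j₀) ^ (d - 2) * (2 ^ j) ^ 2 := by positivity
    linarith

/-- A box of radius 2 ^ J lies in the ball of radius 2 ^ (J + 1) around any of its points, so the
growth bound at scale J + 1 bounds the total number of common points in the box. -/
theorem rangesIntersectionGT_subset {Ω : Type*} {d k : ℕ} (S : Fin k → ℕ → Ω → (Fin d → ℤ)) {t B : ℝ}
    (hB : B ≤ t) (J : ℕ) (f : ℕ → ℝ) (hf0 : ∀ j, 0 ≤ f j) (hf : f (J + 1) ≤ B) :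
    rangesIntersectionGT S t ⊆
      {ω | ¬ HasGrowth (visitedBy (latticeBall d (2 ^ J)) S k ω) f} ∪
      {ω | ∃ x, x ∉ latticeBall d (2 ^ J) ∧ ∀ i, x ∈ Set.range fun n => S i n ω} := by
  intro ω hω
  by_contra hc
  simp only [Set.mem_union, Set.mem_ofPred_eq, not_or, not_not, not_exists, not_and] at hc
  obtain ⟨h1, h2⟩ := hc
  set V := visitedBy (latticeBall d (2 ^ J)) S k ω with hV
  have hsub : (⋂ i, Set.range fun n => S i n ω) ⊆ (V : Set (Fin d → ℤ)) := by
    intro x hx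
    have hx' : ∀ i, x ∈ Set.range fun n => S i n ω := Set.mem_iInter.1 hx
    have hxΛ : x ∈ latticeBall d (2 ^ J) := by
      by_contra hn; exact h2 x hn hx'
    simp only [hV, visitedBy, Finset.coe_filter, Set.mem_ofPred_eq]
    exact ⟨hxΛ, fun i _ => hx' i⟩
  have hcard : (V.card : ℝ) ≤ B := by
    rcases V.eq_empty_or_nonempty with h0 | ⟨z, hz⟩
    · rw [h0]; simp only [Finset.card_empty, Nat.cast_zero]; exact (hf0 _).trans hf
    · refine le_trans ?_ ((h1 z hz (J + 1)).trans hf)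
      norm_cast
      refine Finset.card_le_card fun y hy => mem_ballPart.2 ⟨hy, ?_⟩
      have e1 := mem_latticeBall.1 (visitedBy_subset _ _ _ _ hz)
      have e2 := mem_latticeBall.1 (visitedBy_subset _ _ _ _ hy)
      have := norm_sub_le y z
      push_cast [pow_succ] at e1 e2 ⊢; linarith
  have h3 : ((⋂ i, Set.range fun n => S i n ω).encard : ENNReal) ≤ (V.card : ENNReal) := by
    have := Set.encard_le_encard hsub
    rw [Set.encard_coe_eq_coe_finsetCard] at this
    exact_mod_cast this
  have h4 : ENNReal.ofReal t < (V.card : ENNReal) := lt_of_lt_of_le hω h3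
  rw [← ENNReal.ofReal_natCast, ENNReal.ofReal_lt_ofReal_iff_of_nonneg
    ((Nat.cast_nonneg _).trans (hcard.trans hB))] at h4
  linarith

/-- The upper tail of the number of common points along a geometric sequence of levels. -/
theorem exists_upper_tail {d : ℕ} (hd : 3 ≤ d) : ∃ K C c : ℝ, 0 < K ∧ 0 < C ∧ 0 < c ∧
    ∀ (Ω : Type*) [MeasurableSpace Ω] (μ : Measure Ω) [IsProbabilityMeasure μ]
      (S : Fin (critWalks d) → ℕ → Ω → (Fin d → ℤ)), AreIndepSimpleRandomWalks μ S →
      ∀ (j₀ : ℕ) (t : ℝ), K * ((2 ^ j₀) ^ d * (logWeight d * j₀ + 1)) ≤ t →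
        μ.real (rangesIntersectionGT S t) ≤ C * Real.exp (-c * (2 ^ j₀) ^ (d - 2)) := by
  obtain ⟨φ, C, hC, hpos, hφC, hsuper⟩ := exists_superharmonic hd
  have hφ : IsGreenBound φ := ⟨hpos, hsuper⟩
  -- The union bound costs about (2 ^ n) ^ d for the centres and at most 3 * 2 ^ n for the scales;
  -- exp (-lam * n) ≤ (2 ^ n) ^ (-(d + 2)) leaves a factor 2 ^ (-n).
  set lam : ℝ := d + 2 with hlam
  have hlam0 : 0 < lam := by positivity
  obtain ⟨K, hK, hgrow⟩ := exists_growthSeq_critWalks_le hd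
    (D₀ := 2 * C * 4 ^ (d - 2) * lam) (by positivity)
  set k := critWalks d with hk
  set T : ℝ := ∑' x : Fin d → ℤ, (1 + ‖x‖) ^ (-((d : ℝ) + 1 / 2)) with hT
  have hT0 : 0 ≤ T := tsum_nonneg fun x => Real.rpow_nonneg (by positivity) _
  refine ⟨K, k * (3 ^ d * 6) + C ^ k * T + 1, Real.log 2 / 2, hK, by positivity,
    by have := Real.log_pos (by norm_num : (1 : ℝ) < 2); positivity, ?_⟩
  intro Ω _ μ _ S hS j₀ t ht
  -- With r = 2 ^ j₀ the box has radius 2 ^ n with n = r ^ (d - 2): the chance (2 ^ n) ^ (-1/2) of a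
  -- common point outside it is itself exponentially small in r ^ (d - 2).
  set n : ℕ := (2 ^ j₀) ^ (d - 2) with hn
  have hnR : (n : ℝ) = (2 ^ j₀) ^ (d - 2) := by push_cast [hn]; rfl
  have hn1 : 1 ≤ n := Nat.one_le_pow _ _ (by positivity)
  have hv : 0 < lam * n := by positivity
  have h1 := hS.real_not_hasGrowth_visitedBy_le (by omega) hφ hC hφC hv n le_rfl
  have h2 := hS.real_exists_far_le (by omega) (critWalks_spec hd) hφ hC hφC (2 ^ n)
  have e : 2 * C * 4 ^ (d - 2) * (lam * n) = 2 * C * 4 ^ (d - 2) * lam * (2 ^ j₀) ^ (d - 2) := by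
    rw [hnR]; ring
  have hsub := rangesIntersectionGT_subset S ht n
    (growthSeq d (2 * C * 4 ^ (d - 2) * (lam * n)) k) (fun j => (growthSeq_pos (by positivity) _ _).le)
    (by rw [e]; exact hgrow j₀ (n + 1))
  refine (measureReal_mono hsub (measure_ne_top μ _)).trans ((measureReal_union_le _ _).trans
    ((add_le_add h1 h2).trans ?_))
  have hexp : Real.exp (-(Real.log 2 / 2) * (2 ^ j₀) ^ (d - 2)) = ((2 : ℝ) ^ n) ^ (-(1 / 2 : ℝ)) := by
    rw [← hnR, ← Real.rpow_natCast, ← Real.rpow_mul (by norm_num), Real.rpow_def_of_pos (by norm_num)]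
    congr 1; ring
  rw [hexp]
  have h2n : (1 : ℝ) ≤ 2 ^ n := one_le_pow₀ (by norm_num)
  have hb1 : (1 + ((2 ^ n : ℕ) : ℝ)) ^ (-(1 / 2 : ℝ)) ≤ ((2 : ℝ) ^ n) ^ (-(1 / 2 : ℝ)) :=
    Real.rpow_le_rpow_of_nonpos (by positivity) (by push_cast; linarith) (by norm_num)
  have hb2 : ((latticeBall d (2 ^ n)).card : ℝ) * ((n + 2) * (2 * Real.exp (-(lam * n)))) ≤
      3 ^ d * 6 * ((2 : ℝ) ^ n) ^ (-(1 / 2 : ℝ)) := by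
    have c1 : ((latticeBall d (2 ^ n)).card : ℝ) ≤ 3 ^ d * ((2 : ℝ) ^ n) ^ d := by
      rw [card_latticeBall, ← mul_pow]; push_cast
      gcongr; linarith
    have c2 : (n : ℝ) + 2 ≤ 3 * 2 ^ n := by
      have : (n : ℝ) < 2 ^ n := by exact_mod_cast Nat.lt_two_pow_self
      linarith
    have c3 : Real.exp (-(lam * n)) ≤ (((2 : ℝ) ^ n) ^ (d + 2))⁻¹ := by
      rw [Real.exp_neg]
      refine inv_anti₀ (by positivity) ?_
      have : Real.exp (lam * n) = (Real.exp 1 ^ n) ^ (d + 2) := by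
        rw [← pow_mul, ← Real.exp_nat_mul, hlam]; congr 1; push_cast; ring
      rw [this]
      gcongr
      linarith [Real.exp_one_gt_d9]
    have c4 : (((2 : ℝ) ^ n))⁻¹ ≤ ((2 : ℝ) ^ n) ^ (-(1 / 2 : ℝ)) := by
      rw [← Real.rpow_neg_one]
      exact Real.rpow_le_rpow_of_exponent_le h2n (by norm_num)
    calc ((latticeBall d (2 ^ n)).card : ℝ) * ((n + 2) * (2 * Real.exp (-(lam * n))))
        ≤ 3 ^ d * ((2 : ℝ) ^ n) ^ d * ((3 * 2 ^ n) * (2 * (((2 : ℝ) ^ n) ^ (d + 2))⁻¹)) := by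
          gcongr
      _ = 3 ^ d * 6 * ((2 : ℝ) ^ n)⁻¹ := by
          rw [pow_add]; field_simp; ring
      _ ≤ _ := by gcongr
  have p : 0 ≤ ((2 : ℝ) ^ n) ^ (-(1 / 2 : ℝ)) := by positivity
  have q1 := mul_le_mul_of_nonneg_left hb2 (Nat.cast_nonneg (α := ℝ) k)
  have q2 := mul_le_mul_of_nonneg_left hb1 (by positivity : 0 ≤ C ^ k * T)
  have hk' : C ^ critWalks d * T = C ^ k * T := rfl
  nlinarith

/-! ### Positive probability of meeting only at the origin -/

section NoIntersection

variable {d : ℕ}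

theorem mem_pathRange_replicate {x y e : Fin d → ℤ} {m : ℕ}
    (h : x ∈ pathRange y (List.replicate m e)) : ∃ j : ℕ, x = y + (j : ℤ) • e := by
  induction m generalizing y with
  | zero => exact ⟨0, by simpa [pathRange] using h⟩
  | succ m ih =>
    rw [List.replicate_succ, pathRange, Finset.mem_insert] at h
    rcases h with rfl | h
    · exact ⟨0, by simp⟩
    · obtain ⟨j, hj⟩ := ih h
      exact ⟨j + 1, by rw [hj]; push_cast; rw [add_smul, one_smul]; abel⟩

theorem card_pathRange_le (x : Fin d → ℤ) (l : List (Fin d → ℤ)) :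
    (pathRange x l).card ≤ l.length + 1 := by
  induction l generalizing x with
  | nil => simp [pathRange]
  | cons e l ih =>
    simp only [pathRange, List.length_cons]
    exact (Finset.card_insert_le _ _).trans (Nat.add_le_add_right (ih _) 1)

/-- Here a and b are the endpoints of two bundles of p and q walks, and x is not much closer to b
than to a. From the factor at b a power 1/2 is kept as decay in m; the rest is traded for powers at
a, where together they exceed the summability exponent. -/
theorem decay_pow_mul_decay_pow_le {p q m : ℕ} (hq : 2 ≤ q * (d - 2))
    (hpq : d + 1 ≤ (p + q) * (d - 2)) {x a b : Fin d → ℤ} (hb : (m : ℝ) ≤ ‖x - b‖)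
    (hab : ‖x - a‖ ≤ 3 * ‖x - b‖) :
    decay (x - a) ^ p * decay (x - b) ^ q ≤
      3 ^ (q * (d - 2)) * ((1 + (m : ℝ)) ^ (-(1 / 2 : ℝ)) *
        (1 + ‖x - a‖) ^ (-((d : ℝ) + 1 / 2))) := by
  set u := 1 + ‖x - a‖ with hu
  set w := 1 + ‖x - b‖ with hw
  have hu1 : 1 ≤ u := by linarith [norm_nonneg (x - a)]
  have hw0 : 0 < w := by positivity
  have hwm : 1 + (m : ℝ) ≤ w := by linarith
  have huw : u / 3 ≤ w := by linarith
  have hq' : (2 : ℝ) ≤ (q * (d - 2) : ℕ) := by exact_mod_cast hq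
  have e1 : decay (x - a) ^ p = u ^ (-((p * (d - 2) : ℕ) : ℝ)) := by
    rw [decay, inv_pow, ← pow_mul, mul_comm (d - 2), Real.rpow_neg (by linarith), Real.rpow_natCast]
  have e2 : decay (x - b) ^ q = w ^ (-(1 / 2 : ℝ)) * w ^ (-(((q * (d - 2) : ℕ) : ℝ) - 1 / 2)) := by
    rw [← Real.rpow_add hw0, decay, inv_pow, ← pow_mul, mul_comm (d - 2)]
    have : -(1 / 2 : ℝ) + -(((q * (d - 2) : ℕ) : ℝ) - 1 / 2) = -((q * (d - 2) : ℕ) : ℝ) := by ring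
    rw [this, Real.rpow_neg hw0.le, Real.rpow_natCast]
  have b1 : w ^ (-(1 / 2 : ℝ)) ≤ (1 + (m : ℝ)) ^ (-(1 / 2 : ℝ)) :=
    Real.rpow_le_rpow_of_nonpos (by positivity) hwm (by norm_num)
  have b2 : w ^ (-(((q * (d - 2) : ℕ) : ℝ) - 1 / 2)) ≤
      3 ^ (q * (d - 2)) * u ^ (-(((q * (d - 2) : ℕ) : ℝ) - 1 / 2)) := by
    refine (Real.rpow_le_rpow_of_nonpos (by positivity) huw (by linarith)).trans ?_
    rw [div_eq_mul_inv, Real.mul_rpow (by linarith) (by norm_num), mul_comm]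
    refine mul_le_mul_of_nonneg_right ?_ (by positivity)
    rw [Real.inv_rpow (by norm_num), Real.rpow_neg (by norm_num), inv_inv, ← Real.rpow_natCast]
    exact Real.rpow_le_rpow_of_exponent_le (by norm_num) (by linarith)
  have b3 : u ^ (-((p * (d - 2) : ℕ) : ℝ)) * u ^ (-(((q * (d - 2) : ℕ) : ℝ) - 1 / 2)) ≤
      u ^ (-((d : ℝ) + 1 / 2)) := by
    rw [← Real.rpow_add (by linarith)]
    refine Real.rpow_le_rpow_of_exponent_le hu1 ?_
    have : ((d + 1 : ℕ) : ℝ) ≤ ((p * (d - 2) + q * (d - 2) : ℕ) : ℝ) := by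
      rw [← add_mul]; exact_mod_cast hpq
    push_cast at this ⊢
    linarith
  rw [e1, e2]
  calc u ^ (-((p * (d - 2) : ℕ) : ℝ)) *
        (w ^ (-(1 / 2 : ℝ)) * w ^ (-(((q * (d - 2) : ℕ) : ℝ) - 1 / 2)))
      ≤ u ^ (-((p * (d - 2) : ℕ) : ℝ)) * ((1 + (m : ℝ)) ^ (-(1 / 2 : ℝ)) *
          (3 ^ (q * (d - 2)) * u ^ (-(((q * (d - 2) : ℕ) : ℝ) - 1 / 2)))) := by
        gcongr
    _ = 3 ^ (q * (d - 2)) * ((1 + (m : ℝ)) ^ (-(1 / 2 : ℝ)) *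
          (u ^ (-((p * (d - 2) : ℕ) : ℝ)) * u ^ (-(((q * (d - 2) : ℕ) : ℝ) - 1 / 2)))) := by ring
    _ ≤ _ := by gcongr

/-- The indicator s that x lies on the straight piece is separated by (s + u) ^ p ≤ 2 ^ p (s + u ^
p). Its coefficient is of order m ^ (-2) because q (d - 2) ≥ 2, so it stays small after summation
over the m + 1 points of the piece. -/
theorem hit_product_le {p q m : ℕ} (hq : 2 ≤ q * (d - 2))
    (hpq : d + 1 ≤ (p + q) * (d - 2)) {x a b : Fin d → ℤ} (hb : (m : ℝ) ≤ ‖x - b‖)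
    (hab : ‖x - a‖ ≤ 3 * ‖x - b‖) {C s : ℝ} (hC : 0 < C) (hs : s = 0 ∨ s = 1) :
    (s + C * decay (x - a)) ^ p * (C * decay (x - b)) ^ q ≤
      2 ^ p * C ^ q * ((1 + (m : ℝ)) ^ 2)⁻¹ * s + 2 ^ p * C ^ (p + q) * 3 ^ (q * (d - 2)) *
        ((1 + (m : ℝ)) ^ (-(1 / 2 : ℝ)) * (1 + ‖x - a‖) ^ (-((d : ℝ) + 1 / 2))) := by
  have hκa := decay_pos (x - a)
  have hκb := decay_pos (x - b)
  have hs0 : 0 ≤ s := by rcases hs with rfl | rfl <;> norm_num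
  have hs1 : s ^ p ≤ s ∨ p = 0 := by
    rcases Nat.eq_zero_or_pos p with h | h
    · exact Or.inr h
    · left; rcases hs with rfl | rfl
      · simp [h.ne']
      · simp
  have h1 : (s + C * decay (x - a)) ^ p ≤ 2 ^ p * (s + (C * decay (x - a)) ^ p) := by
    rcases hs1 with hs1 | rfl
    · calc (s + C * decay (x - a)) ^ p ≤ (2 * max s (C * decay (x - a))) ^ p := by
            gcongr
            linarith [le_max_left s (C * decay (x - a)), le_max_right s (C * decay (x - a))]
        _ = 2 ^ p * (max s (C * decay (x - a))) ^ p := mul_pow _ _ _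
        _ ≤ 2 ^ p * (s + (C * decay (x - a)) ^ p) := by
            gcongr
            rcases max_choice s (C * decay (x - a)) with h | h <;> rw [h]
            · have : 0 ≤ (C * decay (x - a)) ^ p := by positivity
              linarith
            · linarith
    · simpa using hs0
  have h2 : decay (x - b) ^ q ≤ ((1 + (m : ℝ)) ^ 2)⁻¹ := by
    rw [decay, inv_pow, ← pow_mul, mul_comm]
    refine inv_anti₀ (by positivity) ?_
    calc (1 + (m : ℝ)) ^ 2 ≤ (1 + ‖x - b‖) ^ 2 := by gcongr
      _ ≤ _ := pow_le_pow_right₀ (by linarith [norm_nonneg (x - b)]) hq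
  have h3 := decay_pow_mul_decay_pow_le hq hpq hb hab
  calc (s + C * decay (x - a)) ^ p * (C * decay (x - b)) ^ q
      ≤ 2 ^ p * (s + (C * decay (x - a)) ^ p) * (C * decay (x - b)) ^ q := by gcongr
    _ = 2 ^ p * C ^ q * decay (x - b) ^ q * s +
        2 ^ p * C ^ (p + q) * (decay (x - a) ^ p * decay (x - b) ^ q) := by
        rw [mul_pow, mul_pow, pow_add]; ring
    _ ≤ 2 ^ p * C ^ q * ((1 + (m : ℝ)) ^ 2)⁻¹ * s + 2 ^ p * C ^ (p + q) *
        (3 ^ (q * (d - 2)) * ((1 + (m : ℝ)) ^ (-(1 / 2 : ℝ)) *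
          (1 + ‖x - a‖) ^ (-((d : ℝ) + 1 / 2)))) := by gcongr
    _ = _ := by ring

/-- The steps of a straight path of length `m` along the coordinate `i`. -/
def straightSteps (i : Fin d) (b : Bool) (m : ℕ) : List (Fin d × Bool) := List.replicate m (i, b)

/-- The signed unit associated with a direction. -/
def dirSign (b : Bool) : ℤ := if b then 1 else -1

theorem unitStep_eq (i : Fin d) (b : Bool) : unitStep (i, b) = Pi.single i (dirSign b) := by
  cases b <;> simp [unitStep, dirSign, Pi.single_neg]

theorem sum_straightSteps (i : Fin d) (b : Bool) (m : ℕ) :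
    ((straightSteps i b m).map unitStep).sum = Pi.single i (m * dirSign b) := by
  rw [straightSteps, List.map_replicate, List.sum_replicate, unitStep_eq]
  ext j
  by_cases h : j = i
  · subst h; simp
  · simp [h]

theorem notMem_pathRange_straightSteps {i : Fin d} {b : Bool} {m : ℕ} {x : Fin d → ℤ}
    (hx : x ≠ 0) (h : dirSign b * x i ≤ 0) :
    x ∉ pathRange 0 ((straightSteps i b m).map unitStep) := by
  intro hmem
  rw [straightSteps, List.map_replicate, unitStep_eq] at hmem
  obtain ⟨j, hj⟩ := mem_pathRange_replicate hmem
  rw [zero_add] at hj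
  have h1 : x i = j * dirSign b := by rw [hj]; simp
  have h2 : dirSign b * dirSign b = 1 := by cases b <;> simp [dirSign]
  rw [h1] at h
  have h3 : (j : ℤ) ≤ 0 := by nlinarith
  have h4 : j = 0 := by omega
  rw [h4] at hj
  exact hx (by simpa using hj)

/-- Upper bound for the probability that a walk starting straight visits `x`. -/
noncomputable def straightHit (C : ℝ) (i : Fin d) (m : ℕ) (b : Bool) (x : Fin d → ℤ) : ℝ :=
  (if x ∈ pathRange 0 ((straightSteps i b m).map unitStep) then 1 else 0) +
    C * decay (x - Pi.single i (m * dirSign b))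

/-- On the half-space towards direction b, the walks sent the other way do not meet x on their
straight piece, and their endpoint is at distance at least m from x. The two endpoints are at most
2m apart, which gives the comparison of distances with factor 3. -/
theorem straightHit_product_le {p q m : ℕ} (hq : 2 ≤ q * (d - 2))
    (hpq : d + 1 ≤ (p + q) * (d - 2)) {C : ℝ} (hC : 0 < C) (i : Fin d) {b : Bool}
    {x : Fin d → ℤ} (hx : x ≠ 0) (h : 0 ≤ dirSign b * x i) :
    straightHit C i m b x ^ p * straightHit C i m (!b) x ^ q ≤
      2 ^ p * C ^ q * ((1 + (m : ℝ)) ^ 2)⁻¹ *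
        (if x ∈ pathRange 0 ((straightSteps i b m).map unitStep) then 1 else 0) +
      2 ^ p * C ^ (p + q) * 3 ^ (q * (d - 2)) * ((1 + (m : ℝ)) ^ (-(1 / 2 : ℝ)) *
        (1 + ‖x - Pi.single i (m * dirSign b)‖) ^ (-((d : ℝ) + 1 / 2))) := by
  have hneg : dirSign (!b) = -dirSign b := by cases b <;> simp [dirSign]
  have hns := notMem_pathRange_straightSteps (m := m) (b := !b) hx (by rw [hneg]; linarith)
  have hnorm : ∀ c : Bool, ‖(Pi.single i (m * dirSign c) : Fin d → ℤ)‖ = m := fun c => by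
    rw [Pi.norm_single]; cases c <;> simp [dirSign]
  have hb : (m : ℝ) ≤ ‖x - Pi.single i (m * dirSign (!b))‖ := by
    refine le_trans ?_ (norm_le_pi_norm _ i)
    rw [Int.norm_eq_abs]
    have : (m : ℤ) ≤ |(x - Pi.single i (m * dirSign (!b)) : Fin d → ℤ) i| := by
      rw [hneg]; simp only [Pi.sub_apply, Pi.single_eq_same]
      cases b <;> simp [dirSign] at h ⊢ <;> rw [le_abs] <;> omega
    exact_mod_cast this
  have hab : ‖x - Pi.single i (m * dirSign b)‖ ≤ 3 * ‖x - Pi.single i (m * dirSign (!b))‖ := by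
    have h1 := norm_add₃_le (a := x - Pi.single i (m * dirSign (!b)))
      (b := Pi.single i (m * dirSign (!b))) (c := -Pi.single i (m * dirSign b))
    rw [norm_neg, hnorm, hnorm, sub_add_cancel, ← sub_eq_add_neg] at h1
    linarith
  have e : straightHit C i m (!b) x = C * decay (x - Pi.single i (m * dirSign (!b))) := by
    simp [straightHit, hns]
  rw [e]
  exact hit_product_le hq hpq hb hab hC (by split_ifs <;> simp)

end NoIntersection

/-- With positive probability the ranges have only the origin in common. -/
theorem exists_real_rangesIntersectionGT_le {d : ℕ} (hd : 3 ≤ d) : ∃ δ : ℝ, 0 < δ ∧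
    ∀ (Ω : Type*) [MeasurableSpace Ω] (μ : Measure Ω) [IsProbabilityMeasure μ]
      (S : Fin (critWalks d) → ℕ → Ω → (Fin d → ℤ)), AreIndepSimpleRandomWalks μ S →
      ∀ t : ℝ, 1 ≤ t → μ.real (rangesIntersectionGT S t) ≤ 1 - δ := by
  obtain ⟨φ, C, hC, hpos, hφC, hsuper⟩ := exists_superharmonic hd
  have hφ : IsGreenBound φ := ⟨hpos, hsuper⟩
  set k := critWalks d with hk
  set i₀ : Fin d := ⟨0, by omega⟩ with hi₀
  set dir : Fin k → Bool := fun i => decide (i.val % 2 = 0) with hdir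
  -- The walks are sent alternately in the two directions. The numbers p and q per direction are 2
  -- and 2, 2 and 1, 1 and 1 for d = 3, d = 4, d ≥ 5, so that each direction has enough decay on its
  -- own.
  obtain ⟨p, q, hp, hq, hpq, hprod⟩ : ∃ p q : ℕ, 2 ≤ p * (d - 2) ∧ 2 ≤ q * (d - 2) ∧
      d + 1 ≤ (p + q) * (d - 2) ∧ ∀ g : Bool → ℝ, ∏ i, g (dir i) = g true ^ p * g false ^ q := by
    rcases (by omega : d = 3 ∨ d = 4 ∨ 5 ≤ d) with rfl | rfl | h5
    · have hk4 : k = 4 := rfl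
      clear_value k; subst hk4
      refine ⟨2, 2, by norm_num, by norm_num, by norm_num, fun g => ?_⟩
      simp [Fin.prod_univ_succ, hdir]; ring
    · have hk3 : k = 3 := rfl
      clear_value k; subst hk3
      refine ⟨2, 1, by norm_num, by norm_num, by norm_num, fun g => ?_⟩
      simp [Fin.prod_univ_succ, hdir]; ring
    · have hk2 : k = 2 := by rw [hk, critWalks, if_neg (by omega), if_neg (by omega)]
      clear_value k; subst hk2
      refine ⟨1, 1, by omega, by omega, by omega, fun g => ?_⟩
      simp [Fin.prod_univ_succ, hdir]
  set T : ℝ := ∑' x : Fin d → ℤ, (1 + ‖x‖) ^ (-((d : ℝ) + 1 / 2)) with hT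
  have hsum := summable_one_add_norm_rpow (d := d) (by omega)
  have hT0 : 0 ≤ T := tsum_nonneg fun x => by positivity
  set A : ℝ := 2 ^ p * C ^ q + 2 ^ q * C ^ p with hA
  set B : ℝ := 2 ^ p * C ^ (p + q) * 3 ^ (q * (d - 2)) +
    2 ^ q * C ^ (q + p) * 3 ^ (p * (d - 2)) with hB
  have hA0 : 0 < A := by positivity
  have hB0 : 0 < B := by positivity
  -- The left side dominates the total mass of the summands a x below. So, given the straight
  -- starts, the bound on the expected number of nonzero common points is at most 1/2.
  obtain ⟨m, hm⟩ : ∃ m : ℕ, (2 * A + 2 * B * T) * (1 + (m : ℝ)) ^ (-(1 / 2 : ℝ)) ≤ 1 / 2 := by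
    have h1 : Filter.Tendsto (fun m : ℕ => 1 + (m : ℝ)) Filter.atTop Filter.atTop :=
      Filter.tendsto_atTop_add_const_left _ _ tendsto_natCast_atTop_atTop
    have h2 := ((tendsto_rpow_neg_atTop (by norm_num : (0 : ℝ) < 1 / 2)).comp h1).const_mul
      (2 * A + 2 * B * T)
    rw [mul_zero] at h2
    exact ((h2.eventually (ge_mem_nhds (by norm_num : (0 : ℝ) < 1 / 2)))).exists
  set seg : Bool → Finset (Fin d → ℤ) := fun b =>
    pathRange 0 ((straightSteps i₀ b m).map unitStep) with hseg
  set ctr : Bool → Fin d → ℤ := fun b => Pi.single i₀ (m * dirSign b) with hctr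
  set a : (Fin d → ℤ) → ℝ := fun x =>
    A * ((1 + (m : ℝ)) ^ 2)⁻¹ * ((if x ∈ seg true then 1 else 0) + (if x ∈ seg false then 1 else 0)) +
    B * (1 + (m : ℝ)) ^ (-(1 / 2 : ℝ)) * ((1 + ‖x - ctr true‖) ^ (-((d : ℝ) + 1 / 2)) +
      (1 + ‖x - ctr false‖) ^ (-((d : ℝ) + 1 / 2))) with ha
  have hsegsum : ∀ b, HasSum (fun x => if x ∈ seg b then (1 : ℝ) else 0) (seg b).card := by
    intro b
    have : HasSum (fun x => if x ∈ seg b then (1 : ℝ) else 0)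
        (∑ x ∈ seg b, if x ∈ seg b then (1 : ℝ) else 0) :=
      hasSum_sum_of_ne_finset_zero fun x hx => if_neg hx
    simpa using this
  have hctrsum : ∀ b, HasSum (fun x => (1 + ‖x - ctr b‖) ^ (-((d : ℝ) + 1 / 2))) T := by
    intro b
    exact (Equiv.subRight (ctr b)).hasSum_iff.2 hsum.hasSum
  have hasum : HasSum a (A * ((1 + (m : ℝ)) ^ 2)⁻¹ * ((seg true).card + (seg false).card) +
      B * (1 + (m : ℝ)) ^ (-(1 / 2 : ℝ)) * (T + T)) :=
    (((hsegsum true).add (hsegsum false)).mul_left _).add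
      (((hctrsum true).add (hctrsum false)).mul_left _)
  have hatot : ∑' x, a x ≤ 1 / 2 := by
    rw [hasum.tsum_eq]
    refine le_trans ?_ hm
    have hcard : ∀ b, ((seg b).card : ℝ) ≤ 1 + m := by
      intro b
      have := card_pathRange_le 0 ((straightSteps i₀ b m).map unitStep)
      rw [List.length_map, straightSteps, List.length_replicate] at this
      have h2 : ((seg b).card : ℝ) ≤ ((m + 1 : ℕ) : ℝ) := by exact_mod_cast this
      push_cast at h2; linarith
    have hm0 : (0 : ℝ) < 1 + m := by positivity
    have h1 : ((1 + (m : ℝ)) ^ 2)⁻¹ * (((seg true).card : ℝ) + (seg false).card) ≤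
        2 * (1 + (m : ℝ)) ^ (-(1 / 2 : ℝ)) := by
      calc ((1 + (m : ℝ)) ^ 2)⁻¹ * (((seg true).card : ℝ) + (seg false).card)
          ≤ ((1 + (m : ℝ)) ^ 2)⁻¹ * ((1 + (m : ℝ)) + (1 + m)) := by
            gcongr
            · exact hcard true
            · exact hcard false
        _ = 2 * (1 + (m : ℝ)) ^ (-1 : ℝ) := by rw [Real.rpow_neg_one]; field_simp; ring
        _ ≤ _ := by
            gcongr 2 * ?_
            exact Real.rpow_le_rpow_of_exponent_le (by linarith [m.cast_nonneg (α := ℝ)])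
              (by norm_num)
    have := mul_le_mul_of_nonneg_left h1 hA0.le
    linarith
  have hprodle : ∀ x, x ≠ 0 → ∏ i, straightHit C i₀ m (dir i) x ≤ a x := by
    intro x hx
    rw [hprod fun b => straightHit C i₀ m b x]
    have hρ : ∀ b, 0 ≤ (1 + ‖x - ctr b‖) ^ (-((d : ℝ) + 1 / 2)) := fun b => by positivity
    have hι : ∀ b, (0 : ℝ) ≤ if x ∈ seg b then 1 else 0 := fun b => by split_ifs <;> norm_num
    have hα : 0 ≤ ((1 + (m : ℝ)) ^ 2)⁻¹ := by positivity
    have hβ : 0 ≤ (1 + (m : ℝ)) ^ (-(1 / 2 : ℝ)) := by positivity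
    rcases le_total 0 (x i₀) with h0 | h0
    · have h := straightHit_product_le (m := m) hq hpq hC i₀ (b := true) hx (by simpa [dirSign])
      refine h.trans ?_
      have u1 : 2 ^ p * C ^ q ≤ A := by rw [hA]; linarith [show 0 < 2 ^ q * C ^ p by positivity]
      have u2 : 2 ^ p * C ^ (p + q) * 3 ^ (q * (d - 2)) ≤ B := by
        rw [hB]; linarith [show 0 < 2 ^ q * C ^ (q + p) * 3 ^ (p * (d - 2)) by positivity]
      simp only [ha]
      rw [mul_assoc B]
      refine add_le_add ?_ ?_
      · exact mul_le_mul (by gcongr) (le_add_of_nonneg_right (hι false)) (hι true) (by positivity)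
      · refine mul_le_mul u2 ?_ (mul_nonneg hβ (hρ true)) hB0.le
        exact mul_le_mul_of_nonneg_left (le_add_of_nonneg_right (hρ false)) hβ
    · have h := straightHit_product_le (p := q) (q := p) (m := m) hp (by rwa [add_comm q p]) hC i₀ (b := false) hx
        (by simpa [dirSign])
      rw [mul_comm]
      refine h.trans ?_
      have u1 : 2 ^ q * C ^ p ≤ A := by rw [hA]; linarith [show 0 < 2 ^ p * C ^ q by positivity]
      have u2 : 2 ^ q * C ^ (q + p) * 3 ^ (p * (d - 2)) ≤ B := by
        rw [hB]; linarith [show 0 < 2 ^ p * C ^ (p + q) * 3 ^ (q * (d - 2)) by positivity]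
      simp only [ha]
      rw [mul_assoc B]
      refine add_le_add ?_ ?_
      · exact mul_le_mul (by gcongr) (le_add_of_nonneg_left (hι true)) (hι false) (by positivity)
      · refine mul_le_mul u2 ?_ (mul_nonneg hβ (hρ false)) hB0.le
        exact mul_le_mul_of_nonneg_left (le_add_of_nonneg_left (hρ true)) hβ
  -- The probability of all the straight starts. At least half of this event has no nonzero common
  -- point, hence δ = ε / 2.
  set ε : ℝ := ((1 / (2 * (d : ℝ))) ^ m) ^ k with hε
  have hd0 : (0 : ℝ) < d := by exact_mod_cast (by omega : 0 < d)
  have hε0 : 0 < ε := by positivity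
  refine ⟨ε / 2, by positivity, ?_⟩
  intro Ω _ μ _ S hS t ht
  set E : Set Ω := {ω | ∀ i, slice (fun n => S i (n + 1) ω - S i n ω) 0 m =
    (straightSteps i₀ (dir i) m).map unitStep} with hE
  have hlen : ∀ b, (straightSteps i₀ b m).length = m := fun b => by simp [straightSteps]
  have hEmeas : MeasurableSet E := by
    have : E = ⋂ i, {ω | slice (fun n => S i (n + 1) ω - S i n ω) 0 m ∈
      ({(straightSteps i₀ (dir i) m).map unitStep} : Set _)} := by ext; simp [hE]
    rw [this]
    exact MeasurableSet.iInter fun i => measurableSet_slice (hS.walk i).measurable _ _ _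
  have hEprob : μ.real E = ε := by
    have h := hS.real_iInter_prefix (fun _ => m)
      (fun i => {(straightSteps i₀ (dir i) m).map unitStep}) Set.univ
    simp only [Set.mem_singleton_iff, Set.mem_univ, exists_const, and_true] at h
    rw [hE, h]
    have : ∀ i, μ.real {ω | slice (fun n => S i (n + 1) ω - S i n ω) 0 m =
        (straightSteps i₀ (dir i) m).map unitStep} = (1 / (2 * (d : ℝ))) ^ m := by
      intro i
      have := (hS.walk i).real_prefix_eq (straightSteps i₀ (dir i) m)
      rwa [hlen] at this
    simp [this, hε]
  have hEle : μ.real (E ∩ rangesIntersectionGT S t) ≤ ε / 2 := by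
    have hsub : E ∩ rangesIntersectionGT S t ⊆ ⋃ x, {ω | x ≠ 0 ∧ ∀ i,
        slice (fun n => S i (n + 1) ω - S i n ω) 0 m = (straightSteps i₀ (dir i) m).map unitStep ∧
        ∃ n, S i n ω = x} := by
      rintro ω ⟨hωE, hω⟩
      have h1 : (1 : ENNReal) < ((⋂ i, Set.range (fun n => S i n ω)).encard : ENNReal) := by
        refine lt_of_le_of_lt ?_ hω
        rw [← ENNReal.ofReal_one]; exact ENNReal.ofReal_le_ofReal ht
      have h2 : 1 < (⋂ i, Set.range (fun n => S i n ω)).encard := by exact_mod_cast h1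
      obtain ⟨x, hx, hx0⟩ := Set.exists_ne_of_one_lt_encard h2 0
      refine Set.mem_iUnion.2 ⟨x, hx0, fun i => ⟨hωE i, ?_⟩⟩
      simpa using Set.mem_iInter.1 hx i
    refine (measureReal_mono hsub (measure_ne_top μ _)).trans
      ((measureReal_iUnion_le_tsum (hasum.summable.mul_left ε) fun x => ?_).trans ?_)
    · by_cases hx : x = 0
      · have ha0 : 0 ≤ a x := by
          simp only [ha]
          have hι : ∀ b, (0 : ℝ) ≤ if x ∈ seg b then 1 else 0 := fun b => by
            split_ifs <;> norm_num
          have := hι true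
          have := hι false
          positivity
        simp only [hx, ne_eq, not_true_eq_false, false_and, Set.ofPred_false, measureReal_empty]
        rw [hx] at ha0; positivity
      · simp only [ne_eq, hx, not_false_eq_true, true_and]
        have h := hS.real_iInter_prefix (fun _ => m)
          (fun i => {(straightSteps i₀ (dir i) m).map unitStep}) {x}
        simp only [Set.mem_singleton_iff] at h
        rw [h]
        have h1 : ∀ i, μ.real {ω | slice (fun n => S i (n + 1) ω - S i n ω) 0 m =
            (straightSteps i₀ (dir i) m).map unitStep ∧ ∃ n, S i n ω = x} ≤
              (1 / (2 * (d : ℝ))) ^ m * straightHit C i₀ m (dir i) x := by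
          intro i
          have := (hS.walk i).real_prefix_mem_range_le hφ (straightSteps i₀ (dir i) m) x
          rw [hlen, sum_straightSteps] at this
          refine this.trans ?_
          unfold straightHit
          gcongr
          refine (hφC _).trans (le_of_eq ?_)
          rw [decay, decay, norm_sub_rev]
        refine (Finset.prod_le_prod (fun i _ => measureReal_nonneg) fun i _ => h1 i).trans ?_
        rw [Finset.prod_mul_distrib, Finset.prod_const, Finset.card_univ, Fintype.card_fin, ← hε]
        exact mul_le_mul_of_nonneg_left (hprodle x hx) hε0.le
    · rw [tsum_mul_left]
      have := mul_le_mul_of_nonneg_left hatot hε0.le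
      linarith
  have hsplit : rangesIntersectionGT S t ⊆ Eᶜ ∪ (E ∩ rangesIntersectionGT S t) := by
    intro ω hω
    by_cases h : ω ∈ E
    · exact Or.inr ⟨h, hω⟩
    · exact Or.inl h
  have h1 := (measureReal_mono hsplit (measure_ne_top μ _)).trans (measureReal_union_le _ _)
  rw [probReal_compl_eq_one_sub hEmeas, hEprob] at h1
  linarith

/-! ### Upper bound at every level and for every number of walks -/

theorem AreIndepSimpleRandomWalks.castLE {Ω : Type*} [MeasurableSpace Ω] {μ : Measure Ω}
    {d k k' : ℕ} {S : Fin k → ℕ → Ω → (Fin d → ℤ)} (hS : AreIndepSimpleRandomWalks μ S)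
    (h : k' ≤ k) : AreIndepSimpleRandomWalks μ fun i => S (Fin.castLE h i) :=
  ⟨fun _ => hS.walk _, hS.indep.precomp (Fin.castLE_injective h)⟩

theorem rangesIntersectionGT_subset_castLE {Ω : Type*} {d k k' : ℕ}
    (S : Fin k → ℕ → Ω → (Fin d → ℤ)) (h : k' ≤ k) (t : ℝ) :
    rangesIntersectionGT S t ⊆ rangesIntersectionGT (fun i => S (Fin.castLE h i)) t := by
  intro ω hω
  refine lt_of_lt_of_le (show ENNReal.ofReal t < _ from hω) ?_
  have : (⋂ i, Set.range (fun n => S i n ω)).encard ≤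
      (⋂ i : Fin k', Set.range (fun n => S (Fin.castLE h i) n ω)).encard :=
    Set.encard_le_encard (Set.subset_iInter fun i => Set.iInter_subset _ _)
  exact_mod_cast this

theorem exists_le_and_lt_succ {F : ℕ → ℝ} {t : ℝ} (h0 : F 0 ≤ t) (h : ∃ j, t < F j) :
    ∃ j, F j ≤ t ∧ t < F (j + 1) := by
  classical
  set j := Nat.find h with hj
  have hpos : j ≠ 0 := fun h' => by
    have := Nat.find_spec h
    rw [← hj, h'] at this; linarith
  obtain ⟨i, hi⟩ := Nat.exists_eq_succ_of_ne_zero hpos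
  refine ⟨i, not_lt.1 (Nat.find_min h (by omega)), ?_⟩
  have := Nat.find_spec h
  rwa [← hj, hi] at this

/-- The level `t`, with the logarithmic correction in low dimensions. -/
noncomputable def effLevel (d : ℕ) (t : ℝ) : ℝ := if d ≤ 4 then t / Real.log t else t

/-- Take the last j₀ whose level does not exceed t. The next level does, so t is at most a constant
times r ^ d (j₀ + 2) when d ≤ 4, and log t ≥ j₀ + 1 turns this into a bound on t / log t. For d ≥ 5
no logarithm appears. The power 1 - 2 / d of r ^ d is r ^ (d - 2). -/
theorem exists_scale {d : ℕ} (hd : 3 ≤ d) {K : ℝ} (hK : 0 < K) : ∃ M : ℝ, 0 < M ∧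
    ∀ t : ℝ, 1 < t → (d ≤ 4 → Real.exp 1 < t) →
      effLevel d t ^ (1 - 2 / (d : ℝ)) ≤ M ∨
      ∃ j₀ : ℕ, K * ((2 ^ j₀) ^ d * (logWeight d * j₀ + 1)) ≤ t ∧
        effLevel d t ^ (1 - 2 / (d : ℝ)) ≤ M * (2 ^ j₀) ^ (d - 2) := by
  have hd' : (3 : ℝ) ≤ d := by exact_mod_cast hd
  -- A constant at least e is needed for exp (j + 1) ≤ K' (2 ^ j) ^ d, which is the source of log t
  -- ≥ j + 1; d ≥ 3 enters through e ≤ 8.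
  set K' := max K 3 with hK'
  have hK3 : 3 ≤ K' := le_max_right _ _
  set θ : ℝ := 1 - 2 / (d : ℝ) with hθ
  have hθ0 : 0 ≤ θ := by
    rw [hθ, sub_nonneg, div_le_one (by linarith)]; linarith
  have hnn : ∀ t : ℝ, 1 < t → 0 ≤ effLevel d t := fun t ht => by
    have := Real.log_pos ht
    unfold effLevel; split_ifs <;> positivity
  refine ⟨(2 * K' * 2 ^ d) ^ θ, by positivity, fun t ht hte => ?_⟩
  by_cases htK : t < K'
  · left
    refine Real.rpow_le_rpow (hnn t ht) ?_ hθ0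
    have h1 : effLevel d t ≤ t := by
      unfold effLevel
      split_ifs with h4
      · refine div_le_self (by linarith) ?_
        rw [Real.le_log_iff_exp_le (by linarith)]
        exact (hte h4).le
      · exact le_rfl
    have h2 : (1 : ℝ) ≤ 2 ^ d := one_le_pow₀ (by norm_num)
    nlinarith
  · right
    rw [not_lt] at htK
    have hw := logWeight_nonneg d
    have hunb : ∃ j : ℕ, t < K' * (((2 : ℝ) ^ j) ^ d * (logWeight d * j + 1)) := by
      obtain ⟨j, hj⟩ := pow_unbounded_of_one_lt t (by norm_num : (1 : ℝ) < 2)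
      refine ⟨j, hj.trans_le ?_⟩
      have h1 : (2 : ℝ) ^ j ≤ (2 ^ j) ^ d := le_self_pow₀ (one_le_pow₀ (by norm_num)) (by omega)
      have h2 : 1 ≤ logWeight d * j + 1 := by
        have : 0 ≤ logWeight d * j := by positivity
        linarith
      calc (2 : ℝ) ^ j ≤ 1 * ((2 ^ j) ^ d * 1) := by linarith
        _ ≤ _ := by gcongr; linarith
    obtain ⟨j, hj1, hj2⟩ := exists_le_and_lt_succ
      (F := fun j : ℕ => K' * (((2 : ℝ) ^ j) ^ d * (logWeight d * j + 1))) (by simpa using htK) hunb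
    refine ⟨j, le_trans ?_ hj1, ?_⟩
    · gcongr; exact le_max_left _ _
    have hs : effLevel d t ≤ 2 * K' * 2 ^ d * (2 ^ j) ^ d := by
      have e : (((2 : ℝ) ^ (j + 1)) ^ d) = 2 ^ d * (2 ^ j) ^ d := by
        rw [pow_succ, mul_pow, mul_comm]
      rw [e] at hj2
      unfold effLevel
      by_cases h4 : d ≤ 4
      · rw [if_pos h4]
        have hw1 : logWeight d = 1 := by simp [logWeight, h4]
        rw [hw1] at hj1 hj2
        have hlog : (j : ℝ) + 1 ≤ Real.log t := by
          rw [Real.le_log_iff_exp_le (by linarith)]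
          refine le_trans ?_ hj1
          have h1 : Real.exp 1 ≤ 3 := by linarith [Real.exp_one_lt_d9]
          have h2 : Real.exp (j : ℝ) ≤ (2 ^ j) ^ d := by
            calc Real.exp (j : ℝ) = Real.exp 1 ^ j := by rw [← Real.exp_nat_mul, mul_one]
              _ ≤ 8 ^ j := by gcongr; linarith
              _ = (2 ^ j) ^ 3 := by rw [← pow_mul, mul_comm, pow_mul]; norm_num
              _ ≤ (2 ^ j) ^ d := pow_le_pow_right₀ (one_le_pow₀ (by norm_num)) hd
          rw [Real.exp_add, mul_comm]
          have h3 : (1 : ℝ) ≤ 1 * j + 1 := by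
            have : (0 : ℝ) ≤ j := by positivity
            linarith
          calc Real.exp 1 * Real.exp j ≤ K' * ((2 ^ j) ^ d * 1) := by
                rw [mul_one]; gcongr; linarith
            _ ≤ _ := by gcongr
        have hlog0 : 0 < Real.log t := Real.log_pos ht
        rw [div_le_iff₀ hlog0]
        push_cast at hj2
        have : 1 * ((j : ℝ) + 1) + 1 ≤ 2 * Real.log t := by linarith [j.cast_nonneg (α := ℝ)]
        refine hj2.le.trans ?_
        calc K' * (2 ^ d * (2 ^ j) ^ d * (1 * ((j : ℝ) + 1) + 1))
            ≤ K' * (2 ^ d * (2 ^ j) ^ d * (2 * Real.log t)) := by gcongr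
          _ = _ := by ring
      · rw [if_neg h4]
        have hw0 : logWeight d = 0 := by simp [logWeight, h4]
        rw [hw0, zero_mul, zero_add, mul_one] at hj2
        refine hj2.le.trans ?_
        have : 0 ≤ K' * (2 ^ d * (2 ^ j) ^ d) := by positivity
        linarith
    calc effLevel d t ^ θ ≤ (2 * K' * 2 ^ d * (2 ^ j) ^ d) ^ θ :=
          Real.rpow_le_rpow (hnn t ht) hs hθ0
      _ = (2 * K' * 2 ^ d) ^ θ * (2 ^ j) ^ (d - 2) := by
          rw [Real.mul_rpow (by positivity) (by positivity)]
          congr 1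
          rw [← Real.rpow_natCast ((2 : ℝ) ^ j) d, ← Real.rpow_mul (by positivity),
            ← Real.rpow_natCast ((2 : ℝ) ^ j) (d - 2)]
          congr 1
          rw [hθ]; push_cast [Nat.cast_sub (by omega : 2 ≤ d)]; field_simp

/-- Only `critWalks d` of the walks are used, since more walks shrink the intersection. When u =
`effLevel d t` ^ (1 - 2 / d) is large, half of the exponent absorbs the prefactor C; when u ≤ u₁,
the bound 1 - δ ≤ exp (-δ) suffices. -/
theorem exists_upper_bound {d : ℕ} (hd : 3 ≤ d) : ∃ c : ℝ, 0 < c ∧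
    ∀ (k : ℕ), critWalks d ≤ k → ∀ (Ω : Type*) [MeasurableSpace Ω] (μ : Measure Ω)
      [IsProbabilityMeasure μ] (S : Fin k → ℕ → Ω → (Fin d → ℤ)),
      AreIndepSimpleRandomWalks μ S → ∀ t : ℝ, 1 < t → (d ≤ 4 → Real.exp 1 < t) →
        μ.real (rangesIntersectionGT S t) ≤
          Real.exp (-c * effLevel d t ^ (1 - 2 / (d : ℝ))) := by
  obtain ⟨K, C, c, hK, hC, hc, htail⟩ := exists_upper_tail hd
  obtain ⟨δ, hδ, hsmall⟩ := exists_real_rangesIntersectionGT_le hd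
  obtain ⟨M, hM, hscale⟩ := exists_scale hd hK
  set u₁ : ℝ := max M (2 * M * Real.log C / c) with hu₁
  have hu₁0 : 0 < u₁ := lt_max_of_lt_left hM
  refine ⟨min (c / (2 * M)) (δ / u₁), by positivity, ?_⟩
  intro k hk Ω _ μ _ S hS t ht hte
  refine (measureReal_mono (rangesIntersectionGT_subset_castLE S hk t) (measure_ne_top μ _)).trans ?_
  have hS' := hS.castLE hk
  have hu0 : 0 ≤ effLevel d t ^ (1 - 2 / (d : ℝ)) := by
    have := Real.log_pos ht
    refine Real.rpow_nonneg ?_ _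
    unfold effLevel; split_ifs <;> positivity
  have hsc := hscale t ht hte
  set u := effLevel d t ^ (1 - 2 / (d : ℝ)) with hu
  rcases le_or_gt u u₁ with h | h
  · refine (hsmall Ω μ _ hS' t ht.le).trans ?_
    have h1 : 1 - δ ≤ Real.exp (-δ) := by linarith [Real.add_one_le_exp (-δ)]
    refine h1.trans (Real.exp_le_exp.2 ?_)
    have : min (c / (2 * M)) (δ / u₁) * u ≤ δ / u₁ * u₁ :=
      mul_le_mul (min_le_right _ _) h hu0 (by positivity)
    rw [div_mul_cancel₀ _ hu₁0.ne'] at this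
    linarith
  · rcases hsc with h' | ⟨j₀, hj₀, h'⟩
    · exact absurd (h'.trans (le_max_left _ _)) (not_le.2 h)
    · refine (htail Ω μ _ hS' j₀ t hj₀).trans ?_
      have h1 : Real.log C ≤ c / (2 * M) * u := by
        have := (le_max_right M (2 * M * Real.log C / c)).trans h.le
        rw [div_le_iff₀ hc] at this
        rw [div_mul_eq_mul_div, le_div_iff₀ (by positivity)]
        linarith
      have h2 : c / M * u ≤ c * (2 ^ j₀) ^ (d - 2) := by
        rw [div_mul_eq_mul_div, div_le_iff₀ hM, mul_assoc]
        have := mul_le_mul_of_nonneg_left h' hc.le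
        linarith
      have h3 : min (c / (2 * M)) (δ / u₁) * u ≤ c / (2 * M) * u := by
        gcongr; exact min_le_left _ _
      have h4 : c / M * u = c / (2 * M) * u + c / (2 * M) * u := by field_simp; ring
      calc C * Real.exp (-c * (2 ^ j₀) ^ (d - 2))
          = Real.exp (Real.log C + -c * (2 ^ j₀) ^ (d - 2)) := by
            rw [Real.exp_add, Real.exp_log hC]
        _ ≤ _ := Real.exp_le_exp.2 (by linarith)

/-! ### Minimum principle on the lattice -/

section MinimumPrinciple

variable {d : ℕ}

theorem le_stepAvg_of_forall_le (hd : 0 < d) {f : (Fin d → ℤ) → ℝ} {x : Fin d → ℤ} {m : ℝ}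
    (h1 : ∀ i, m ≤ f (x + Pi.single i 1)) (h2 : ∀ i, m ≤ f (x - Pi.single i 1)) (i₀ : Fin d)
    (h3 : m < f (x + Pi.single i₀ 1)) : m < stepAvg f x := by
  have hd' : (0 : ℝ) < d := by exact_mod_cast hd
  unfold stepAvg
  rw [lt_div_iff₀ (by positivity)]
  have : ∑ _i : Fin d, (m + m) < ∑ i, (f (x + Pi.single i 1) + f (x - Pi.single i 1)) :=
    Finset.sum_lt_sum (fun i _ => add_le_add (h1 i) (h2 i))
      ⟨i₀, Finset.mem_univ _, add_lt_add_of_lt_of_le h3 (h2 i₀)⟩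
  simp at this
  linarith

/-- A function that vanishes at infinity and is superharmonic where it is negative is
nonnegative. -/
theorem nonneg_of_superharmonic (hd : 0 < d) {f : (Fin d → ℤ) → ℝ}
    (hfin : ∀ ε > 0, {x | f x ≤ -ε}.Finite) (hf : ∀ x, f x < 0 → stepAvg f x ≤ f x)
    (x : Fin d → ℤ) : 0 ≤ f x := by
  by_contra! hx
  have hs : ({y | f y ≤ f x} : Set (Fin d → ℤ)).Finite := by
    simpa using hfin (-f x) (by linarith)
  obtain ⟨y, hy, hmin⟩ := Set.exists_min_image _ f hs ⟨x, le_refl (f x)⟩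
  have hmin' : ∀ z, f y ≤ f z := fun z => by
    by_cases hz : f z ≤ f x
    · exact hmin z hz
    · exact le_trans hy (not_le.1 hz).le
  have hs2 : ({z | f z ≤ f y} : Set (Fin d → ℤ)).Finite :=
    hs.subset fun z (hz : f z ≤ f y) => (hz.trans hy : f z ≤ f x)
  -- Among the finitely many global minimisers, one with the largest first coordinate has a strictly
  -- larger right neighbour, so the average there exceeds the minimum.
  obtain ⟨w, hw, hmax⟩ := Set.exists_max_image _ (fun z : Fin d → ℤ => z ⟨0, hd⟩) hs2 ⟨y, le_refl (f y)⟩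
  have hw' : f w ≤ f y := hw
  have h1 : f y < f (w + Pi.single ⟨0, hd⟩ 1) := by
    by_contra! hc
    have := hmax _ hc
    simp at this
  have h2 := le_stepAvg_of_forall_le hd (x := w) (fun i => hmin' _) (fun i => hmin' _) _ h1
  have h3 := hf w (hw'.trans_lt (lt_of_le_of_lt hy hx))
  linarith

theorem finite_norm_le (r : ℝ) : {x : Fin d → ℤ | ‖x‖ ≤ r}.Finite := by
  obtain ⟨n, hn⟩ := exists_nat_ge r
  exact (latticeBall d n).finite_toSet.subset fun x hx => by
    simpa [mem_latticeBall] using le_trans hx hn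

theorem finite_decay_ge (hd : 3 ≤ d) {ε : ℝ} (hε : 0 < ε) :
    {x : Fin d → ℤ | ε ≤ decay x}.Finite := by
  refine (finite_norm_le ε⁻¹).subset fun x hx => ?_
  have hx : ε ≤ ((1 + ‖x‖) ^ (d - 2))⁻¹ := hx
  have h1 : (1 + ‖x‖) ^ (d - 2) ≤ ε⁻¹ := by
    rw [← inv_inv ((1 + ‖x‖) ^ (d - 2))]
    exact inv_anti₀ hε hx
  have h2 : (1 + ‖x‖) ≤ (1 + ‖x‖) ^ (d - 2) :=
    le_self_pow₀ (by linarith [norm_nonneg x]) (by omega)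
  show ‖x‖ ≤ ε⁻¹
  linarith

theorem lattice_induction {P : (Fin d → ℤ) → Prop} (h0 : P 0)
    (h1 : ∀ x i, P x → P (x + Pi.single i 1)) (h2 : ∀ x i, P x → P (x - Pi.single i 1))
    (x : Fin d → ℤ) : P x := by
  have h3 : ∀ y i (m : ℤ), P y → P (y + Pi.single i m) := fun y i m hy => by
    induction m using Int.induction_on with
    | zero => simpa using hy
    | succ m ih => rw [Pi.single_add, ← add_assoc]; exact h1 _ _ ih
    | pred m ih => rw [Pi.single_sub, ← add_sub_assoc]; exact h2 _ _ ih
  have h4 : ∀ s : Finset (Fin d), P (∑ i ∈ s, Pi.single i (x i)) := fun s => by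
    induction s using Finset.induction_on with
    | empty => simpa using h0
    | insert a s ha ih => rw [Finset.sum_insert ha, add_comm]; exact h3 _ _ _ ih
  simpa [Finset.univ_sum_single] using h4 Finset.univ

end MinimumPrinciple

/-! ### The Green function and its killed version -/

section Green

variable {d : ℕ}

/-- The law of simple random walk from the origin after `n` steps. -/
noncomputable def walkLaw {d : ℕ} : ℕ → (Fin d → ℤ) → ℝ
  | 0, x => if x = 0 then 1 else 0
  | n + 1, x => stepAvg (walkLaw n) x

theorem walkLaw_nonneg (n : ℕ) (x : Fin d → ℤ) : 0 ≤ walkLaw n x := by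
  induction n generalizing x with
  | zero => unfold walkLaw; split_ifs <;> norm_num
  | succ n ih => exact stepAvg_nonneg ih x

theorem sum_walkLaw_succ (N : ℕ) (x : Fin d → ℤ) :
    ∑ n ∈ Finset.range (N + 1), walkLaw n x =
      (if x = 0 then 1 else 0) + stepAvg (fun y => ∑ n ∈ Finset.range N, walkLaw n y) x := by
  rw [Finset.sum_range_succ', stepAvg_sum, add_comm]; rfl

theorem IsGreenBound.sum_walkLaw_le {φ : (Fin d → ℤ) → ℝ} (hφ : IsGreenBound φ) (N : ℕ)
    (x : Fin d → ℤ) : ∑ n ∈ Finset.range N, walkLaw n x ≤ φ x := by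
  induction N generalizing x with
  | zero => simpa using (hφ.pos x).le
  | succ N ih =>
    rw [sum_walkLaw_succ, add_comm]
    exact (add_le_add_left (stepAvg_mono ih x) _).trans (hφ.superharmonic x)

/-- The Green function of simple random walk. -/
noncomputable def green {d : ℕ} (x : Fin d → ℤ) : ℝ := ∑' n, walkLaw n x

theorem exists_isGreenBound (hd : 3 ≤ d) :
    ∃ (φ : (Fin d → ℤ) → ℝ) (C : ℝ), 0 < C ∧ IsGreenBound φ ∧ ∀ x, φ x ≤ C * decay x := by
  obtain ⟨φ, C, hC, h1, h2, h3⟩ := exists_superharmonic hd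
  exact ⟨φ, C, hC, ⟨h1, h3⟩, h2⟩

theorem summable_walkLaw (hd : 3 ≤ d) (x : Fin d → ℤ) : Summable fun n => walkLaw n x := by
  obtain ⟨φ, -, -, hφ, -⟩ := exists_isGreenBound hd
  exact summable_of_sum_range_le (fun n => walkLaw_nonneg n x) (fun N => hφ.sum_walkLaw_le N x)

theorem IsGreenBound.green_le {φ : (Fin d → ℤ) → ℝ} (hφ : IsGreenBound φ) (x : Fin d → ℤ) :
    green x ≤ φ x :=
  Real.tsum_le_of_sum_range_le (fun n => walkLaw_nonneg n x) (fun N => hφ.sum_walkLaw_le N x)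

theorem green_nonneg (x : Fin d → ℤ) : 0 ≤ green x := tsum_nonneg fun n => walkLaw_nonneg n x

theorem green_eq (hd : 3 ≤ d) (x : Fin d → ℤ) :
    green x = (if x = 0 then 1 else 0) + stepAvg green x := by
  have h1 := (summable_walkLaw hd x).tendsto_sum_tsum_nat.comp (Filter.tendsto_add_atTop_nat 1)
  refine tendsto_nhds_unique h1 ?_
  have h2 : (fun N => ∑ n ∈ Finset.range (N + 1), walkLaw n x) = fun N =>
      (if x = 0 then 1 else 0) + stepAvg (fun y => ∑ n ∈ Finset.range N, walkLaw n y) x :=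
    funext fun N => sum_walkLaw_succ N x
  change Filter.Tendsto (fun N => ∑ n ∈ Finset.range (N + 1), walkLaw n x) _ _
  rw [h2]
  unfold stepAvg
  refine tendsto_const_nhds.add (Filter.Tendsto.div_const (tendsto_finsetSum _ fun i _ => ?_) _)
  exact ((summable_walkLaw hd _).tendsto_sum_tsum_nat).add
    ((summable_walkLaw hd _).tendsto_sum_tsum_nat)

theorem div_le_stepAvg {f : (Fin d → ℤ) → ℝ} (hf : ∀ x, 0 ≤ f x) (x : Fin d → ℤ) (i : Fin d) :
    f (x + Pi.single i 1) / (2 * d) ≤ stepAvg f x ∧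
      f (x - Pi.single i 1) / (2 * d) ≤ stepAvg f x := by
  have h := Finset.single_le_sum (f := fun i => f (x + Pi.single i 1) + f (x - Pi.single i 1))
    (fun i _ => add_nonneg (hf _) (hf _)) (Finset.mem_univ i)
  have h1 := hf (x + Pi.single i 1)
  have h2 := hf (x - Pi.single i 1)
  unfold stepAvg
  constructor <;> gcongr <;> linarith

theorem green_pos (hd : 3 ≤ d) (x : Fin d → ℤ) : 0 < green x := by
  have hd' : (0 : ℝ) < d := by exact_mod_cast (by omega : 0 < d)
  refine lattice_induction (P := fun x => 0 < green x) ?_ (fun x i hx => ?_) (fun x i hx => ?_) x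
  · rw [green_eq hd, if_pos rfl]
    have := stepAvg_nonneg green_nonneg (0 : Fin d → ℤ)
    linarith
  · rw [green_eq hd]
    have h1 := (div_le_stepAvg green_nonneg (x + Pi.single i 1) i).2
    rw [add_sub_cancel_right] at h1
    have h2 : 0 < green x / (2 * d) := by positivity
    split_ifs <;> linarith
  · rw [green_eq hd]
    have h1 := (div_le_stepAvg green_nonneg (x - Pi.single i 1) i).1
    rw [sub_add_cancel] at h1
    have h2 : 0 < green x / (2 * d) := by positivity
    split_ifs <;> linarith

theorem isGreenBound_green (hd : 3 ≤ d) : IsGreenBound (green (d := d)) :=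
  ⟨green_pos hd, fun x => by rw [add_comm, ← green_eq hd x]⟩

theorem exists_green_le (hd : 3 ≤ d) : ∃ C : ℝ, 0 < C ∧ ∀ x : Fin d → ℤ, green x ≤ C * decay x := by
  obtain ⟨φ, C, hC, hφ, h⟩ := exists_isGreenBound hd
  exact ⟨C, hC, fun x => (hφ.green_le x).trans (h x)⟩

/-- The minimum principle is applied to L * green - ψ, which is at least -C * `decay`. In the
exceptional ball L is large enough to make it nonnegative, so wherever it is negative `green` is
superharmonic and ψ subharmonic. -/
theorem exists_le_green (hd : 3 ≤ d) : ∃ c : ℝ, 0 < c ∧ ∀ x : Fin d → ℤ, c * decay x ≤ green x := by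
  obtain ⟨ψ, c, C, M, K, hc, hC, -, h1, h2, h3⟩ := exists_subharmonic hd
  obtain ⟨m, hm, hmin⟩ : ∃ m : ℝ, 0 < m ∧ ∀ x : Fin d → ℤ, ‖x‖ ≤ K → m ≤ green x := by
    rcases Set.eq_empty_or_nonempty {x : Fin d → ℤ | ‖x‖ ≤ K} with h0 | h0
    · exact ⟨1, one_pos, fun x hx => absurd hx (Set.eq_empty_iff_forall_notMem.1 h0 x)⟩
    · obtain ⟨y, -, hy⟩ := Set.exists_min_image _ green (finite_norm_le K) h0
      exact ⟨green y, green_pos hd y, hy⟩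
  set L : ℝ := C / m with hL
  have hL0 : 0 < L := by positivity
  have key : ∀ x, 0 ≤ L * green x - ψ x := by
    refine nonneg_of_superharmonic (by omega) (fun ε hε => ?_) fun x hx => ?_
    · refine (finite_decay_ge hd (by positivity : 0 < ε / C)).subset fun x hx => ?_
      have hx : L * green x - ψ x ≤ -ε := hx
      have := mul_pos hL0 (green_pos hd x)
      show ε / C ≤ decay x
      rw [div_le_iff₀' hC]
      linarith [h2 x]
    · have hK : ¬ ‖x‖ ≤ K := fun hK => by
        have e1 : C ≤ L * green x := by
          have := mul_le_mul_of_nonneg_left (hmin x hK) hL0.le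
          rwa [hL, div_mul_cancel₀ _ hm.ne'] at this
        have e2 := (h2 x).trans (mul_le_of_le_one_right hC.le (decay_le_one x))
        linarith
      have e := h3 x
      rw [if_neg hK] at e
      have e2 := (isGreenBound_green hd).superharmonic x
      have e3 : stepAvg (fun x => L * green x - ψ x) x = L * stepAvg green x - stepAvg ψ x := by
        have := stepAvg_add (fun x => L * green x) (fun x => (-1) * ψ x) x
        rw [stepAvg_const_mul, stepAvg_const_mul] at this
        simpa [sub_eq_add_neg] using this
      rw [e3]
      have e4 : L * stepAvg green x ≤ L * green x := by
        gcongr; split_ifs at e2 <;> linarith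
      linarith
  refine ⟨c / L, by positivity, fun x => ?_⟩
  rw [div_mul_eq_mul_div, div_le_iff₀' hL0]
  linarith [h1 x, key x]

/-- The Green function of the walk killed at `y`. -/
noncomputable def killedGreen {d : ℕ} (y x z : Fin d → ℤ) : ℝ :=
  green (x - z) - green (x - y) * (green (y - z) / green (0 : Fin d → ℤ))

/-- The term subtracted in `killedGreen` is the contribution after the first visit to y: the hitting
probability green (x - y) / green 0 times green (y - z). Only its consequences are used: vanishing
at y, the Green equation off y, and nonnegativity. -/
theorem killedGreen_self (hd : 3 ≤ d) (y z : Fin d → ℤ) : killedGreen y y z = 0 := by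
  have := (green_pos hd (0 : Fin d → ℤ)).ne'
  rw [killedGreen, sub_self]; field_simp; ring

theorem stepAvg_killedGreen (y x z : Fin d → ℤ) :
    stepAvg (fun x => killedGreen y x z) x =
      stepAvg green (x - z) - stepAvg green (x - y) * (green (y - z) / green (0 : Fin d → ℤ)) := by
  have := stepAvg_add (fun x => green (x - z))
    (fun x => (-(green (y - z) / green (0 : Fin d → ℤ))) * green (x - y)) x
  rw [stepAvg_const_mul, stepAvg_sub_right, stepAvg_sub_right] at this
  have e : (fun x => killedGreen y x z) =
      fun x => green (x - z) + (-(green (y - z) / green (0 : Fin d → ℤ))) * green (x - y) := by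
    funext x; rw [killedGreen]; ring
  rw [e, this]; ring

theorem killedGreen_eq (hd : 3 ≤ d) {y x : Fin d → ℤ} (z : Fin d → ℤ) (h : x ≠ y) :
    killedGreen y x z = (if x = z then 1 else 0) + stepAvg (fun x => killedGreen y x z) x := by
  rw [stepAvg_killedGreen, killedGreen, green_eq hd (x - z), green_eq hd (x - y),
    if_neg (sub_ne_zero.2 h)]
  simp only [sub_eq_zero]; ring

theorem killedGreen_nonneg (hd : 3 ≤ d) (y x z : Fin d → ℤ) : 0 ≤ killedGreen y x z := by
  refine nonneg_of_superharmonic (f := fun x => killedGreen y x z) (by omega) (fun ε hε => ?_)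
    (fun x hx => ?_) x
  · obtain ⟨C, hC, hgr⟩ := exists_green_le hd
    set a := green (y - z) / green (0 : Fin d → ℤ) with ha
    have ha0 : 0 < a := div_pos (green_pos hd _) (green_pos hd _)
    have hfin := (finite_decay_ge hd (by positivity : 0 < ε / (C * a))).image (· + y)
    refine hfin.subset fun x hx => ⟨x - y, ?_, by simp⟩
    have hx : green (x - z) - green (x - y) * a ≤ -ε := hx
    have h1 := green_pos hd (x - z)
    have h2 := mul_le_mul_of_nonneg_right (hgr (x - y)) ha0.le
    show ε / (C * a) ≤ decay (x - y)
    rw [div_le_iff₀ (by positivity)]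
    linarith
  · have hxy : x ≠ y := by
      rintro rfl
      simp only [killedGreen_self hd] at hx
      exact lt_irrefl _ hx
    have := killedGreen_eq hd z hxy
    change stepAvg (fun x => killedGreen y x z) x ≤ killedGreen y x z
    split_ifs at this <;> linarith

end Green

/-! ### Moments of the number of chains of visits -/

/-- The sum of products of `K` along the chains `x, z₁, …, zₙ` with `z₁ ∈ B (n - 1)`, …,
`zₙ ∈ B 0`. -/
def chainSum {X : Type*} (K : X → X → ℝ) (B : ℕ → Finset X) : ℕ → X → ℝ
  | 0, _ => 1
  | n + 1, x => ∑ z ∈ B n, K x z * chainSum K B n z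

section ChainSum

variable {X : Type*} {K K' : X → X → ℝ} {B : ℕ → Finset X}

theorem chainSum_nonneg (hK : ∀ x z, 0 ≤ K x z) (n : ℕ) (x : X) : 0 ≤ chainSum K B n x := by
  induction n generalizing x with
  | zero => exact zero_le_one
  | succ n ih => exact Finset.sum_nonneg fun z _ => mul_nonneg (hK x z) (ih z)

theorem chainSum_le_pow_mul {q : ℝ} (hq : 0 ≤ q) (hK : ∀ x z, 0 ≤ K x z)
    (hK' : ∀ x z, 0 ≤ K' x z) (h : ∀ n, ∀ x ∈ B (n + 1), ∀ z ∈ B n, K' x z ≤ q * K x z)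
    (n : ℕ) {x : X} (hx : x ∈ B n) : chainSum K' B n x ≤ q ^ n * chainSum K B n x := by
  induction n generalizing x with
  | zero => simp [chainSum]
  | succ n ih =>
    simp only [chainSum, Finset.mul_sum]
    refine Finset.sum_le_sum fun z hz => ?_
    calc K' x z * chainSum K' B n z ≤ (q * K x z) * (q ^ n * chainSum K B n z) :=
          mul_le_mul (h n x hx z hz) (ih hz) (chainSum_nonneg hK' n z) (mul_nonneg hq (hK x z))
      _ = q ^ (n + 1) * (K x z * chainSum K B n z) := by ring

/-- The starting point need not lie in any of the sets, so the first link is compared only by K' ≤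
K, and n + 1 links gain n factors q. -/
theorem chainSum_succ_le_pow_mul {q : ℝ} (hq : 0 ≤ q) (hK' : ∀ x z, 0 ≤ K' x z)
    (hKK : ∀ x z, K' x z ≤ K x z)
    (h : ∀ n, ∀ x ∈ B (n + 1), ∀ z ∈ B n, K' x z ≤ q * K x z)
    (n : ℕ) (x : X) : chainSum K' B (n + 1) x ≤ q ^ n * chainSum K B (n + 1) x := by
  have hK : ∀ x z, 0 ≤ K x z := fun x z => (hK' x z).trans (hKK x z)
  simp only [chainSum, Finset.mul_sum]
  refine Finset.sum_le_sum fun z hz => ?_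
  calc K' x z * chainSum K' B n z ≤ K x z * (q ^ n * chainSum K B n z) :=
        mul_le_mul (hKK x z) (chainSum_le_pow_mul hq hK hK' h n hz) (chainSum_nonneg hK' n z)
          (hK x z)
    _ = q ^ n * (K x z * chainSum K B n z) := by ring

theorem pow_le_chainSum {v : ℝ} (hv : 0 ≤ v) (hK : ∀ x z, 0 ≤ K x z) (x₀ : X)
    (h : ∀ n, ∀ x, x ∈ B (n + 1) ∨ x = x₀ → v ≤ ∑ z ∈ B n, K x z) (n : ℕ) {x : X}
    (hx : x ∈ B n ∨ x = x₀) : v ^ n ≤ chainSum K B n x := by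
  induction n generalizing x with
  | zero => simp [chainSum]
  | succ n ih =>
    rw [pow_succ']
    refine (mul_le_mul_of_nonneg_right (h n x hx) (pow_nonneg hv n)).trans ?_
    rw [Finset.sum_mul]
    exact Finset.sum_le_sum fun z hz => mul_le_mul_of_nonneg_left (ih (Or.inl hz)) (hK x z)

theorem tendsto_chainSum {K' : ℕ → X → X → ℝ}
    (h : ∀ x z, Filter.Tendsto (fun N => K' N x z) Filter.atTop (nhds (K x z))) (n : ℕ) (x : X) :
    Filter.Tendsto (fun N => chainSum (K' N) B n x) Filter.atTop (nhds (chainSum K B n x)) := by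
  induction n generalizing x with
  | zero => exact tendsto_const_nhds
  | succ n ih => exact tendsto_finsetSum _ fun z _ => (h x z).mul (ih z)

end ChainSum

section ChainCount

variable {d : ℕ}

/-- The sum of `h` over the end pieces of a path. -/
def suffixSum (h : (Fin d → ℤ) → List (Fin d → ℤ) → ℝ) : (Fin d → ℤ) → List (Fin d → ℤ) → ℝ
  | x, [] => h x []
  | x, e :: l => h x (e :: l) + suffixSum h (x + e) l

/-- The number of times `i₁ ≤ … ≤ iₙ` at which a path is in `B (n - 1)`, …, `B 0`. -/
def chainCount (B : ℕ → Finset (Fin d → ℤ)) : ℕ → (Fin d → ℤ) → List (Fin d → ℤ) → ℝ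
  | 0 => fun _ _ => 1
  | n + 1 => suffixSum fun x l => if x ∈ B n then chainCount B n x l else 0

variable {B : ℕ → Finset (Fin d → ℤ)}

theorem chainCount_succ_nil (n : ℕ) (x : Fin d → ℤ) :
    chainCount B (n + 1) x [] = if x ∈ B n then chainCount B n x [] else 0 := rfl

theorem chainCount_succ_cons (n : ℕ) (x e : Fin d → ℤ) (l : List (Fin d → ℤ)) :
    chainCount B (n + 1) x (e :: l) =
      (if x ∈ B n then chainCount B n x (e :: l) else 0) + chainCount B (n + 1) (x + e) l := rfl

theorem chainCount_nonneg (n : ℕ) (x : Fin d → ℤ) (l : List (Fin d → ℤ)) :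
    0 ≤ chainCount B n x l := by
  induction n generalizing x l with
  | zero => exact zero_le_one
  | succ n ih =>
    induction l generalizing x with
    | nil => rw [chainCount_succ_nil]; split_ifs; exacts [ih _ _, le_rfl]
    | cons e l ihl =>
      rw [chainCount_succ_cons]
      refine add_nonneg ?_ (ihl _)
      split_ifs; exacts [ih _ _, le_rfl]

/-- A path with T visits to D has at most as many chains as there are multisets of size n from T
times, and the generating function of these numbers is (1 - ξ) ^ (-T) ≤ exp (2 ξ T) for ξ ≤ 1/2. The
induction splits by whether the first time of the chain is the present one: shares ξ and 1 - ξ. -/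
theorem chainCount_le {D : Finset (Fin d → ℤ)} (hB : ∀ n, B n ⊆ D) {ξ : ℝ} (hξ : 0 < ξ)
    (hξ' : ξ ≤ 1 / 2) (n : ℕ) (x : Fin d → ℤ) (l : List (Fin d → ℤ)) :
    chainCount B n x l ≤ ξ⁻¹ ^ n * Real.exp (2 * ξ * pathVisits D x l) := by
  have hρ : 1 ≤ Real.exp (2 * ξ) * (1 - ξ) := by
    have := mul_le_mul_of_nonneg_right (Real.add_one_le_exp (2 * ξ)) (by linarith : 0 ≤ 1 - ξ)
    nlinarith
  have hE := Real.exp_pos (2 * ξ)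
  induction n generalizing x l with
  | zero => simpa [chainCount] using Real.one_le_exp (by positivity)
  | succ n ih =>
    have hstep : ∀ y l', y ∈ B n → chainCount B n y l' ≤
        ξ * (ξ⁻¹ ^ (n + 1) * Real.exp (2 * ξ * pathVisits D y l')) := fun y l' _ => by
      refine (ih y l').trans (le_of_eq ?_)
      rw [pow_succ]; field_simp
    induction l generalizing x with
    | nil =>
      rw [chainCount_succ_nil]
      split_ifs with hx
      · refine (hstep x [] hx).trans (mul_le_of_le_one_left (by positivity) (by linarith))
      · positivity
    | cons e l ihl =>
      rw [chainCount_succ_cons]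
      split_ifs with hx
      · have h1 := hstep x (e :: l) hx
        have h2 := ihl (x + e)
        have h3 : Real.exp (2 * ξ * pathVisits D x (e :: l)) =
            Real.exp (2 * ξ) * Real.exp (2 * ξ * pathVisits D (x + e) l) := by
          rw [← Real.exp_add]; simp [pathVisits, hB n hx]; ring
        have h4 : Real.exp (2 * ξ * pathVisits D (x + e) l) ≤
            (1 - ξ) * Real.exp (2 * ξ * pathVisits D x (e :: l)) := by
          rw [h3, ← mul_assoc, mul_comm (1 - ξ)]
          exact le_mul_of_one_le_left (Real.exp_pos _).le hρ
        have h5 := mul_le_mul_of_nonneg_left h4 (by positivity : 0 ≤ ξ⁻¹ ^ (n + 1))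
        linarith
      · rw [zero_add]
        refine (ihl (x + e)).trans ?_
        gcongr
        simp [pathVisits]

/-- With ξ = 1 / (8g) the squared count carries exp (4 ξ T) = exp (T / (2g)), exactly the
exponential moment available. -/
theorem pathMean_chainCount_sq_le (hd : 0 < d) {φ : (Fin d → ℤ) → ℝ} (hφ : IsGreenBound φ)
    {D : Finset (Fin d → ℤ)} (hB : ∀ n, B n ⊆ D) {g : ℝ} (hg : 1 ≤ g)
    (hD : ∀ x, ∑ z ∈ D, φ (x - z) ≤ g) (n N : ℕ) (x : Fin d → ℤ) :
    pathMean N (fun l => chainCount B n x l ^ 2) ≤ 2 * ((8 * g) ^ n) ^ 2 := by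
  have h0 : 0 < g := by linarith
  have h1 : ∀ l, chainCount B n x l ^ 2 ≤
      ((8 * g) ^ n) ^ 2 * Real.exp (pathVisits D x l / (2 * g)) := fun l => by
    have hξ' : (8 * g)⁻¹ ≤ 1 / 2 := by
      rw [inv_le_comm₀ (by positivity) (by norm_num)]; linarith
    have h2 := chainCount_le hB (by positivity : 0 < (8 * g)⁻¹) hξ' n x l
    rw [inv_inv] at h2
    refine (pow_le_pow_left₀ (chainCount_nonneg n x l) h2 2).trans (le_of_eq ?_)
    rw [mul_pow, ← Real.exp_nat_mul]
    congr 2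
    push_cast; field_simp; ring
  refine (pathMean_mono h1 N).trans ?_
  rw [pathMean_const_mul, mul_comm]
  gcongr
  exact hφ.mean_exp_visits_le hd h0 hD N x

theorem pathMean_chainCount_succ (n N : ℕ) (x : Fin d → ℤ) :
    pathMean (N + 1) (chainCount B (n + 1) x) =
      (if x ∈ B n then pathMean (N + 1) (chainCount B n x) else 0) +
        stepAvg (fun y => pathMean N (chainCount B (n + 1) y)) x := by
  have e : chainCount B (n + 1) x = fun l => (if x ∈ B n then chainCount B n x l else 0) +
      (chainCount B (n + 1) x l - if x ∈ B n then chainCount B n x l else 0) := by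
    funext l; ring
  rw [e, pathMean_add]
  congr 1
  · split_ifs
    · rfl
    · exact pathMean_zero_fun _
  · exact pathMean_succ
      (F := fun x l => chainCount B (n + 1) x l - if x ∈ B n then chainCount B n x l else 0)
      (H := fun y l => chainCount B (n + 1) y l) N x fun e l => by
        rw [chainCount_succ_cons]; ring

/-- If the first link takes fewer than m steps, at least M₀ steps remain for the other links. Only a
lower bound is needed, which is why truncated Green functions appear. -/
theorem sum_walkLaw_le_pathMean (n m M₀ : ℕ) {L : (Fin d → ℤ) → ℝ}
    (hL : ∀ M, M₀ ≤ M → ∀ x, L x ≤ pathMean M (chainCount B n x)) (M : ℕ) (hM : M₀ + m ≤ M)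
    (x : Fin d → ℤ) :
    ∑ z ∈ B n, (∑ j ∈ Finset.range m, walkLaw j (x - z)) * L z ≤
      pathMean M (chainCount B (n + 1) x) := by
  induction m generalizing M x with
  | zero => simpa using pathMean_nonneg (chainCount_nonneg (n + 1) x) M
  | succ m ih =>
    obtain ⟨M, rfl⟩ : ∃ M', M = M' + 1 := ⟨M - 1, by omega⟩
    rw [pathMean_chainCount_succ]
    have h1 := stepAvg_mono (ih M (by omega)) x
    have h2 : (if x ∈ B n then L x else 0) ≤
        if x ∈ B n then pathMean (M + 1) (chainCount B n x) else 0 := by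
      split_ifs; exacts [hL _ (by omega) x, le_rfl]
    refine le_trans (le_of_eq ?_) (add_le_add h2 h1)
    rw [stepAvg_sum]
    have e : (if x ∈ B n then L x else 0) = ∑ z ∈ B n, (if x - z = 0 then L z else 0) := by
      simp [sub_eq_zero]
    rw [e, ← Finset.sum_add_distrib]
    refine Finset.sum_congr rfl fun z _ => ?_
    have e2 : stepAvg (fun y => (∑ j ∈ Finset.range m, walkLaw j (y - z)) * L z) x =
        L z * stepAvg (fun y => ∑ j ∈ Finset.range m, walkLaw j y) (x - z) := by
      rw [← stepAvg_sub_right (fun y => ∑ j ∈ Finset.range m, walkLaw j y), ← stepAvg_const_mul]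
      simp only [mul_comm]
    rw [e2, sum_walkLaw_succ]
    split_ifs <;> ring

theorem chainSum_walkLaw_le_pathMean (hd : 0 < d) (m n M : ℕ) (hM : n * m ≤ M) (x : Fin d → ℤ) :
    chainSum (fun x z => ∑ j ∈ Finset.range m, walkLaw j (x - z)) B n x ≤
      pathMean M (chainCount B n x) := by
  induction n generalizing M x with
  | zero => exact (pathMean_const hd 1 M).ge
  | succ n ih =>
    exact sum_walkLaw_le_pathMean n m (n * m) (fun M hM x => ih M hM x) M
      (by rw [add_mul, one_mul] at hM; exact hM) x

theorem exists_half_chainSum_le (hd : 3 ≤ d) (n : ℕ) (x : Fin d → ℤ)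
    (hpos : 0 < chainSum (fun x z => green (x - z)) B n x) :
    ∃ N, chainSum (fun x z => green (x - z)) B n x / 2 ≤ pathMean N (chainCount B n x) := by
  have h := tendsto_chainSum (B := B) (K := fun x z => green (x - z))
    (K' := fun m x z => ∑ j ∈ Finset.range m, walkLaw j (x - z))
    (fun x z => (summable_walkLaw hd (x - z)).tendsto_sum_tsum_nat) n x
  obtain ⟨m, hm⟩ := (h.eventually (lt_mem_nhds (half_lt_self hpos))).exists
  exact ⟨n * m, hm.le.trans (chainSum_walkLaw_le_pathMean (by omega) m n _ le_rfl x)⟩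

/-- `chainCount` on the paths that avoid `y`. -/
def avoidCount (B : ℕ → Finset (Fin d → ℤ)) (y : Fin d → ℤ) (n : ℕ) (x : Fin d → ℤ)
    (l : List (Fin d → ℤ)) : ℝ := if y ∈ pathRange x l then 0 else chainCount B n x l

theorem avoidCount_self (y : Fin d → ℤ) (n : ℕ) (l : List (Fin d → ℤ)) :
    avoidCount B y n y l = 0 := by
  rw [avoidCount, if_pos]
  cases l <;> simp [pathRange]

theorem pathMean_avoidCount_succ (n N : ℕ) {x y : Fin d → ℤ} (hxy : x ≠ y) :
    pathMean (N + 1) (avoidCount B y (n + 1) x) =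
      (if x ∈ B n then pathMean (N + 1) (avoidCount B y n x) else 0) +
        stepAvg (fun w => pathMean N (avoidCount B y (n + 1) w)) x := by
  have e : avoidCount B y (n + 1) x = fun l => (if x ∈ B n then avoidCount B y n x l else 0) +
      (avoidCount B y (n + 1) x l - if x ∈ B n then avoidCount B y n x l else 0) := by
    funext l; ring
  rw [e, pathMean_add]
  congr 1
  · split_ifs
    · rfl
    · exact pathMean_zero_fun _
  · rw [← pathMean_succ
      (F := fun w l => avoidCount B y (n + 1) x l - if x ∈ B n then avoidCount B y n x l else 0)
      (H := fun w l => avoidCount B y (n + 1) w l) N x fun e l => ?_]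
    simp only [avoidCount, pathRange, Finset.mem_insert, hxy.symm, false_or,
      chainCount_succ_cons]
    split_ifs <;> ring

theorem chainSum_killedGreen_succ (hd : 3 ≤ d) {x y : Fin d → ℤ} (hxy : x ≠ y) (n : ℕ) :
    chainSum (killedGreen y) B (n + 1) x =
      (if x ∈ B n then chainSum (killedGreen y) B n x else 0) +
        stepAvg (fun w => chainSum (killedGreen y) B (n + 1) w) x := by
  simp only [chainSum]
  rw [stepAvg_sum]
  have e : (if x ∈ B n then chainSum (killedGreen y) B n x else 0) =
      ∑ z ∈ B n, (if x = z then chainSum (killedGreen y) B n z else 0) := by simp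
  rw [e, ← Finset.sum_add_distrib]
  refine Finset.sum_congr rfl fun z _ => ?_
  have e2 : stepAvg (fun w => killedGreen y w z * chainSum (killedGreen y) B n z) x =
      chainSum (killedGreen y) B n z * stepAvg (fun w => killedGreen y w z) x := by
    rw [← stepAvg_const_mul]; simp only [mul_comm]
  rw [e2, killedGreen_eq hd z hxy]
  split_ifs <;> ring

/-- Off y both sides obey the same first-step recursion; at y the left side vanishes and the right
side is nonnegative. The induction is on the number of links and, inside it, on the length of the
path. -/
theorem pathMean_avoidCount_le (hd : 3 ≤ d) (y : Fin d → ℤ) (n N : ℕ) (x : Fin d → ℤ) :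
    pathMean N (avoidCount B y n x) ≤ chainSum (killedGreen y) B n x := by
  have h0 := fun n x => chainSum_nonneg (B := B) (fun x z => killedGreen_nonneg hd y x z) n x
  induction n generalizing N x with
  | zero =>
    refine (pathMean_mono (g := fun _ => 1) (fun l => ?_) N).trans
      (pathMean_const (by omega) 1 N).le
    unfold avoidCount; split_ifs; exacts [zero_le_one, le_rfl]
  | succ n ih =>
    have hB : ∀ N x, (if x ∈ B n then pathMean N (avoidCount B y n x) else 0) ≤
        if x ∈ B n then chainSum (killedGreen y) B n x else 0 := fun N x => by
      split_ifs; exacts [ih N x, le_rfl]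
    induction N generalizing x with
    | zero =>
      by_cases hxy : x = y
      · subst hxy
        exact (avoidCount_self x _ _).le.trans (h0 _ _)
      rw [chainSum_killedGreen_succ hd hxy]
      refine le_add_of_le_of_nonneg (le_trans (le_of_eq ?_) (hB 0 x)) (stepAvg_nonneg (h0 _) x)
      simp only [pathMean, avoidCount, chainCount_succ_nil]
      split_ifs <;> rfl
    | succ N ihN =>
      by_cases hxy : x = y
      · subst hxy
        have : avoidCount B x (n + 1) x = fun _ => 0 := funext fun l => avoidCount_self x _ l
        rw [this, pathMean_zero_fun]
        exact h0 _ _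
      rw [chainSum_killedGreen_succ hd hxy, pathMean_avoidCount_succ n N hxy]
      exact add_le_add (hB (N + 1) x) (stepAvg_mono ihN x)

end ChainCount

/-! ### Covering most of a ball -/

section Cover

variable {d : ℕ}

/-- Markov's inequality under the weight W = `chainCount B n x`: summing `avoidCount` over y in A
gives W times the number of missed points. -/
theorem pathMean_mul_indicator_le {B : ℕ → Finset (Fin d → ℤ)} (A : Finset (Fin d → ℤ)) {b : ℝ}
    (hb : 0 < b) (n N : ℕ) (x : Fin d → ℤ) :
    pathMean N (fun l => chainCount B n x l *
      {l | b < ((A \ pathRange x l).card : ℝ)}.indicator 1 l) ≤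
      b⁻¹ * ∑ y ∈ A, pathMean N (avoidCount B y n x) := by
  rw [← pathMean_sum, ← pathMean_const_mul]
  refine pathMean_mono (fun l => ?_) N
  have e : ∑ y ∈ A, avoidCount B y n x l = ((A \ pathRange x l).card : ℝ) * chainCount B n x l := by
    simp only [avoidCount]
    rw [← Finset.filter_notMem_eq_sdiff, ← nsmul_eq_mul, ← Finset.sum_const, Finset.sum_filter]
    exact Finset.sum_congr rfl fun y _ => (ite_not _ _ _).symm
  have h0 := chainCount_nonneg (B := B) n x l
  rw [e, Set.indicator_apply]
  split_ifs with h
  · have h : b < ((A \ pathRange x l).card : ℝ) := h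
    rw [Pi.one_apply, mul_one, inv_mul_eq_div, le_div_iff₀ hb, mul_comm]
    gcongr
  · rw [mul_zero]; positivity

/-- Let V be the Green chain sum. At a suitable finite horizon the mean of W is at least V / 2,
while paths missing more than θ |A| points contribute at most V / 4. The remaining V / 4 lives on
the covering event, whose probability is then bounded below through the second moment of W, at most
2 H ^ 2. -/
theorem exists_pathMean_cover_ge (hd : 3 ≤ d) {B : ℕ → Finset (Fin d → ℤ)}
    {A D : Finset (Fin d → ℤ)} (hA : A.Nonempty) {g v q θ : ℝ} (hg : 1 ≤ g)
    (hBD : ∀ n, B n ⊆ D) (hD : ∀ x, ∑ z ∈ D, green (x - z) ≤ g) (hv : 0 < v)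
    (hB : ∀ n, ∀ x, x ∈ B (n + 1) ∨ x = 0 → v ≤ ∑ z ∈ B n, green (x - z)) (hq : 0 ≤ q)
    (hkill : ∀ y ∈ A, ∀ n, ∀ x ∈ B (n + 1), ∀ z ∈ B n, killedGreen y x z ≤ q * green (x - z))
    (hθ : 0 < θ) {n : ℕ} (hn : q ^ n ≤ θ / 4) :
    ∃ N, ((v / (8 * g)) ^ (n + 1)) ^ 2 / 32 ≤
      pathMean N ({l | ((A \ pathRange 0 l).card : ℝ) ≤ θ * A.card}.indicator 1) := by
  have hG0 : ∀ x z : Fin d → ℤ, 0 ≤ green (x - z) := fun x z => green_nonneg _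
  set V := chainSum (fun x z => green (x - z)) B (n + 1) 0 with hV
  have hVv : v ^ (n + 1) ≤ V := pow_le_chainSum hv.le hG0 0 hB (n + 1) (Or.inr rfl)
  have hV0 : 0 < V := lt_of_lt_of_le (by positivity) hVv
  obtain ⟨N, hN⟩ := exists_half_chainSum_le hd (n + 1) 0 hV0
  rw [← hV] at hN
  refine ⟨N, ?_⟩
  have hA0 : (0 : ℝ) < A.card := by exact_mod_cast hA.card_pos
  set b := θ * A.card with hb
  have hb0 : 0 < b := by positivity
  set F : Set (List (Fin d → ℤ)) := {l | ((A \ pathRange 0 l).card : ℝ) ≤ b} with hF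
  set p := pathMean N (F.indicator 1) with hp
  set H := (8 * g) ^ (n + 1) with hH
  have hH0 : 0 < H := by positivity
  set W := chainCount B (n + 1) 0 with hW
  have hmiss : pathMean N (fun l => W l * {l | b < ((A \ pathRange 0 l).card : ℝ)}.indicator 1 l) ≤
      V / 4 := by
    refine (pathMean_mul_indicator_le A hb0 (n + 1) N 0).trans ?_
    have : ∀ y ∈ A, pathMean N (avoidCount B y (n + 1) 0) ≤ θ / 4 * V := fun y hy => by
      refine (pathMean_avoidCount_le hd y (n + 1) N 0).trans ?_
      refine (chainSum_succ_le_pow_mul (K := fun x z => green (x - z)) hq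
        (killedGreen_nonneg hd y) (fun x z => ?_) (hkill y hy) n 0).trans
        (mul_le_mul_of_nonneg_right hn hV0.le)
      exact sub_le_self _ (mul_nonneg (green_nonneg _)
        (div_nonneg (green_nonneg _) (green_nonneg _)))
    refine (mul_le_mul_of_nonneg_left (Finset.sum_le_sum this) (by positivity)).trans
      (le_of_eq ?_)
    rw [Finset.sum_const, nsmul_eq_mul, hb]
    field_simp
  have hsq : pathMean N (fun l => W l ^ 2) ≤ 2 * H ^ 2 :=
    pathMean_chainCount_sq_le (by omega) (isGreenBound_green hd) hBD hg hD (n + 1) N 0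
  set t := V / (8 * H ^ 2) with ht
  have ht0 : 0 < t := by positivity
  -- On the covering event, W ≤ (t / 2) W ^ 2 + 1 / (2t). The value t = V / (8 H ^ 2) makes the
  -- quadratic term cost at most V / 8, so at least V / 8 is left for the probability.
  have hpt : ∀ l, W l ≤ W l * {l | b < ((A \ pathRange 0 l).card : ℝ)}.indicator 1 l +
      (t / 2 * W l ^ 2 + (2 * t)⁻¹ * F.indicator 1 l) := fun l => by
    have hW0 : 0 ≤ W l := chainCount_nonneg _ _ _
    by_cases hl : l ∈ F
    · have hl' : l ∉ {l | b < ((A \ pathRange 0 l).card : ℝ)} :=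
        not_lt.2 (show ((A \ pathRange 0 l).card : ℝ) ≤ b from hl)
      rw [Set.indicator_of_mem hl, Set.indicator_of_notMem hl', Pi.one_apply, mul_zero, zero_add,
        mul_one]
      have e : t / 2 * W l ^ 2 + (2 * t)⁻¹ - W l = (2 * t)⁻¹ * (t * W l - 1) ^ 2 := by
        field_simp; ring
      have : 0 ≤ (2 * t)⁻¹ * (t * W l - 1) ^ 2 := by positivity
      linarith
    · have hl' : l ∈ {l | b < ((A \ pathRange 0 l).card : ℝ)} :=
        show b < ((A \ pathRange 0 l).card : ℝ) from not_le.1 hl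
      rw [Set.indicator_of_notMem hl, Set.indicator_of_mem hl', Pi.one_apply, mul_one, mul_zero,
        add_zero]
      have : 0 ≤ t / 2 * W l ^ 2 := by positivity
      linarith
  have hmean := pathMean_mono hpt N
  rw [pathMean_add, pathMean_add, pathMean_const_mul, pathMean_const_mul] at hmean
  have h1 : t / 2 * pathMean N (fun l => W l ^ 2) ≤ V / 8 := by
    refine (mul_le_mul_of_nonneg_left hsq (by positivity)).trans (le_of_eq ?_)
    rw [ht]; field_simp
  have h2 : (2 * t)⁻¹ * p = 4 * H ^ 2 * p / V := by rw [ht]; field_simp; ring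
  have h3 : V / 8 ≤ (2 * t)⁻¹ * p := by
    change _ ≤ _ + (_ + (2 * t)⁻¹ * p) at hmean
    have : pathMean N (chainCount B (n + 1) 0) = pathMean N fun l => W l := rfl
    linarith
  rw [h2, le_div_iff₀ hV0] at h3
  have h4 : (v ^ (n + 1)) ^ 2 ≤ V ^ 2 := pow_le_pow_left₀ (by positivity) hVv 2
  rw [div_pow, ← hH, div_pow, div_div, div_le_iff₀ (by positivity)]
  linarith

theorem sum_decay_latticeBall_le (hd : 2 ≤ d) {R : ℕ} (hR : 1 ≤ R) (x : Fin d → ℤ) :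
    ∑ z ∈ latticeBall d R, decay (x - z) ≤ 4 ^ (d - 2) * 3 ^ d * 32 * (R : ℝ) ^ 2 := by
  set i := Nat.log 2 R + 1 with hi
  have h1 : R < 2 ^ i := Nat.lt_pow_succ_log_self (by norm_num) R
  have h2 : 2 ^ i ≤ 2 * R := by
    have := Nat.pow_log_le_self 2 (show R ≠ 0 by omega)
    rw [hi, pow_succ]; omega
  have h3 : ballPart (latticeBall d R) 0 (2 ^ i) = latticeBall d R := by
    ext z
    rw [mem_ballPart, and_iff_left_iff_imp, mem_latticeBall, sub_zero]
    exact fun h => h.trans (by exact_mod_cast h1.le)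
  have h := sum_decay_le_of_growth (A := latticeBall d R) (f := fun j => 3 ^ d * (2 ^ j) ^ d)
    (fun j => by positivity) (fun z _ j => card_ballPart_le _ z j) 0 i x
  rw [h3] at h
  have e : ∀ j : ℕ, 3 ^ d * ((2 : ℝ) ^ j) ^ d / (2 ^ j) ^ (d - 2) = 3 ^ d * 4 ^ j := fun j => by
    have e2 : ((2 : ℝ) ^ j) ^ d = (2 ^ j) ^ (d - 2) * (2 ^ j) ^ 2 := by
      rw [← pow_add]; congr 1; omega
    have e3 : ((2 : ℝ) ^ j) ^ 2 = 4 ^ j := by rw [← pow_mul, mul_comm, pow_mul]; norm_num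
    rw [e2, e3]; field_simp
  simp only [e, ← Finset.mul_sum] at h
  refine h.trans ?_
  have h4 := sum_four_pow_le (i + 1)
  have h5 : (4 : ℝ) ^ (i + 1) ≤ 16 * (R : ℝ) ^ 2 := by
    have : ((2 : ℝ) ^ i) ≤ 2 * R := by exact_mod_cast h2
    have h6 := pow_le_pow_left₀ (by positivity) this 2
    have e3 : ((2 : ℝ) ^ i) ^ 2 = 4 ^ i := by rw [← pow_mul, mul_comm, pow_mul]; norm_num
    rw [e3] at h6
    rw [pow_succ]; linarith
  calc (4 : ℝ) ^ (d - 2) * (3 ^ d * ∑ j ∈ Finset.range (i + 2), 4 ^ j)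
      ≤ 4 ^ (d - 2) * (3 ^ d * (32 * R ^ 2)) := by gcongr; linarith
    _ = _ := by ring

/-- Balls of radius `r` at distances of order `r` from the origin and, for indices of different
parity, from each other. -/
noncomputable def sideBall (i₀ : Fin d) (r n : ℕ) : Finset (Fin d → ℤ) :=
  (latticeBall d r).map
    (Equiv.addLeft (Pi.single i₀ (if Even n then 4 * r else 8 * r : ℤ))).toEmbedding

theorem norm_sub_le_of_mem_sideBall {i₀ : Fin d} {r n : ℕ} {x : Fin d → ℤ}
    (hx : x ∈ sideBall i₀ r n) :
    ‖x - Pi.single i₀ (if Even n then 4 * r else 8 * r : ℤ)‖ ≤ r := by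
  simp only [sideBall, Finset.mem_map, mem_latticeBall] at hx
  obtain ⟨y, hy, rfl⟩ := hx
  simpa using hy

theorem norm_le_of_mem_sideBall {i₀ : Fin d} {r n : ℕ} {x : Fin d → ℤ}
    (hx : x ∈ sideBall i₀ r n) : ‖x‖ ≤ 9 * r := by
  have h1 := norm_sub_le_of_mem_sideBall hx
  have h2 : ‖(Pi.single i₀ (if Even n then 4 * r else 8 * r : ℤ) : Fin d → ℤ)‖ ≤ 8 * r := by
    rw [Pi.norm_single, Int.norm_eq_abs]
    split_ifs <;> push_cast <;> rw [abs_of_nonneg (by positivity)]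
    linarith [r.cast_nonneg (α := ℝ)]
  have h3 := norm_add_le (x - Pi.single i₀ (if Even n then 4 * r else 8 * r : ℤ))
    (Pi.single i₀ (if Even n then 4 * r else 8 * r : ℤ))
  rw [sub_add_cancel] at h3
  linarith

theorem le_norm_sub_of_mem_sideBall {i₀ : Fin d} {r n : ℕ} {x z : Fin d → ℤ}
    (hx : x ∈ sideBall i₀ r (n + 1)) (hz : z ∈ sideBall i₀ r n) : 2 * (r : ℝ) ≤ ‖x - z‖ := by
  have h1 := (norm_le_pi_norm _ i₀).trans (norm_sub_le_of_mem_sideBall hx)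
  have h2 := (norm_le_pi_norm _ i₀).trans (norm_sub_le_of_mem_sideBall hz)
  refine le_trans ?_ (norm_le_pi_norm (x - z) i₀)
  rw [Pi.sub_apply, Int.norm_eq_abs] at *
  simp only [Pi.single_eq_same, Nat.even_add_one] at h1 h2
  by_cases hn : Even n
  · simp only [hn, not_true_eq_false, if_true, if_false] at h1 h2
    push_cast at *
    rw [abs_le] at h1 h2
    exact le_trans (by linarith) (le_abs_self _)
  · simp only [hn, not_false_eq_true, if_true, if_false] at h1 h2
    push_cast at *
    rw [abs_le] at h1 h2
    exact le_trans (by linarith) (neg_le_abs _)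

theorem card_sideBall (i₀ : Fin d) (r n : ℕ) : (sideBall i₀ r n).card = (2 * r + 1) ^ d := by
  rw [sideBall, Finset.card_map, card_latticeBall]

theorem le_decay_of_norm_le {x : Fin d → ℤ} {r : ℕ} (hr : 1 ≤ r) (h : ‖x‖ ≤ 18 * r) :
    (19 ^ (d - 2) * (r : ℝ) ^ (d - 2))⁻¹ ≤ decay x := by
  have hr' : (1 : ℝ) ≤ r := by exact_mod_cast hr
  unfold decay
  rw [← mul_pow]
  gcongr
  linarith

theorem decay_le_of_le_norm {x : Fin d → ℤ} {r : ℕ} (hr : 1 ≤ r) (h : (r : ℝ) ≤ ‖x‖) :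
    decay x ≤ ((r : ℝ) ^ (d - 2))⁻¹ := by
  unfold decay
  gcongr
  linarith

/-- Simple random walk covers most of a ball of radius `r` with probability at least
`exp (-C * r ^ (d - 2))`. -/
theorem exists_cover_latticeBall (hd : 3 ≤ d) {θ : ℝ} (hθ : 0 < θ) : ∃ C : ℝ, 0 < C ∧
    ∀ r : ℕ, 1 ≤ r → ∃ N, Real.exp (-C * (r : ℝ) ^ (d - 2)) ≤
      pathMean N ({l | ((latticeBall d r \ pathRange 0 l).card : ℝ) ≤
        θ * (latticeBall d r).card}.indicator 1) := by
  obtain ⟨C, hC, hup⟩ := exists_green_le hd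
  obtain ⟨c, hc, hlow⟩ := exists_le_green hd
  set i₀ : Fin d := ⟨0, by omega⟩ with hi₀
  have hG0 := green_pos hd (0 : Fin d → ℤ)
  -- With s = r ^ (d - 2), the links through y have weight at least (a / s) ^ 2 / green 0, the whole
  -- link at most C / s; the ratio is ε / s. Killing at y thus costs a factor at most 1 - ε / s ≤
  -- exp (-(ε / s)) per link.
  set ε : ℝ := c ^ 2 / (C * green (0 : Fin d → ℤ) * (19 ^ (d - 2)) ^ 2) with hε
  have hε0 : 0 < ε := by positivity
  set a : ℝ := c / 19 ^ (d - 2) with ha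
  have ha0 : 0 < a := by positivity
  set b : ℝ := max 1 (C * (4 ^ (d - 2) * 3 ^ d * 32 * 81)) with hb
  have hb1 : 1 ≤ b := le_max_left _ _
  -- Both v = a r ^ 2 and g = b r ^ 2 scale like r ^ 2, so v / (8g) does not depend on r, and the
  -- price of n + 1 links is exponential in n alone.
  set κ : ℝ := a / (8 * b) with hκ
  have hκ0 : 0 < κ := by positivity
  -- About K s links bring exp (-(ε / s)) ^ n below θ / 4. The maximum with 0 covers θ > 4.
  set K : ℝ := max 0 (Real.log (4 / θ) / ε) with hK
  have hK0 : 0 ≤ K := le_max_left _ _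
  refine ⟨(K + 2) * 2 * |Real.log κ| + 4, by positivity, fun r hr => ?_⟩
  have hr' : (1 : ℝ) ≤ r := by exact_mod_cast hr
  set s : ℝ := (r : ℝ) ^ (d - 2) with hs
  have hs1 : 1 ≤ s := one_le_pow₀ hr'
  have hs0 : 0 < s := by linarith
  set n : ℕ := ⌈K * s⌉₊ with hn
  have hn1 : K * s ≤ n := Nat.le_ceil _
  have hn2 : (n : ℝ) ≤ K * s + 1 := (Nat.ceil_lt_add_one (by positivity)).le
  have hfar : ∀ w : Fin d → ℤ, ‖w‖ ≤ 18 * r → a / s ≤ green w := fun w hw => by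
    refine le_trans (le_of_eq ?_) ((mul_le_mul_of_nonneg_left
      (le_decay_of_norm_le hr hw) hc.le).trans (hlow w))
    rw [ha]; field_simp; rfl
  have e : a * (r : ℝ) ^ 2 / (8 * (b * r ^ 2)) = κ := by rw [hκ]; field_simp
  have h1 : Real.exp (-((K + 2) * 2 * |Real.log κ| * s)) ≤ κ ^ ((n + 1) * 2) := by
    rw [← Real.exp_log (pow_pos hκ0 _), Real.log_pow]
    refine Real.exp_le_exp.2 ?_
    push_cast
    have h2 : ((n : ℝ) + 1) * 2 ≤ (K + 2) * 2 * s := by nlinarith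
    have h3 := mul_le_mul_of_nonneg_right h2 (abs_nonneg (Real.log κ))
    have h4 := mul_le_mul_of_nonneg_left (neg_abs_le (Real.log κ))
      (by positivity : 0 ≤ ((n : ℝ) + 1) * 2)
    linarith
  have h2 : Real.exp (-(4 * s)) ≤ 1 / 32 := by
    have h3 : Real.exp (-(4 * s)) ≤ Real.exp (-4) := Real.exp_le_exp.2 (by linarith)
    have h4 : (32 : ℝ) ≤ Real.exp 4 := by
      have := Real.exp_one_gt_d9
      calc (32 : ℝ) ≤ 2.7 ^ 4 := by norm_num
        _ ≤ Real.exp 1 ^ 4 := by gcongr; linarith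
        _ = Real.exp 4 := by rw [← Real.exp_nat_mul]; norm_num
    refine h3.trans ?_
    rw [Real.exp_neg, one_div]
    exact inv_anti₀ (by norm_num) h4
  have hfin : Real.exp (-((K + 2) * 2 * |Real.log κ| + 4) * s) ≤
      ((a * (r : ℝ) ^ 2 / (8 * (b * r ^ 2))) ^ (n + 1)) ^ 2 / 32 := by
    rw [e, ← pow_mul]
    calc Real.exp (-((K + 2) * 2 * |Real.log κ| + 4) * s)
        = Real.exp (-((K + 2) * 2 * |Real.log κ| * s)) * Real.exp (-(4 * s)) := by
          rw [← Real.exp_add]; congr 1; ring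
      _ ≤ κ ^ ((n + 1) * 2) * (1 / 32) := mul_le_mul h1 h2 (Real.exp_pos _).le (by positivity)
      _ = _ := by ring
  refine (exists_pathMean_cover_ge hd (B := sideBall i₀ r) (A := latticeBall d r)
    (D := latticeBall d (9 * r)) (g := b * r ^ 2) (v := a * r ^ 2) (q := Real.exp (-(ε / s)))
    (θ := θ) (n := n) ⟨0, by simp [mem_latticeBall]⟩ ?_ ?_ ?_ (by positivity) ?_
    (Real.exp_pos _).le ?_ hθ ?_).imp fun N hN => hfin.trans hN
  · nlinarith
  · intro m x hx
    rw [mem_latticeBall]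
    push_cast
    exact norm_le_of_mem_sideBall hx
  · intro x
    have h1 := mul_le_mul_of_nonneg_left
      (sum_decay_latticeBall_le (by omega) (by omega : 1 ≤ 9 * r) x) hC.le
    rw [Finset.mul_sum] at h1
    refine (Finset.sum_le_sum fun z _ => hup (x - z)).trans (h1.trans ?_)
    have h2 : C * (4 ^ (d - 2) * 3 ^ d * 32 * 81) * (r : ℝ) ^ 2 ≤ b * r ^ 2 := by
      gcongr; exact le_max_right _ _
    refine le_trans (le_of_eq ?_) h2
    push_cast; ring
  · intro m x hx
    have hx' : ‖x‖ ≤ 9 * r := by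
      rcases hx with hx | rfl
      · exact norm_le_of_mem_sideBall hx
      · rw [norm_zero]; positivity
    have h1 : ∀ z ∈ sideBall i₀ r m, a / s ≤ green (x - z) := fun z hz => by
      refine hfar _ ((norm_sub_le x z).trans ?_)
      linarith [norm_le_of_mem_sideBall hz]
    have h2 := Finset.card_nsmul_le_sum _ _ _ h1
    rw [card_sideBall, nsmul_eq_mul] at h2
    refine le_trans ?_ h2
    have h3 : s * (r : ℝ) ^ 2 ≤ ((2 * r + 1 : ℕ) : ℝ) ^ d := by
      rw [hs, ← pow_add, show d - 2 + 2 = d by omega]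
      gcongr
      omega
    push_cast at h3 ⊢
    rw [mul_div_assoc', le_div_iff₀ hs0]
    calc a * (r : ℝ) ^ 2 * s = s * (r : ℝ) ^ 2 * a := by ring
      _ ≤ _ := by gcongr
  · intro y hy m x hx z hz
    rw [mem_latticeBall] at hy
    have h1 : a / s ≤ green (x - y) := hfar _ ((norm_sub_le x y).trans (by
      linarith [norm_le_of_mem_sideBall hx]))
    have h2 : a / s ≤ green (y - z) := hfar _ ((norm_sub_le y z).trans (by
      linarith [norm_le_of_mem_sideBall hz]))
    have h3 : green (x - z) ≤ C / s := by
      refine (hup _).trans ?_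
      rw [div_eq_mul_inv]
      gcongr
      exact decay_le_of_le_norm hr (by linarith [le_norm_sub_of_mem_sideBall hx hz])
    have h4 : green (x - z) * (ε / s) ≤
        green (x - y) * (green (y - z) / green (0 : Fin d → ℤ)) := by
      calc green (x - z) * (ε / s) ≤ C / s * (ε / s) := by gcongr
        _ = a / s * (a / s / green (0 : Fin d → ℤ)) := by rw [hε, ha]; field_simp
        _ ≤ _ := mul_le_mul h1 (by gcongr) (by positivity) (green_nonneg _)
    have h5 := mul_le_mul_of_nonneg_left (Real.add_one_le_exp (-(ε / s))) (green_nonneg (x - z))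
    unfold killedGreen
    linarith
  · rw [← Real.exp_nat_mul, ← Real.exp_log (by positivity : 0 < θ / 4)]
    refine Real.exp_le_exp.2 ?_
    have h1 : Real.log (4 / θ) / ε * s ≤ n := le_trans (by gcongr; exact le_max_right _ _) hn1
    have h2 : Real.log (θ / 4) = -Real.log (4 / θ) := by rw [← Real.log_inv, inv_div]
    rw [h2]
    have h3 : Real.log (4 / θ) ≤ n * (ε / s) := by
      rw [mul_div_assoc', le_div_iff₀ hs0]
      rw [div_mul_eq_mul_div, div_le_iff₀ hε0] at h1
      exact h1
    linarith

end Cover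

/-! ### Lower bound and conclusion -/

/-- If each of the k walks misses at most the fraction 1 / (2k) of A, together they miss at most
half, and the other half is common. Independence gives the k-th power. -/
theorem AreIndepSimpleRandomWalks.pathMean_pow_le {Ω : Type*} [MeasurableSpace Ω]
    {μ : Measure Ω} [IsProbabilityMeasure μ] {d k : ℕ} {S : Fin k → ℕ → Ω → (Fin d → ℤ)}
    (hS : AreIndepSimpleRandomWalks μ S) {A : Finset (Fin d → ℤ)} {t : ℝ} (ht : 0 ≤ t)
    (hk : 0 < k) (hA : t < A.card / 2) (N : ℕ) :
    pathMean N ({l | ((A \ pathRange 0 l).card : ℝ) ≤ 1 / (2 * k) * A.card}.indicator 1) ^ k ≤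
      μ.real (rangesIntersectionGT S t) := by
  set Q : Set (List (Fin d → ℤ)) :=
    {l | ((A \ pathRange 0 l).card : ℝ) ≤ 1 / (2 * k) * A.card} with hQ
  have hk' : (0 : ℝ) < k := by exact_mod_cast hk
  have h := hS.real_iInter_prefix (fun _ => N) (fun _ => Q) Set.univ
  simp only [Set.mem_univ, exists_const, and_true, (hS.walk _).real_slice_eq, Finset.prod_const,
    Finset.card_univ, Fintype.card_fin] at h
  rw [← h]
  refine measureReal_mono (fun ω hω => ?_) (measure_ne_top μ _)
  set l : Fin k → List (Fin d → ℤ) := fun i => slice (fun n => S i (n + 1) ω - S i n ω) 0 N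
    with hl
  have hω : ∀ i, ((A \ pathRange 0 (l i)).card : ℝ) ≤ 1 / (2 * k) * A.card := hω
  set M := Finset.univ.biUnion fun i => A \ pathRange 0 (l i) with hM
  have hMc : (M.card : ℝ) ≤ A.card / 2 := by
    have h1 : (M.card : ℝ) ≤ ∑ i : Fin k, ((A \ pathRange 0 (l i)).card : ℝ) := by
      exact_mod_cast Finset.card_biUnion_le
    refine h1.trans ((Finset.sum_le_sum fun i _ => hω i).trans (le_of_eq ?_))
    rw [Finset.sum_const, Finset.card_univ, Fintype.card_fin, nsmul_eq_mul]
    field_simp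
  have hAM : (A.card : ℝ) ≤ (A \ M).card + M.card := by
    exact_mod_cast Nat.sub_le_iff_le_add.1 (Finset.le_card_sdiff M A)
  have hsub : ((A \ M : Finset (Fin d → ℤ)) : Set (Fin d → ℤ)) ⊆
      ⋂ i, Set.range fun n => S i n ω := by
    intro x hx
    rw [Finset.mem_coe, Finset.mem_sdiff] at hx
    refine Set.mem_iInter.2 fun i => ?_
    have hxi : x ∈ pathRange 0 (l i) := by
      by_contra hc
      exact hx.2 (Finset.mem_biUnion.2 ⟨i, Finset.mem_univ i, Finset.mem_sdiff.2 ⟨hx.1, hc⟩⟩)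
    obtain ⟨j, -, hj⟩ := ((hS.walk i).mem_pathRange_slice ω N x).1 hxi
    exact ⟨j, hj⟩
  have h3 : ((A \ M).card : ENNReal) ≤ ((⋂ i, Set.range fun n => S i n ω).encard : ENNReal) := by
    have := Set.encard_le_encard hsub
    rw [Set.encard_coe_eq_coe_finsetCard] at this
    exact_mod_cast this
  refine lt_of_lt_of_le ?_ h3
  rw [← ENNReal.ofReal_natCast]
  exact (ENNReal.ofReal_lt_ofReal_iff_of_nonneg ht).2 (by linarith)

theorem exists_lower_bound {d : ℕ} (hd : 3 ≤ d) {k : ℕ} (hk : 0 < k) : ∃ c : ℝ, 0 < c ∧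
    ∀ (Ω : Type*) [MeasurableSpace Ω] (μ : Measure Ω)
      [IsProbabilityMeasure μ] (S : Fin k → ℕ → Ω → (Fin d → ℤ)),
      AreIndepSimpleRandomWalks μ S → ∀ t : ℝ, 1 < t →
        Real.exp (-c * t ^ (1 - 2 / (d : ℝ))) ≤ μ.real (rangesIntersectionGT S t) := by
  have hk' : (0 : ℝ) < k := by exact_mod_cast hk
  have hd' : (0 : ℝ) < d := by exact_mod_cast (by omega : 0 < d)
  obtain ⟨C, hC, hcov⟩ := exists_cover_latticeBall hd (by positivity : (0 : ℝ) < 1 / (2 * k))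
  refine ⟨k * (C * 2 ^ (d - 2)), by positivity, fun Ω _ μ _ S hS t ht => ?_⟩
  have ht0 : 0 < t := by linarith
  set ρ : ℝ := t ^ (1 / (d : ℝ)) with hρ
  have hρ1 : 1 ≤ ρ := Real.one_le_rpow ht.le (by positivity)
  have hρd : ρ ^ d = t := by
    rw [hρ, ← Real.rpow_natCast, ← Real.rpow_mul ht0.le, one_div_mul_cancel hd'.ne', Real.rpow_one]
  have hρd2 : ρ ^ (d - 2) = t ^ (1 - 2 / (d : ℝ)) := by
    rw [hρ, ← Real.rpow_natCast, ← Real.rpow_mul ht0.le]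
    congr 1
    push_cast [Nat.cast_sub (by omega : 2 ≤ d)]; field_simp
  -- The ball of radius r ≥ t ^ (1 / d) has (2r + 1) ^ d points, more than 2t; and ρ ≥ 1 gives r ≤
  -- 2ρ, so r ^ (d - 2) is still of order t ^ (1 - 2 / d).
  set r := ⌈ρ⌉₊ with hr
  have hr1 : ρ ≤ r := Nat.le_ceil _
  have hr2 : (r : ℝ) ≤ 2 * ρ := by linarith [Nat.ceil_lt_add_one (by linarith : 0 ≤ ρ)]
  obtain ⟨N, hN⟩ := hcov r (Nat.one_le_iff_ne_zero.2 fun h0 => by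
    rw [h0] at hr1; norm_num at hr1; linarith)
  have hA : t < ((latticeBall d r).card : ℝ) / 2 := by
    rw [card_latticeBall, lt_div_iff₀ two_pos]
    push_cast
    calc t * 2 < 2 ^ 2 * t := by linarith
      _ ≤ 2 ^ d * ρ ^ d := by
          rw [hρd]; gcongr
          · norm_num
          · omega
      _ = (2 * ρ) ^ d := (mul_pow _ _ _).symm
      _ ≤ _ := by gcongr; linarith
  refine le_trans ?_ ((pow_le_pow_left₀ (Real.exp_pos _).le hN k).trans
    (hS.pathMean_pow_le ht0.le hk hA N))
  rw [← Real.exp_nat_mul]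
  refine Real.exp_le_exp.2 ?_
  rw [← hρd2]
  have h1 : (r : ℝ) ^ (d - 2) ≤ 2 ^ (d - 2) * ρ ^ (d - 2) := by
    rw [← mul_pow]; gcongr
  have h2 := mul_le_mul_of_nonneg_left h1 (by positivity : 0 ≤ k * C)
  linarith

theorem theorem1p6 :
    (∀ d k : ℕ, 5 ≤ d → 2 ≤ k → ∃ c₁ c₂ : ℝ, 0 < c₁ ∧ 0 < c₂ ∧
      ∀ (Ω : Type*) [MeasurableSpace Ω] (μ : Measure Ω) [IsProbabilityMeasure μ]
        (S : Fin k → ℕ → Ω → (Fin d → ℤ)), AreIndepSimpleRandomWalks μ S → ∀ t : ℝ, 1 < t →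
        Real.exp (-c₁ * t ^ (1 - 2 / (d : ℝ))) ≤ μ.real (rangesIntersectionGT S t) ∧
        μ.real (rangesIntersectionGT S t) ≤ Real.exp (-c₂ * t ^ (1 - 2 / (d : ℝ)))) ∧
    (∀ k : ℕ, 3 ≤ k → ∃ c₁ c₂ : ℝ, 0 < c₁ ∧ 0 < c₂ ∧
      ∀ (Ω : Type*) [MeasurableSpace Ω] (μ : Measure Ω) [IsProbabilityMeasure μ]
        (S : Fin k → ℕ → Ω → (Fin 4 → ℤ)), AreIndepSimpleRandomWalks μ S →
        ∀ t : ℝ, Real.exp 1 < t →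
        Real.exp (-c₁ * Real.sqrt t) ≤ μ.real (rangesIntersectionGT S t) ∧
        μ.real (rangesIntersectionGT S t) ≤
          Real.exp (-c₂ * (t / Real.log t) ^ (1 / 2 : ℝ))) ∧
    (∀ k : ℕ, 4 ≤ k → ∃ c₁ c₂ : ℝ, 0 < c₁ ∧ 0 < c₂ ∧
      ∀ (Ω : Type*) [MeasurableSpace Ω] (μ : Measure Ω) [IsProbabilityMeasure μ]
        (S : Fin k → ℕ → Ω → (Fin 3 → ℤ)), AreIndepSimpleRandomWalks μ S →
        ∀ t : ℝ, Real.exp 1 < t →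
        Real.exp (-c₁ * t ^ (1 / 3 : ℝ)) ≤ μ.real (rangesIntersectionGT S t) ∧
        μ.real (rangesIntersectionGT S t) ≤
          Real.exp (-c₂ * (t / Real.log t) ^ (1 / 3 : ℝ))) := by
  have h1 : (1 : ℝ) < Real.exp 1 := Real.one_lt_exp_iff.2 one_pos
  refine ⟨fun d k hd hk => ?_, fun k hk => ?_, fun k hk => ?_⟩
  · obtain ⟨c₁, hc₁, hl⟩ := exists_lower_bound (d := d) (by omega) (by omega : 0 < k)
    obtain ⟨c₂, hc₂, hu⟩ := exists_upper_bound (d := d) (by omega)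
    refine ⟨c₁, c₂, hc₁, hc₂, fun Ω _ μ _ S hS t ht => ⟨hl Ω μ S hS t ht, ?_⟩⟩
    have := hu k (by simp only [critWalks]; split_ifs <;> omega) Ω μ S hS t ht (by omega)
    rwa [effLevel, if_neg (by omega)] at this
  · obtain ⟨c₁, hc₁, hl⟩ := exists_lower_bound (d := 4) (by omega) (by omega : 0 < k)
    obtain ⟨c₂, hc₂, hu⟩ := exists_upper_bound (d := 4) (by omega)
    refine ⟨c₁, c₂, hc₁, hc₂, fun Ω _ μ _ S hS t ht => ⟨?_, ?_⟩⟩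
    · have := hl Ω μ S hS t (h1.trans ht)
      rw [Real.sqrt_eq_rpow]
      norm_num at this ⊢
      exact this
    · have := hu k (by simpa [critWalks] using hk) Ω μ S hS t (h1.trans ht) fun _ => ht
      rw [effLevel, if_pos le_rfl] at this
      norm_num at this ⊢
      exact this
  · obtain ⟨c₁, hc₁, hl⟩ := exists_lower_bound (d := 3) (by omega) (by omega : 0 < k)
    obtain ⟨c₂, hc₂, hu⟩ := exists_upper_bound (d := 3) (by omega)
    refine ⟨c₁, c₂, hc₁, hc₂, fun Ω _ μ _ S hS t ht => ⟨?_, ?_⟩⟩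
    · have := hl Ω μ S hS t (h1.trans ht)
      norm_num at this ⊢
      exact this
    · have := hu k (by simpa [critWalks] using hk) Ω μ S hS t (h1.trans ht) fun _ => ht
      rw [effLevel, if_pos (by norm_num)] at this
      norm_num at this ⊢
      exact this
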